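/- Let $r$ be a fixed number of factors and let $x_{it}=\Lambda_i^{0\prime}F_t^0+e_{it}$, $i\le N$, $t\le T$, where the loadings $\Lambda^0_i\in\mathbb R^r$, the factors $F^0_t\in\mathbb R^r$ and the errors $e_{it}\in\mathbb R$ (square integrable) are random variables on one probability space. The loadings have the form $\Lambda_i^0=c_N\lambda_i$ with nonrandom scales $c_N\in(0,1]$ and vectors $\lambda_i$, random or not, that do not depend on $N$ ($c_N\equiv1$: loadings that do not vary with $N$; $c_N=N^{-\tau}$: uniformly shrinking ones). In matrices, $\mathbf X=\mathbf F^0\mathbf\Lambda^{0\prime}+\mathbf e$ with $\mathbf X,\mathbf e$ of size $T\times N$; $e_t=(e_{1t},\dots,e_{Nt})'$ and $e_i=(e_{i1},\dots,e_{iT})'$. Let $\|\cdot\|$ be the Euclidean/Frobenius norm, $\|\cdot\|_{sp}$ the spectral norm, $\delta_{NT}=\min(\sqrt N,\sqrt T)$, and let $M<\infty$ not depend on $N$ and $T$. All $O_p$ statements, and all limits in which $N$ and $T$ both appear, are along a sequence of panel sizes $(N,T)=(N_n,T_n)$ with $N_n,T_n\to\infty$. The principal components estimator is $(\tilde{\mathbf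 F},\tilde{\mathbf\Lambda})=(\sqrt T\,\mathbf U_r,\sqrt N\,\mathbf V_r\mathbf D_r)$, where $\mathbf D_r$ holds the $r$ largest singular values in some singular value decomposition $\mathbf U\mathbf D\mathbf V'$ of $\mathbf X/\sqrt{NT}$ and $\mathbf U_r,\mathbf V_r$ the corresponding singular vectors; $\tilde C_{it}=\tilde\Lambda_i'\tilde F_t$ and $C^0_{it}=\Lambda_i^{0\prime}F_t^0$. Assumption A. (A1) $E(e_{it}\mid\Lambda_i^0,F_t^0)=0$; $E\big[N^{-1/2}\sum_{i\le N}(e_{it}e_{is}-E e_{it}e_{is})\big]^2\le M$ for all $N,t,s$; $T^{-1}\sum_{t,s\le T}|E(e_{it}e_{is})|\le M$ for all $i,T$ and $N^{-1}\sum_{i,j\le N}|E(e_{it}e_{jt})|\le M$ for all $t,N$; $\frac1{N\sqrt T}\|e_t'\mathbf e'\|=O_p(\delta_{NT}^{-1})$ for each $t$ and $\frac1{T\sqrt N}\|e_i'\mathbf e\|=O_p(\delta_{NT}^{-1})$ for each $i$; $\|\mathbf e\|_{sp}^2=O_p(\max\{N,T\})$. (A2) $E\|F^0_t\|^4\le M$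 and $\mathbf F^{0\prime}\mathbf F^0/T\to\mathbf\Sigma_F$ in probability as $T\to\infty$, $\mathbf\Sigma_F$ positive definite; $\|\lambda_i\|\le M$ almost surely (hence $\|\Lambda^0_i\|\le M$) and $\mathbf\Lambda^{0\prime}\mathbf\Lambda^0/N^\alpha\to\mathbf\Sigma_\Lambda$ in probability as $N\to\infty$, $\mathbf\Sigma_\Lambda$ positive definite, for some $\alpha\in(0,1]$; the eigenvalues of $\mathbf\Sigma_\Lambda\mathbf\Sigma_F$ are distinct. (A3) For each $t$: $E\|N^{-\alpha/2}\sum_{i\le N}\Lambda_i^0e_{it}\|^2\le M$ for all $N$, and $\frac1{NT}e_t'\mathbf e'\mathbf F^0=O_p(\delta_{NT}^{-2})$; for each $i$: $E\|T^{-1/2}\sum_{t\le T}F_t^0e_{it}\|^2\le M$ for all $T$, and $\frac1{N^\alpha T}e_i'\mathbf e\mathbf\Lambda^0=O_p(N^{-\alpha})+O_p((TN^\alpha)^{-1/2})$; and $\sum_{i\le N}\sum_{t\le T}\Lambda_i^0F_t^{0\prime}e_{it}=O_p(\sqrt{N^\alpha T})$. (A4) $\frac N{N^\alpha}\frac1T\to0$.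 Assumption B. There are positive definite $r\times r$ matrices $\mathbf\Gamma_t$, $\mathbf\Phi_i$ such that, for each $i$ and $t$, $N^{-\alpha/2}\sum_{j\le N}\Lambda^0_je_{jt}\to\mathcal N(0,\mathbf\Gamma_t)$ and $T^{-1/2}\sum_{s\le T}F_s^0e_{is}\to\mathcal N(0,\mathbf\Phi_i)$ in distribution, jointly with $(\lambda_i,F_t^0)$, where the two Gaussian limits are independent of each other and of $(\lambda_i,F^0_t)$. Assumption C. $\alpha>\frac12$, $\frac{\sqrt T}{N^\alpha}\to0$, $\frac1{\sqrt T}\frac N{N^\alpha}\to0$ and $\frac1T\frac{N^{3/2}}{N^\alpha}\to0$. Proposition. Under Assumptions A, B and C, for every $i$ and $t$ such that almost surely $\lambda_i\neq0$ or $F_t^0\neq0$ (so that the asymptotic variance is not zero), $$\frac{\tilde C_{it}-C^0_{it}}{\sqrt{N^{-\alpha}W^\Lambda_{it}+T^{-1}W^F_{it}}}\ \to\ \mathcal N(0,1)\quad\text{in distribution},$$ where $W^\Lambda_{it}=\Lambda_i^{0\prime}\mathbf\Sigma_\Lambda^{-1}\mathbf\Gamma_t\mathbf\Sigma_\Lambda^{-1}\Lambda_i^0$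 and $W^F_{it}=F_t^{0\prime}\mathbf\Sigma_F^{-1}\mathbf\Phi_i\mathbf\Sigma_F^{-1}F_t^0$. In particular $\tilde C_{it}-C_{it}^0=O_p\big(1/\min(\sqrt{N^\alpha},\sqrt T)\big)$. -/

import Mathlib

open MeasureTheory ProbabilityTheory Filter Topology
open scoped ENNReal Matrix Matrix.Norms.L2Operator

noncomputable section

namespace WeakFactor

/-- `X n = O_p(a n)` as `n → ∞`: for every `ε > 0` there is `K` such that
`P(|X n| > K a n) ≤ ε` for all large `n`. -/
def IsBigOP {Ω : Type*} [MeasurableSpace Ω] (μ : Measure Ω) (X : ℕ → Ω → ℝ) (a : ℕ → ℝ) : Prop :=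
  ∀ ε : ℝ, 0 < ε → ∃ K : ℝ, ∀ᶠ n in atTop, μ {ω | K * a n < |X n ω|} ≤ ENNReal.ofReal ε

/-- `δ_{NT} = min(√N, √T)`. -/
def delta (N T : ℕ) : ℝ := min (√(N : ℝ)) (√(T : ℝ))

variable {Ω : Type*} {r : ℕ}

/-- The loadings `Λ⁰_i = c_N λ_i` in a panel with `N` units: `λ_i` is a possibly random vector that
does not depend on `N`, and `c_N` a nonrandom scale (`c = 1` for loadings that do not vary with `N`,
`c_N = N^{-τ}` for uniformly shrinking ones). -/
def loading (c : ℕ → ℝ) (lam : ℕ → Ω → EuclideanSpace ℝ (Fin r)) (N : ℕ) :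
    ℕ → Ω → EuclideanSpace ℝ (Fin r) :=
  fun i ω => c N • lam i ω

/-- The `T × N` error matrix `𝐞 = (e_{it})`, rows indexed by time, columns by units. -/
def errMatrix (e : ℕ → ℕ → Ω → ℝ) (N T : ℕ) (ω : Ω) : Matrix (Fin T) (Fin N) ℝ :=
  Matrix.of fun t i => e i t ω

/-- The common component `C⁰_{it} = Λ⁰_i' F⁰_t`. -/
def common (Λ F : ℕ → Ω → EuclideanSpace ℝ (Fin r)) (i t : ℕ) (ω : Ω) : ℝ :=
  (Λ i ω).ofLp ⬝ᵥ (F t ω).ofLp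

/-- The `T × N` data matrix with entries `x_{it} = Λ⁰_i' F⁰_t + e_{it}`. -/
def dataMatrix (Λ F : ℕ → Ω → EuclideanSpace ℝ (Fin r)) (e : ℕ → ℕ → Ω → ℝ) (N T : ℕ) (ω : Ω) :
    Matrix (Fin T) (Fin N) ℝ :=
  Matrix.of fun t i => common Λ F i t ω + e i t ω

/-- `(F̃, Λ̃) = (√T U_r, √N V_r D_r)` for some singular value decomposition `X / √(NT) = U D V'`
with orthogonal `U`, `V` and singular values `d 0 ≥ d 1 ≥ ⋯ ≥ 0` on the diagonal of the `T × N`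
matrix `D`; `U_r`, `V_r` are the first `r` columns of `U`, `V`. -/
def IsPCEstimator {N T : ℕ} (X : Matrix (Fin T) (Fin N) ℝ)
    (Ft : Matrix (Fin T) (Fin r) ℝ) (Lt : Matrix (Fin N) (Fin r) ℝ) : Prop :=
  ∃ (hT : r ≤ T) (hN : r ≤ N)
    (U : Matrix (Fin T) (Fin T) ℝ) (V : Matrix (Fin N) (Fin N) ℝ) (d : ℕ → ℝ),
    U ∈ Matrix.orthogonalGroup (Fin T) ℝ ∧ V ∈ Matrix.orthogonalGroup (Fin N) ℝ ∧
    Antitone d ∧ (∀ k, 0 ≤ d k) ∧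
    (1 / √((N : ℝ) * T)) • X =
      U * (Matrix.of fun (t : Fin T) (i : Fin N) => if (t : ℕ) = i then d t else 0) * Vᵀ ∧
    Ft = Matrix.of (fun t k => √(T : ℝ) * U t (Fin.castLE hT k)) ∧
    Lt = Matrix.of (fun i k => √(N : ℝ) * V i (Fin.castLE hN k) * d k)

/-- The `(i,t)` entry `C̃_{it} = Λ̃_i' F̃_t` of `F̃ Λ̃'` (and `0` if `i` or `t` is not in the panel;
indices start at `0`). -/
def estCommon {N T : ℕ} (Ft : Matrix (Fin T) (Fin r) ℝ) (Lt : Matrix (Fin N) (Fin r) ℝ)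
    (i t : ℕ) : ℝ :=
  if h : t < T ∧ i < N then (Ft * Ltᵀ) ⟨t, h.1⟩ ⟨i, h.2⟩ else 0

/-- `N^{-α/2} ∑_{i<N} Λ⁰_i e_{it}`. -/
def crossSum (Λ : ℕ → Ω → EuclideanSpace ℝ (Fin r)) (e : ℕ → ℕ → Ω → ℝ) (α : ℝ) (t N : ℕ)
    (ω : Ω) : EuclideanSpace ℝ (Fin r) :=
  ((N : ℝ) ^ (-α / 2)) • ∑ i ∈ Finset.range N, e i t ω • Λ i ω

/-- `T^{-1/2} ∑_{t<T} F⁰_t e_{it}`. -/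
def timeSum (F : ℕ → Ω → EuclideanSpace ℝ (Fin r)) (e : ℕ → ℕ → Ω → ℝ) (i T : ℕ)
    (ω : Ω) : EuclideanSpace ℝ (Fin r) :=
  (1 / √(T : ℝ)) • ∑ t ∈ Finset.range T, e i t ω • F t ω

variable [MeasurableSpace Ω]

/-- Errors: mean independence, weak cross-sectional and serial correlation. -/
structure ErrorAssumption (μ : Measure Ω) (lam F : ℕ → Ω → EuclideanSpace ℝ (Fin r))
    (e : ℕ → ℕ → Ω → ℝ) (N T : ℕ → ℕ) (M : ℝ) : Prop where
  /-- The errors have finite variance (so that the moments below exist). -/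
  memLp : ∀ i t, MemLp (e i t) 2 μ
  /-- `E(e_{it} | Λ⁰_i, F⁰_t) = 0`; as `c_N ≠ 0`, `Λ⁰_i = c_N λ_i` and `λ_i` generate the same
  `σ`-algebra. -/
  mean_indep : ∀ i t,
    μ[e i t | MeasurableSpace.comap (fun ω => (lam i ω, F t ω)) inferInstance] =ᵐ[μ] 0
  /-- `E (N^{-1/2} ∑_i [e_{it} e_{is} - E(e_{it} e_{is})])² ≤ M`. -/
  second_moment : ∀ n t s : ℕ,
    ∫⁻ ω, ‖(1 / √(n : ℝ)) * ∑ i ∈ Finset.range n,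
      (e i t ω * e i s ω - ∫ ω', e i t ω' * e i s ω' ∂μ)‖ₑ ^ 2 ∂μ ≤ ENNReal.ofReal M
  serial : ∀ i n : ℕ,
    (1 / (n : ℝ)) * ∑ t ∈ Finset.range n, ∑ s ∈ Finset.range n,
      |∫ ω, e i t ω * e i s ω ∂μ| ≤ M
  cross : ∀ t n : ℕ,
    (1 / (n : ℝ)) * ∑ i ∈ Finset.range n, ∑ j ∈ Finset.range n,
      |∫ ω, e i t ω * e j t ω ∂μ| ≤ M
  /-- `(N√T)⁻¹ ‖e_t' 𝐞'‖ = O_p(δ_{NT}⁻¹)` for each `t`. -/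
  cross_norm : ∀ t : ℕ, IsBigOP μ
    (fun n ω => (1 / ((N n : ℝ) * √(T n : ℝ))) *
      √(∑ s ∈ Finset.range (T n), (∑ i ∈ Finset.range (N n), e i t ω * e i s ω) ^ 2))
    (fun n => (delta (N n) (T n))⁻¹)
  /-- `(T√N)⁻¹ ‖e_i' 𝐞‖ = O_p(δ_{NT}⁻¹)` for each `i`. -/
  serial_norm : ∀ i : ℕ, IsBigOP μ
    (fun n ω => (1 / ((T n : ℝ) * √(N n : ℝ))) *
      √(∑ j ∈ Finset.range (N n), (∑ t ∈ Finset.range (T n), e i t ω * e j t ω) ^ 2))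
    (fun n => (delta (N n) (T n))⁻¹)
  /-- Squared spectral norm: `‖𝐞‖²_{sp} = O_p(max(N, T))`. -/
  spectral : IsBigOP μ (fun n ω => ‖errMatrix e (N n) (T n) ω‖ ^ 2)
    (fun n => max (N n : ℝ) (T n : ℝ))

/-- Factors and loadings, with loadings of strength `α`. -/
structure FactorAssumption (μ : Measure Ω) (c : ℕ → ℝ)
    (lam F : ℕ → Ω → EuclideanSpace ℝ (Fin r))
    (α M : ℝ) (SΛ SF : Matrix (Fin r) (Fin r) ℝ) : Prop where
  scale_pos : ∀ n, 0 < c n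
  scale_le_one : ∀ n, c n ≤ 1
  measurable_loading : ∀ i, Measurable (lam i)
  measurable_factor : ∀ t, Measurable (F t)
  factor_moment : ∀ t, ∫⁻ ω, ‖F t ω‖ₑ ^ 4 ∂μ ≤ ENNReal.ofReal M
  factor_plim : ∀ j k, TendstoInMeasure μ
    (fun (n : ℕ) ω => (1 / (n : ℝ)) * ∑ t ∈ Finset.range n, F t ω j * F t ω k) atTop
    (fun _ => SF j k)
  factor_posDef : SF.PosDef
  alpha_pos : 0 < α
  alpha_le_one : α ≤ 1
  /-- In particular `‖Λ⁰_i‖ ≤ M`. -/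
  loading_bound : ∀ i, ∀ᵐ ω ∂μ, ‖lam i ω‖ ≤ M
  /-- Loadings may be random; for nonrandom loadings this is ordinary convergence. -/
  loading_lim : ∀ j k, TendstoInMeasure μ
    (fun (n : ℕ) ω => (1 / (n : ℝ) ^ α) *
      ∑ i ∈ Finset.range n, loading c lam n i ω j * loading c lam n i ω k) atTop
    (fun _ => SΛ j k)
  loading_posDef : SΛ.PosDef
  /-- The `r` eigenvalues of `Σ_Λ Σ_F` (all real, since both factors are positive definite)
  are distinct. -/
  eigenvalues_distinct : (SΛ * SF).charpoly.roots.Nodup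

/-- Moment and rate conditions linking errors with factors and loadings. -/
structure LinkAssumption (μ : Measure Ω) (c : ℕ → ℝ)
    (lam F : ℕ → Ω → EuclideanSpace ℝ (Fin r))
    (e : ℕ → ℕ → Ω → ℝ) (N T : ℕ → ℕ) (α M : ℝ) : Prop where
  cross_moment : ∀ t n : ℕ, ∫⁻ ω, ‖crossSum (loading c lam n) e α t n ω‖ₑ ^ 2 ∂μ ≤ ENNReal.ofReal M
  /-- `(NT)⁻¹ e_t' 𝐞' 𝐅⁰ = O_p(δ_{NT}⁻²)` for each `t`. -/
  cross_factor : ∀ t : ℕ, IsBigOP μ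
    (fun n ω => (1 / ((N n : ℝ) * T n)) *
      ‖∑ s ∈ Finset.range (T n), (∑ i ∈ Finset.range (N n), e i t ω * e i s ω) • F s ω‖)
    (fun n => (delta (N n) (T n) ^ 2)⁻¹)
  time_moment : ∀ i n : ℕ, ∫⁻ ω, ‖timeSum F e i n ω‖ₑ ^ 2 ∂μ ≤ ENNReal.ofReal M
  /-- `(N^α T)⁻¹ e_i' 𝐞 𝚲⁰ = O_p(N^{-α}) + O_p((T N^α)^{-1/2})` for each `i`. -/
  serial_loading : ∀ i : ℕ, IsBigOP μ
    (fun n ω => (1 / ((N n : ℝ) ^ α * T n)) *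
      ‖∑ j ∈ Finset.range (N n),
        (∑ t ∈ Finset.range (T n), e i t ω * e j t ω) • loading c lam (N n) j ω‖)
    (fun n => 1 / (N n : ℝ) ^ α + 1 / √((T n : ℝ) * (N n : ℝ) ^ α))
  /-- `∑_i ∑_t Λ⁰_i F⁰_t' e_{it} = O_p(√(N^α T))` in Frobenius norm. -/
  loading_factor : IsBigOP μ
    (fun n ω => √(∑ j : Fin r, ∑ k : Fin r,
      (∑ i ∈ Finset.range (N n), ∑ t ∈ Finset.range (T n),
        loading c lam (N n) i ω j * F t ω k * e i t ω) ^ 2))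
    (fun n => √((N n : ℝ) ^ α * T n))

/-- Errors, factors and loadings, their link, and `(N / N^α) / T → 0`. -/
structure AssumptionA (μ : Measure Ω) (c : ℕ → ℝ)
    (lam F : ℕ → Ω → EuclideanSpace ℝ (Fin r))
    (e : ℕ → ℕ → Ω → ℝ) (N T : ℕ → ℕ) (α M : ℝ) (SΛ SF : Matrix (Fin r) (Fin r) ℝ) :
    Prop where
  errors : ErrorAssumption μ lam F e N T M
  factors : FactorAssumption μ c lam F α M SΛ SF
  link : LinkAssumption μ c lam F e N T α M
  rate : Tendsto (fun n => (N n : ℝ) / (N n : ℝ) ^ α * (1 / (T n : ℝ))) atTop (𝓝 0)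

/-- Central limit theorems: for each `i` and `t` the two normalised sums are asymptotically
`N(0, Γ_t)` and `N(0, Φ_i)`, jointly with `(λ_i, F⁰_t)`, the two Gaussian limits being independent
of each other and of `(λ_i, F⁰_t)`. The limit is realised on `Ω × ℝʳ × ℝʳ` with the product
measure `μ ⊗ N(0, Γ_t) ⊗ N(0, Φ_i)`. -/
structure AssumptionB (μ : Measure Ω) [IsProbabilityMeasure μ]
    (c : ℕ → ℝ) (lam F : ℕ → Ω → EuclideanSpace ℝ (Fin r))
    (e : ℕ → ℕ → Ω → ℝ) (N T : ℕ → ℕ) (α : ℝ) (Γ Φ : ℕ → Matrix (Fin r) (Fin r) ℝ) :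
    Prop where
  cross_posDef : ∀ t, (Γ t).PosDef
  time_posDef : ∀ i, (Φ i).PosDef
  clt : ∀ i t : ℕ, TendstoInDistribution
    (fun n ω => ((lam i ω, F t ω),
      (crossSum (loading c lam (N n)) e α t (N n) ω, timeSum F e i (T n) ω)))
    atTop
    (fun p : Ω × (EuclideanSpace ℝ (Fin r) × EuclideanSpace ℝ (Fin r)) =>
      ((lam i p.1, F t p.1), p.2))
    (fun _ => μ)
    (μ.prod ((multivariateGaussian 0 (Γ t)).prod (multivariateGaussian 0 (Φ i))))

/-- Loading strength above `1/2` and relative rates of the panel sizes. -/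
structure AssumptionC (N T : ℕ → ℕ) (α : ℝ) : Prop where
  alpha_gt : 1 / 2 < α
  rate₁ : Tendsto (fun n => √(T n : ℝ) / (N n : ℝ) ^ α) atTop (𝓝 0)
  rate₂ : Tendsto (fun n => 1 / √(T n : ℝ) * ((N n : ℝ) / (N n : ℝ) ^ α)) atTop (𝓝 0)
  rate₃ : Tendsto (fun n => 1 / (T n : ℝ) * ((N n : ℝ) ^ (3 / 2 : ℝ) / (N n : ℝ) ^ α)) atTop (𝓝 0)

/-- The quadratic form `v' S⁻¹ G S⁻¹ v`: with `v = Λ⁰_i, S = Σ_Λ, G = Γ_t` this is `W^Λ_{it}`,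
with `v = F⁰_t, S = Σ_F, G = Φ_i` it is `W^F_{it}`. -/
def sandwich (S G : Matrix (Fin r) (Fin r) ℝ) (v : EuclideanSpace ℝ (Fin r)) : ℝ :=
  v.ofLp ⬝ᵥ ((S⁻¹ * G * S⁻¹) *ᵥ v.ofLp)

end WeakFactor

end

/-!
The proof expands the principal components estimator to first order and studentizes the result.

Write `u = √(N^α)`, `F = F⁰/√T`, `L = Λ⁰/u`, `E = e/(u√T)`, so that the Gram matrices of `F` and `L`
converge in probability to positive definite limits while `‖E‖ = o_p(T^{-1/4})`. The rescaled
estimators `U = F̃/√T` and `Q = Λ̃/u` satisfy the normal equations `UᵀU = 1`, `Q = (F Lᵀ + E)ᵀ U`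
and `U = (F Lᵀ + E) Q K` with `K = (QᵀQ)⁻¹` (`IsPCEstimator.normal_equations`,
`IsPCEstimator.pcaEquations`); here `K` is bounded because `F Lᵀ + E` is bounded below on an
`r`-dimensional space. With the rotations `G = FᵀU` and `B = LᵀQK` this reads `U = F B + E Q K`,
`Q = L G + Eᵀ U`. Only `B Gᵀ ≈ 1`, `G K Gᵀ ≈ Σ_Λ⁻¹` and `B Bᵀ ≈ Σ_F⁻¹` matter for the common
component, so that the rotations themselves need not converge, and the leading term of `C̃ - C⁰`
is the linear form `(c_N/u) ⟨Σ_Λ⁻¹ λ_i, ξ⟩ + T^{-1/2} ⟨Σ_F⁻¹ F_t, η⟩` in the two normalized sums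
`ξ = N^{-α/2} ∑ Λ_j e_{jt}` and `η = T^{-1/2} ∑ F_s e_{is}`. The deterministic remainder bound is
`PCAEquations.norm_common_remainder_le`; `panelOrders` supplies the stochastic orders.

The standard deviation of the leading term dominates both `(c_N/u) ‖λ_i‖` and `T^{-1/2} ‖F_t‖`, also
when one of `λ_i`, `F_t` vanishes, and it dominates `min (c_N/u) T^{-1/2}` times a positive random
variable. This makes the remainder negligible after studentization (`tendsto_studentized_sub`); the
product of the two estimation errors is the delicate term, and it needs `c_N √T → ∞`, which follows
from the strength of the loadings and `(N/N^α)/T → 0`.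

It remains to prove a central limit theorem for the leading term with its random weights. The
relative size of the two scales `c_N/u` and `T^{-1/2}` need not converge, but the studentized
weights are bounded and unit-variance, so that they converge along subsequences; joint convergence
with `(λ_i, F_t)` then gives convergence of characteristic functions along subsequences to the same
limit (`tendstoInDistribution_pairing_weight`).

Stochastic orders are expressed with a filter `whp` on `ℕ × Ω`: `o_p(1)` is convergence to zero
along this filter.
-/

set_option linter.unusedSectionVars false

namespace WeakFactor

/-! ### Stochastic orders as limits along a filter -/

section StochasticOrder

variable {Ω : Type*} [MeasurableSpace Ω] {μ : Measure Ω}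

/-- The filter on `ℕ × Ω` of the events that hold with probability tending to one:
`s` belongs to it when `P((n, ω) ∉ s) → 0` as `n → ∞`. A random sequence is `o_p(1)` exactly when it
tends to `0` along this filter, so that the calculus of limits applies to `o_p`. Outer measure is
used, since estimators need not be measurable. -/
def whp (μ : Measure Ω) : Filter (ℕ × Ω) where
  sets := {s | Tendsto (fun n => μ {ω | (n, ω) ∉ s}) atTop (𝓝 0)}
  univ_sets := by simp
  sets_of_superset {s t} hs hst :=
    tendsto_of_tendsto_of_tendsto_of_le_of_le tendsto_const_nhds hs (fun _ => zero_le)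
      (fun n => measure_mono fun _ hω h => hω (hst h))
  inter_sets {s t} hs ht := by
    have h := Tendsto.add hs ht
    rw [add_zero] at h
    refine tendsto_of_tendsto_of_tendsto_of_le_of_le tendsto_const_nhds h (fun _ => zero_le)
      (fun n => (measure_mono fun ω hω => ?_).trans (measure_union_le _ _))
    by_contra hc
    simp only [Set.mem_union, Set.mem_ofPred_eq, not_or, not_not] at hc
    exact hω ⟨hc.1, hc.2⟩

lemma eventually_whp {p : ℕ × Ω → Prop} :
    (∀ᶠ x in whp μ, p x) ↔ Tendsto (fun n => μ {ω | ¬ p (n, ω)}) atTop (𝓝 0) := Iff.rfl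

lemma eventually_whp_of_ae {p : ℕ × Ω → Prop} (h : ∀ᶠ n in atTop, ∀ᵐ ω ∂μ, p (n, ω)) :
    ∀ᶠ x in whp μ, p x := by
  rw [eventually_whp]
  refine tendsto_const_nhds.congr' ?_
  filter_upwards [h] with n hn using (ae_iff.1 hn).symm

lemma tendsto_fst_whp : Tendsto Prod.fst (whp μ) atTop := fun s hs => by
  refine eventually_whp_of_ae ?_
  filter_upwards [hs] with n hn using ae_of_all _ fun _ => hn

lemma tendsto_whp_zero_iff {X : ℕ × Ω → ℝ} :
    Tendsto X (whp μ) (𝓝 0) ↔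
      ∀ δ > 0, Tendsto (fun n => μ {ω | δ < |X (n, ω)|}) atTop (𝓝 0) := by
  constructor
  · intro h δ hδ
    have := eventually_whp.1 (h.eventually (Metric.closedBall_mem_nhds (0 : ℝ) hδ))
    simpa [Metric.mem_closedBall, Real.dist_eq] using this
  · intro h
    rw [Metric.nhds_basis_closedBall.tendsto_right_iff]
    intro δ hδ
    rw [eventually_whp]
    simpa [Metric.mem_closedBall, Real.dist_eq] using h δ hδ

lemma tendsto_whp_of_tendstoInMeasure {X : ℕ → Ω → ℝ} {c : ℝ}
    (h : TendstoInMeasure μ X atTop fun _ => c) :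
    Tendsto (fun p : ℕ × Ω => X p.1 p.2) (whp μ) (𝓝 c) := by
  rw [tendsto_iff_norm_sub_tendsto_zero, tendsto_whp_zero_iff]
  intro δ hδ
  rw [tendstoInMeasure_iff_norm] at h
  refine tendsto_of_tendsto_of_tendsto_of_le_of_le tendsto_const_nhds (h δ hδ) (fun _ => zero_le)
    (fun n => measure_mono fun ω hω => ?_)
  have : δ < |‖X n ω - c‖| := hω
  rw [abs_norm] at this
  exact this.le

lemma tendstoInMeasure_of_tendsto_whp {X : ℕ → Ω → ℝ}
    (h : Tendsto (fun p : ℕ × Ω => X p.1 p.2) (whp μ) (𝓝 0)) :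
    TendstoInMeasure μ X atTop 0 := by
  rw [tendstoInMeasure_iff_norm]
  intro δ hδ
  refine tendsto_of_tendsto_of_tendsto_of_le_of_le tendsto_const_nhds
    (tendsto_whp_zero_iff.1 h (δ / 2) (half_pos hδ)) (fun _ => zero_le)
    (fun n => measure_mono fun ω hω => ?_)
  have : δ ≤ ‖X n ω - 0‖ := hω
  rw [sub_zero, Real.norm_eq_abs] at this
  exact (half_lt_self hδ).trans_le this

/-- Bounded in probability, `X_n = O_p(1)`. -/
def BddInProb (μ : Measure Ω) (X : ℕ × Ω → ℝ) : Prop :=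
  ∀ ε : ℝ, 0 < ε → ∃ K : ℝ, ∀ᶠ n in atTop, μ {ω | K < |X (n, ω)|} ≤ ENNReal.ofReal ε

lemma BddInProb.mono {X Y : ℕ × Ω → ℝ} (hY : BddInProb μ Y)
    (h : ∀ᶠ p in whp μ, |X p| ≤ |Y p|) : BddInProb μ X := by
  intro ε hε
  obtain ⟨K, hK⟩ := hY (ε / 2) (half_pos hε)
  refine ⟨K, ?_⟩
  have h' := (eventually_whp.1 h).eventually_le_const
    (ENNReal.ofReal_pos.2 (half_pos hε))
  filter_upwards [hK, h'] with n hn hn'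
  calc μ {ω | K < |X (n, ω)|} ≤ μ ({ω | K < |Y (n, ω)|} ∪ {ω | ¬ |X (n, ω)| ≤ |Y (n, ω)|}) := by
        refine measure_mono fun ω hω => ?_
        by_cases hc : |X (n, ω)| ≤ |Y (n, ω)|
        · exact Or.inl (lt_of_lt_of_le hω hc)
        · exact Or.inr hc
    _ ≤ ENNReal.ofReal (ε / 2) + ENNReal.ofReal (ε / 2) :=
        (measure_union_le _ _).trans (add_le_add hn hn')
    _ = ENNReal.ofReal ε := by
        rw [← ENNReal.ofReal_add (by positivity) (by positivity), add_halves]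

lemma BddInProb.of_bound {X : ℕ × Ω → ℝ} (C : ℝ) (h : ∀ᶠ p in whp μ, |X p| ≤ C) :
    BddInProb μ X := by
  intro ε hε
  refine ⟨C, ?_⟩
  filter_upwards [(eventually_whp.1 h).eventually_le_const (ENNReal.ofReal_pos.2 hε)] with n hn
  simpa using hn

lemma BddInProb.of_tendsto {X : ℕ × Ω → ℝ} {c : ℝ} (h : Tendsto X (whp μ) (𝓝 c)) :
    BddInProb μ X :=
  .of_bound (|c| + 1) (by
    filter_upwards [h.abs.eventually_le_const (lt_add_one |c|)] with p hp using hp)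

/-- The common core of the sum and product rules: a quantity controlled by a function of two
bounds is bounded in probability when both bounded quantities are. -/
lemma BddInProb.map₂ {X Y Z : ℕ × Ω → ℝ} (hX : BddInProb μ X) (hY : BddInProb μ Y)
    (f : ℝ → ℝ → ℝ) (h : ∀ p K L, |X p| ≤ K → |Y p| ≤ L → |Z p| ≤ f K L) : BddInProb μ Z := by
  intro ε hε
  obtain ⟨K, hK⟩ := hX (ε / 2) (half_pos hε)
  obtain ⟨L, hL⟩ := hY (ε / 2) (half_pos hε)
  refine ⟨f K L, ?_⟩
  filter_upwards [hK, hL] with n hn hn'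
  calc μ {ω | f K L < |Z (n, ω)|} ≤ μ ({ω | K < |X (n, ω)|} ∪ {ω | L < |Y (n, ω)|}) := by
        refine measure_mono fun ω hω => ?_
        by_contra hc
        simp only [Set.mem_union, Set.mem_ofPred_eq, not_or, not_lt] at hc
        exact absurd (h _ _ _ hc.1 hc.2) (not_le.2 hω)
    _ ≤ ENNReal.ofReal (ε / 2) + ENNReal.ofReal (ε / 2) :=
        (measure_union_le _ _).trans (add_le_add hn hn')
    _ = ENNReal.ofReal ε := by
        rw [← ENNReal.ofReal_add (by positivity) (by positivity), add_halves]

lemma BddInProb.add {X Y : ℕ × Ω → ℝ} (hX : BddInProb μ X) (hY : BddInProb μ Y) :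
    BddInProb μ fun p => X p + Y p :=
  hX.map₂ hY (· + ·) fun _ _ _ h h' => (abs_add_le _ _).trans (add_le_add h h')

lemma BddInProb.mul {X Y : ℕ × Ω → ℝ} (hX : BddInProb μ X) (hY : BddInProb μ Y) :
    BddInProb μ fun p => X p * Y p :=
  hX.map₂ hY (· * ·) fun p K L h h' => by
    rw [abs_mul]
    exact mul_le_mul h h' (abs_nonneg _) ((abs_nonneg _).trans h)

lemma BddInProb.const (c : ℝ) : BddInProb μ fun _ => c :=
  .of_bound |c| (.of_forall fun _ => le_rfl)

/-- `o_p(1) · O_p(1) = o_p(1)`. -/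
lemma BddInProb.tendsto_mul {X Y : ℕ × Ω → ℝ} (hY : BddInProb μ Y)
    (hX : Tendsto X (whp μ) (𝓝 0)) : Tendsto (fun p => X p * Y p) (whp μ) (𝓝 0) := by
  rw [tendsto_whp_zero_iff] at hX ⊢
  intro δ hδ
  rw [ENNReal.tendsto_nhds_zero]
  intro ε hε
  obtain ⟨η, hη, hηε⟩ : ∃ η : ℝ, 0 < η ∧ ENNReal.ofReal η ≤ ε := by
    rcases eq_or_ne ε ⊤ with rfl | hε'
    · exact ⟨1, one_pos, le_top⟩
    · exact ⟨ε.toReal, ENNReal.toReal_pos hε.ne' hε', (ENNReal.ofReal_toReal hε').le⟩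
  obtain ⟨K, hK⟩ := hY (η / 2) (half_pos hη)
  have hK' : 0 < |K| + 1 := by positivity
  have h1 := (hX (δ / (|K| + 1)) (by positivity)).eventually_le_const
    (ENNReal.ofReal_pos.2 (half_pos hη))
  filter_upwards [hK, h1] with n hn hn'
  calc μ {ω | δ < |X (n, ω) * Y (n, ω)|}
      ≤ μ ({ω | K < |Y (n, ω)|} ∪ {ω | δ / (|K| + 1) < |X (n, ω)|}) := by
        refine measure_mono fun ω hω => ?_
        by_contra hc
        simp only [Set.mem_union, Set.mem_ofPred_eq, not_or, not_lt] at hc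
        have hω' : δ < |X (n, ω) * Y (n, ω)| := hω
        refine absurd hω' (not_lt.2 ?_)
        rw [abs_mul]
        calc |X (n, ω)| * |Y (n, ω)| ≤ δ / (|K| + 1) * (|K| + 1) :=
              mul_le_mul hc.2 (hc.1.trans ((le_abs_self K).trans (by linarith)))
                (abs_nonneg _) (by positivity)
          _ = δ := by field_simp
    _ ≤ ENNReal.ofReal (η / 2) + ENNReal.ofReal (η / 2) :=
        (measure_union_le _ _).trans (add_le_add hn hn')
    _ = ENNReal.ofReal η := by
        rw [← ENNReal.ofReal_add (by positivity) (by positivity), add_halves]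
    _ ≤ ε := hηε

/-- A fixed random variable is bounded in probability. -/
lemma BddInProb.of_measurable [IsFiniteMeasure μ] {Y : Ω → ℝ} (hY : Measurable Y) :
    BddInProb μ fun p => Y p.2 := by
  intro ε hε
  have h : Tendsto (fun k : ℕ => μ {ω | (k : ℝ) < |Y ω|}) atTop
      (𝓝 (μ (⋂ k : ℕ, {ω | (k : ℝ) < |Y ω|}))) := by
    refine tendsto_measure_iInter_atTop
      (fun k => (measurableSet_lt measurable_const hY.abs).nullMeasurableSet) ?_
      ⟨0, measure_ne_top _ _⟩
    intro k l hkl ω hω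
    have hω' : (l : ℝ) < |Y ω| := hω
    have hkl' : (k : ℝ) < |Y ω| := lt_of_le_of_lt (Nat.cast_le.2 hkl) hω'
    exact hkl'
  have h0 : (⋂ k : ℕ, {ω | (k : ℝ) < |Y ω|}) = ∅ := by
    ext ω
    simp only [Set.mem_iInter, Set.mem_ofPred_eq, Set.mem_empty_iff_false, iff_false, not_forall,
      not_lt]
    exact exists_nat_ge _
  rw [h0, measure_empty] at h
  obtain ⟨k, hk⟩ := (h.eventually_le_const (ENNReal.ofReal_pos.2 hε)).exists
  exact ⟨k, .of_forall fun _ => hk⟩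

/-- Chebyshev's inequality: bounded second moments imply boundedness in probability. -/
lemma BddInProb.of_lintegral_sq {E : Type*} [NormedAddCommGroup E] {X : ℕ → Ω → E}
    {C : ℝ} (hX : ∀ n, AEStronglyMeasurable (X n) μ)
    (h : ∀ n, ∫⁻ ω, ‖X n ω‖ₑ ^ 2 ∂μ ≤ ENNReal.ofReal C) :
    BddInProb μ fun p => ‖X p.1 p.2‖ := by
  intro ε hε
  obtain ⟨k, hk⟩ := exists_nat_gt (|C| / ε)
  have hk0 : (0 : ℝ) < k := lt_of_le_of_lt (by positivity) hk
  have hk1 : (1 : ℝ) ≤ k := by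
    have : 0 < k := by exact_mod_cast hk0
    exact_mod_cast this
  refine ⟨k, .of_forall fun n => ?_⟩
  have h1 := mul_meas_ge_le_lintegral₀ ((hX n).enorm.pow_const 2) ((k : ℝ≥0∞) ^ 2)
  have h2 : μ {ω | (k : ℝ) < |‖X n ω‖|} ≤ μ {ω | (k : ℝ≥0∞) ^ 2 ≤ ‖X n ω‖ₑ ^ 2} := by
    refine measure_mono fun ω hω => ?_
    have hω' : (k : ℝ) < ‖X n ω‖ := by simpa using hω
    have h' : (k : ℝ≥0∞) ≤ ‖X n ω‖ₑ := by
      rw [← ofReal_norm, ← ENNReal.ofReal_natCast]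
      exact ENNReal.ofReal_le_ofReal hω'.le
    have h'' : (k : ℝ≥0∞) ^ 2 ≤ ‖X n ω‖ₑ ^ 2 := by gcongr
    exact h''
  refine h2.trans ?_
  have h3 : (k : ℝ≥0∞) ^ 2 * μ {ω | (k : ℝ≥0∞) ^ 2 ≤ ‖X n ω‖ₑ ^ 2} ≤
      (k : ℝ≥0∞) ^ 2 * ENNReal.ofReal ε := by
    refine (h1.trans (h n)).trans ?_
    rw [← ENNReal.ofReal_natCast, ← ENNReal.ofReal_pow hk0.le,
      ← ENNReal.ofReal_mul (by positivity)]
    refine ENNReal.ofReal_le_ofReal ((le_abs_self C).trans ?_)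
    rw [div_lt_iff₀ hε] at hk
    have : (k : ℝ) * ε ≤ (k : ℝ) ^ 2 * ε :=
      mul_le_mul_of_nonneg_right (le_self_pow₀ hk1 two_ne_zero) hε.le
    linarith
  refine (ENNReal.mul_le_mul_iff_right ?_ ?_).1 h3
  · simpa using hk0.ne'
  · simp

/-- If `X = O_p(a)` and `a b → 0` then `X b = o_p(1)`. -/
lemma IsBigOP.tendsto_mul {X : ℕ → Ω → ℝ} {a b : ℕ → ℝ} (hX : IsBigOP μ X a)
    (hb : ∀ n, 0 ≤ b n) (hab : Tendsto (fun n => a n * b n) atTop (𝓝 0)) :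
    Tendsto (fun p : ℕ × Ω => X p.1 p.2 * b p.1) (whp μ) (𝓝 0) := by
  rw [tendsto_whp_zero_iff]
  intro δ hδ
  rw [ENNReal.tendsto_nhds_zero]
  intro ε hε
  obtain ⟨η, hη, hηε⟩ : ∃ η : ℝ, 0 < η ∧ ENNReal.ofReal η ≤ ε := by
    rcases eq_or_ne ε ⊤ with rfl | hε'
    · exact ⟨1, one_pos, le_top⟩
    · exact ⟨ε.toReal, ENNReal.toReal_pos hε.ne' hε', (ENNReal.ofReal_toReal hε').le⟩
  obtain ⟨K, hK⟩ := hX η hη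
  have h1 := (hab.const_mul K).eventually_le_const (by rwa [mul_zero] : K * 0 < δ)
  filter_upwards [hK, h1] with n hn hn'
  refine ((measure_mono fun ω hω => ?_).trans hn).trans hηε
  by_contra hc
  have hc' : |X n ω| ≤ K * a n := not_lt.1 hc
  have hω' : δ < |X n ω * b n| := hω
  rw [abs_mul, abs_of_nonneg (hb n)] at hω'
  have := mul_le_mul_of_nonneg_right hc' (hb n)
  linarith

lemma isBigOP_of_bddInProb {X : ℕ → Ω → ℝ} {a : ℕ → ℝ} {Y : ℕ × Ω → ℝ} (ha : ∀ n, 0 ≤ a n)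
    (hY : BddInProb μ Y) (h : ∀ᶠ p in whp μ, |X p.1 p.2| ≤ |Y p| * a p.1) :
    IsBigOP μ X a := by
  intro ε hε
  obtain ⟨K, hK⟩ := hY (ε / 2) (half_pos hε)
  refine ⟨K, ?_⟩
  have h' := (eventually_whp.1 h).eventually_le_const
    (ENNReal.ofReal_pos.2 (half_pos hε))
  filter_upwards [hK, h'] with n hn hn'
  calc μ {ω | K * a n < |X n ω|}
      ≤ μ ({ω | K < |Y (n, ω)|} ∪ {ω | ¬ |X n ω| ≤ |Y (n, ω)| * a n}) := by
        refine measure_mono fun ω hω => ?_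
        by_contra hc
        simp only [Set.mem_union, Set.mem_ofPred_eq, not_or, not_lt, not_not] at hc
        exact absurd (hc.2.trans (mul_le_mul_of_nonneg_right hc.1 (ha n))) (not_le.2 hω)
    _ ≤ ENNReal.ofReal (ε / 2) + ENNReal.ofReal (ε / 2) :=
        (measure_union_le _ _).trans (add_le_add hn hn')
    _ = ENNReal.ofReal ε := by
        rw [← ENNReal.ofReal_add (by positivity) (by positivity), add_halves]

end StochasticOrder

/-! ### Operator norm of real matrices -/

section Matrices

variable {m n p q r : Type*} [Fintype m] [Fintype n] [Fintype p] [Fintype q] [Fintype r]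
  [DecidableEq m] [DecidableEq n] [DecidableEq p] [DecidableEq q] [DecidableEq r]

lemma norm_matrix_transpose (A : Matrix m n ℝ) : ‖Aᵀ‖ = ‖A‖ := by
  rw [← Matrix.conjTranspose_eq_transpose_of_trivial, Matrix.l2_opNorm_conjTranspose]

lemma norm_transpose_mul_self (A : Matrix m n ℝ) : ‖Aᵀ * A‖ = ‖A‖ ^ 2 := by
  rw [← Matrix.conjTranspose_eq_transpose_of_trivial, Matrix.l2_opNorm_conjTranspose_mul_self, sq]

lemma norm_matrix_one_le : ‖(1 : Matrix n n ℝ)‖ ≤ 1 := by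
  rw [← Matrix.diagonal_one, Matrix.l2_opNorm_diagonal]
  exact (pi_norm_le_iff_of_nonneg zero_le_one).2 fun i => by simp

lemma norm_mul_le_of_le {A : Matrix m n ℝ} {B : Matrix n p ℝ} {a b : ℝ} (hA : ‖A‖ ≤ a)
    (hB : ‖B‖ ≤ b) : ‖A * B‖ ≤ a * b :=
  (Matrix.l2_opNorm_mul A B).trans
    (mul_le_mul hA hB (norm_nonneg _) ((norm_nonneg _).trans hA))

lemma norm_mul₃_le (A : Matrix m n ℝ) (B : Matrix n p ℝ) (C : Matrix p q ℝ) :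
    ‖A * B * C‖ ≤ ‖A‖ * ‖B‖ * ‖C‖ :=
  norm_mul_le_of_le (Matrix.l2_opNorm_mul _ _) le_rfl

lemma norm_mul₄_le (A : Matrix m n ℝ) (B : Matrix n p ℝ) (C : Matrix p q ℝ) (D : Matrix q r ℝ) :
    ‖A * B * C * D‖ ≤ ‖A‖ * ‖B‖ * ‖C‖ * ‖D‖ :=
  norm_mul_le_of_le (norm_mul₃_le _ _ _) le_rfl

/-- The spectral norm is at most the Frobenius norm. -/
lemma norm_le_frobenius (A : Matrix m n ℝ) : ‖A‖ ≤ √(∑ i, ∑ j, A i j ^ 2) := by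
  rw [Matrix.l2_opNorm_def]
  refine ContinuousLinearMap.opNorm_le_bound _ (Real.sqrt_nonneg _) fun x => ?_
  have h : ‖(WithLp.toLp 2 (A *ᵥ x.ofLp) : EuclideanSpace ℝ m)‖ ≤
      √(∑ i, ∑ j, A i j ^ 2) * ‖x‖ := by
    rw [EuclideanSpace.norm_eq, EuclideanSpace.norm_eq, ← Real.sqrt_mul (by positivity)]
    refine Real.sqrt_le_sqrt ?_
    rw [Finset.sum_mul]
    refine Finset.sum_le_sum fun i _ => ?_
    simp only [Real.norm_eq_abs, sq_abs]
    exact Finset.sum_mul_sq_le_sq_mul_sq _ _ _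
  exact h

lemma abs_entry_le_norm (A : Matrix m n ℝ) (i : m) (j : n) : |A i j| ≤ ‖A‖ := by
  have h := Matrix.l2_opNorm_mulVec A (EuclideanSpace.single j (1 : ℝ))
  rw [PiLp.norm_single, norm_one, mul_one] at h
  refine le_trans ?_ h
  have h2 := PiLp.norm_apply_le (WithLp.toLp 2 (A *ᵥ (EuclideanSpace.single j (1 : ℝ)).ofLp)) i
  simpa using h2

/-- If `‖J‖ ≤ 1/2` and `Y X = 1 + J` with square factors, then `X Y - 1` is of the order of `J`:
it equals `X J (1 + J)⁻¹ Y`. -/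
lemma norm_mul_swap_sub_one_le {X Y : Matrix n n ℝ} (h : ‖Y * X - 1‖ ≤ 1 / 2) :
    ‖X * Y - 1‖ ≤ 2 * ‖X‖ * ‖Y * X - 1‖ * ‖Y‖ := by
  set J := Y * X - 1 with hJ
  have hYX : Y * X = 1 + J := by rw [hJ]; abel
  have hu : IsUnit (Y * X) := by
    rw [hYX, ← sub_neg_eq_add]
    exact isUnit_one_sub_of_norm_lt_one (by rw [norm_neg]; linarith)
  have hd : IsUnit (Y * X).det := (Matrix.isUnit_iff_isUnit_det _).1 hu
  set A := (Y * X)⁻¹ with hA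
  have h1 : A * (Y * X) = 1 := Matrix.nonsing_inv_mul _ hd
  have h2 : (Y * X) * A = 1 := Matrix.mul_nonsing_inv _ hd
  have h3 : A = 1 - J * A := by
    rw [hYX, Matrix.add_mul, Matrix.one_mul] at h2
    exact eq_sub_of_add_eq h2
  have h4 : ‖A‖ ≤ 2 := by
    have : ‖A‖ ≤ 1 + 1 / 2 * ‖A‖ := by
      calc ‖A‖ = ‖1 - J * A‖ := by rw [← h3]
        _ ≤ ‖(1 : Matrix n n ℝ)‖ + ‖J * A‖ := norm_sub_le _ _
        _ ≤ 1 + 1 / 2 * ‖A‖ := add_le_add norm_matrix_one_le (norm_mul_le_of_le h le_rfl)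
    linarith
  have h5 : X * (A * Y) = 1 := by
    rw [← Matrix.mul_assoc] at h1
    exact mul_eq_one_comm.1 h1
  have h6 : X * Y - 1 = X * J * A * Y := by
    have h2' : J * A = 1 - A := by rw [eq_sub_iff_add_eq, add_comm, ← eq_sub_iff_add_eq]; exact h3
    rw [Matrix.mul_assoc X J A, h2', Matrix.mul_sub, Matrix.mul_one, Matrix.sub_mul,
      Matrix.mul_assoc X A Y, h5]
  rw [h6]
  calc ‖X * J * A * Y‖ ≤ ‖X‖ * ‖J‖ * ‖A‖ * ‖Y‖ := norm_mul₄_le _ _ _ _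
    _ ≤ ‖X‖ * ‖J‖ * 2 * ‖Y‖ := by gcongr
    _ = 2 * ‖X‖ * ‖J‖ * ‖Y‖ := by ring

/-! ### The first-order expansion of the principal components estimator -/

/-- The normal equations of principal components for `F Lᵀ + E`: `U` holds orthonormal estimated
factors, `Q` the estimated loadings, `K` the inverse of `Qᵀ Q`; `G` and `B` are the rotations
with `Q ≈ L G` and `U ≈ F B`. -/
structure PCAEquations (F : Matrix m r ℝ) (L : Matrix n r ℝ) (E : Matrix m n ℝ)
    (U : Matrix m r ℝ) (Q : Matrix n r ℝ) (K G B : Matrix r r ℝ) : Prop where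
  orth : Uᵀ * U = 1
  loadings : Q = (F * Lᵀ + E)ᵀ * U
  factors : U = (F * Lᵀ + E) * Q * K
  symm : Kᵀ = K
  rotG : G = Fᵀ * U
  rotB : B = Lᵀ * Q * K

namespace PCAEquations

variable {F : Matrix m r ℝ} {L : Matrix n r ℝ} {E : Matrix m n ℝ}
    {U : Matrix m r ℝ} {Q : Matrix n r ℝ} {K G B : Matrix r r ℝ}

lemma Q_eq (h : PCAEquations F L E U Q K G B) : Q = L * G + Eᵀ * U := by
  rw [h.rotG]
  conv_lhs => rw [h.loadings]
  rw [Matrix.transpose_add, Matrix.transpose_mul, Matrix.transpose_transpose, Matrix.add_mul,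
    Matrix.mul_assoc]

lemma U_eq (h : PCAEquations F L E U Q K G B) : U = F * B + E * Q * K := by
  rw [h.rotB]
  conv_lhs => rw [h.factors]
  simp only [Matrix.add_mul, Matrix.mul_assoc]

lemma norm_U_le (h : PCAEquations F L E U Q K G B) : ‖U‖ ≤ 1 := by
  have h1 : ‖U‖ ^ 2 ≤ 1 := by
    rw [← norm_transpose_mul_self, h.orth]
    exact norm_matrix_one_le
  exact (sq_le_one_iff₀ (norm_nonneg _)).1 h1

lemma norm_G_le (h : PCAEquations F L E U Q K G B) : ‖G‖ ≤ ‖F‖ := by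
  rw [h.rotG]
  refine (norm_mul_le_of_le (norm_matrix_transpose F).le h.norm_U_le).trans (mul_one _).le

lemma norm_Q_le (h : PCAEquations F L E U Q K G B) : ‖Q‖ ≤ ‖L‖ * ‖F‖ + ‖E‖ := by
  rw [h.Q_eq]
  refine (norm_add_le _ _).trans (add_le_add (norm_mul_le_of_le le_rfl h.norm_G_le) ?_)
  exact (norm_mul_le_of_le (norm_matrix_transpose E).le h.norm_U_le).trans (mul_one _).le

lemma norm_B_le (h : PCAEquations F L E U Q K G B) : ‖B‖ ≤ ‖L‖ * ‖Q‖ * ‖K‖ := by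
  rw [h.rotB]
  refine (norm_mul₃_le _ _ _).trans (by rw [norm_matrix_transpose])

/-- `Bᵀ G = 1 - K Qᵀ Eᵀ U`, and both factors of `Qᵀ Eᵀ U` are expanded once more. -/
lemma norm_BG_sub_one_le (h : PCAEquations F L E U Q K G B) :
    ‖Bᵀ * G - 1‖ ≤ ‖K‖ * (‖F‖ * (‖Lᵀ * Eᵀ * F‖ * ‖B‖ + ‖L‖ * ‖E‖ ^ 2 * ‖Q‖ * ‖K‖) + ‖E‖ ^ 2) := by
  have h1 : Bᵀ * G - 1 = -(K * (Qᵀ * Eᵀ * U)) := by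
    have h2 : (1 : Matrix r r ℝ) = Bᵀ * G + K * (Qᵀ * Eᵀ * U) := by
      rw [← h.orth]
      conv_lhs => enter [1, 1]; rw [h.U_eq]
      rw [Matrix.transpose_add, Matrix.add_mul, h.rotG]
      simp only [Matrix.transpose_mul, Matrix.mul_assoc, h.symm]
    rw [h2]; abel
  have h2 : Qᵀ * Eᵀ * U = Gᵀ * (Lᵀ * Eᵀ * F * B + Lᵀ * Eᵀ * E * Q * K) + Uᵀ * E * Eᵀ * U := by
    conv_lhs => enter [1, 1]; rw [h.Q_eq]
    have h3 : Lᵀ * Eᵀ * F * B + Lᵀ * Eᵀ * E * Q * K = Lᵀ * Eᵀ * U := by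
      conv_rhs => rw [h.U_eq]
      simp only [Matrix.mul_add, Matrix.mul_assoc]
    rw [h3]
    simp only [Matrix.transpose_add, Matrix.transpose_mul, Matrix.transpose_transpose,
      Matrix.add_mul, Matrix.mul_assoc]
  rw [h1, norm_neg, h2]
  refine norm_mul_le_of_le le_rfl ((norm_add_le _ _).trans (add_le_add ?_ ?_))
  · refine norm_mul_le_of_le ((norm_matrix_transpose _).trans_le h.norm_G_le)
      ((norm_add_le _ _).trans (add_le_add (norm_mul_le_of_le le_rfl le_rfl) ?_))
    refine norm_mul_le_of_le (norm_mul_le_of_le ((norm_mul₃_le _ _ _).trans ?_) le_rfl) le_rfl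
    rw [norm_matrix_transpose, norm_matrix_transpose, mul_assoc, sq]
  · refine (norm_mul_le_of_le (norm_mul_le_of_le (norm_mul_le_of_le
      ((norm_matrix_transpose _).trans_le h.norm_U_le) le_rfl)
      (norm_matrix_transpose _).le) h.norm_U_le).trans ?_
    rw [sq, one_mul, mul_one]

lemma norm_FF_mul_BB_sub_one_le (h : PCAEquations F L E U Q K G B) :
    ‖Fᵀ * F * (B * Bᵀ) - 1‖ ≤ ‖G * Bᵀ - 1‖ + ‖F‖ * ‖E‖ * ‖Q‖ * ‖K‖ * ‖B‖ := by
  have h1 : Fᵀ * F * (B * Bᵀ) - 1 = (G * Bᵀ - 1) - Fᵀ * E * Q * K * Bᵀ := by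
    have : G = Fᵀ * F * B + Fᵀ * E * Q * K := by
      rw [h.rotG]
      conv_lhs => rw [h.U_eq]
      simp only [Matrix.mul_add, Matrix.mul_assoc]
    rw [this, Matrix.add_mul]
    simp only [Matrix.mul_assoc]
    abel
  rw [h1]
  refine (norm_sub_le _ _).trans (add_le_add le_rfl ?_)
  refine norm_mul_le_of_le ((norm_mul₄_le _ _ _ _).trans ?_) (norm_matrix_transpose _).le
  rw [norm_matrix_transpose]

lemma norm_LL_mul_GKG_sub_one_le (h : PCAEquations F L E U Q K G B) :
    ‖Lᵀ * L * (G * K * Gᵀ) - 1‖ ≤ ‖B * Gᵀ - 1‖ + ‖L‖ * ‖E‖ * ‖K‖ * ‖F‖ := by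
  have h1 : Lᵀ * L * (G * K * Gᵀ) - 1 = (B * Gᵀ - 1) - Lᵀ * Eᵀ * U * K * Gᵀ := by
    have : B = Lᵀ * L * G * K + Lᵀ * Eᵀ * U * K := by
      rw [h.rotB]
      conv_lhs => rw [h.Q_eq]
      simp only [Matrix.mul_add, Matrix.add_mul, Matrix.mul_assoc]
    rw [this, Matrix.add_mul]
    simp only [Matrix.mul_assoc]
    abel
  rw [h1]
  refine (norm_sub_le _ _).trans (add_le_add le_rfl ?_)
  refine norm_mul_le_of_le ((norm_mul_le_of_le (norm_mul_le_of_le (norm_mul_le_of_le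
    (norm_matrix_transpose _).le (norm_matrix_transpose _).le) h.norm_U_le) le_rfl).trans ?_)
    ((norm_matrix_transpose _).trans_le h.norm_G_le)
  rw [mul_one]

/-- The remainder of the factor estimate in one period, whose errors are the column `g`. -/
lemma norm_factor_remainder_le (h : PCAEquations F L E U Q K G B) (g : Matrix n q ℝ) :
    ‖gᵀ * Q - gᵀ * L * G‖ ≤ ‖Fᵀ * E * g‖ * ‖B‖ + ‖E * g‖ * ‖E‖ * ‖Q‖ * ‖K‖ := by
  have h1 : gᵀ * Q - gᵀ * L * G = (Fᵀ * E * g)ᵀ * B + (E * g)ᵀ * E * Q * K := by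
    have h2 : (Fᵀ * E * g)ᵀ * B + (E * g)ᵀ * E * Q * K = gᵀ * Eᵀ * U := by
      conv_rhs => rw [h.U_eq]
      simp only [Matrix.transpose_mul, Matrix.transpose_transpose, Matrix.mul_add,
        Matrix.mul_assoc]
    rw [h2]
    conv_lhs => enter [1]; rw [h.Q_eq]
    simp only [Matrix.mul_add, Matrix.mul_assoc]
    abel
  rw [h1]
  refine (norm_add_le _ _).trans (add_le_add ?_ ?_)
  · exact norm_mul_le_of_le (norm_matrix_transpose _).le le_rfl
  · refine (norm_mul₄_le _ _ _ _).trans (by rw [norm_matrix_transpose])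

/-- The remainder of the loading estimate of one unit, whose errors are the column `g`. -/
lemma norm_loading_remainder_le (h : PCAEquations F L E U Q K G B) (g : Matrix m q ℝ) :
    ‖Uᵀ * g - Bᵀ * (Fᵀ * g)‖ ≤ ‖K‖ * (‖F‖ * ‖Lᵀ * Eᵀ * g‖ + ‖E‖ * ‖Eᵀ * g‖) := by
  have h1 : Uᵀ * g - Bᵀ * (Fᵀ * g) = K * (Gᵀ * (Lᵀ * Eᵀ * g) + Uᵀ * E * (Eᵀ * g)) := by
    have h2 : Gᵀ * (Lᵀ * Eᵀ * g) + Uᵀ * E * (Eᵀ * g) = Qᵀ * Eᵀ * g := by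
      conv_rhs => rw [h.Q_eq]
      simp only [Matrix.transpose_add, Matrix.transpose_mul, Matrix.transpose_transpose,
        Matrix.add_mul, Matrix.mul_assoc]
    rw [h2]
    conv_lhs => enter [1]; rw [h.U_eq]
    simp only [Matrix.transpose_add, Matrix.transpose_mul, h.symm, Matrix.add_mul,
      Matrix.mul_assoc]
    abel
  rw [h1]
  refine norm_mul_le_of_le le_rfl ((norm_add_le _ _).trans (add_le_add ?_ ?_))
  · exact norm_mul_le_of_le ((norm_matrix_transpose _).trans_le h.norm_G_le) le_rfl
  · refine norm_mul_le_of_le ((norm_mul_le_of_le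
      ((norm_matrix_transpose _).trans_le h.norm_U_le) le_rfl).trans (one_mul _).le) le_rfl

/-- The expansion of an estimated common component with factor `f`, loading `l`, period errors `g`
and unit errors `k`, for arbitrary approximations `P` of `G K Gᵀ` and `R` of `B Bᵀ`. -/
lemma norm_common_remainder_le (h : PCAEquations F L E U Q K G B) (P R : Matrix r r ℝ)
    (f l : Matrix r q ℝ) (g : Matrix n q ℝ) (k : Matrix m q ℝ) :
    ‖(fᵀ * B + gᵀ * Q * K) * (Gᵀ * l + Uᵀ * k) - fᵀ * l -
        (gᵀ * L * P * l + fᵀ * R * (Fᵀ * k))‖ ≤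
      ‖f‖ * ‖l‖ * ‖B * Gᵀ - 1‖ +
      ‖l‖ * (‖gᵀ * L‖ * ‖G * K * Gᵀ - P‖ + ‖gᵀ * Q - gᵀ * L * G‖ * ‖K‖ * ‖F‖) +
      ‖f‖ * (‖Fᵀ * k‖ * ‖B * Bᵀ - R‖ + ‖Uᵀ * k - Bᵀ * (Fᵀ * k)‖ * ‖B‖) +
      ‖gᵀ * Q‖ * ‖K‖ * ‖Uᵀ * k‖ := by
  have h1 : (fᵀ * B + gᵀ * Q * K) * (Gᵀ * l + Uᵀ * k) - fᵀ * l -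
        (gᵀ * L * P * l + fᵀ * R * (Fᵀ * k)) =
      fᵀ * (B * Gᵀ - 1) * l +
      (gᵀ * L * (G * K * Gᵀ - P) + (gᵀ * Q - gᵀ * L * G) * K * Gᵀ) * l +
      fᵀ * ((B * Bᵀ - R) * (Fᵀ * k) + B * (Uᵀ * k - Bᵀ * (Fᵀ * k))) +
      gᵀ * Q * K * (Uᵀ * k) := by
    simp only [Matrix.mul_add, Matrix.add_mul, Matrix.mul_sub, Matrix.sub_mul, Matrix.mul_assoc,
      Matrix.mul_one]
    abel
  rw [h1]
  refine (norm_add_le _ _).trans (add_le_add ((norm_add_le _ _).trans (add_le_add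
    ((norm_add_le _ _).trans (add_le_add ?_ ?_)) ?_)) (norm_mul₃_le _ _ _))
  · refine (norm_mul₃_le _ _ _).trans (le_of_eq ?_)
    rw [norm_matrix_transpose]; ring
  · rw [mul_comm ‖l‖]
    refine norm_mul_le_of_le ((norm_add_le _ _).trans (add_le_add
      (norm_mul_le_of_le le_rfl le_rfl) ?_)) le_rfl
    exact norm_mul_le_of_le (norm_mul_le_of_le le_rfl le_rfl)
      ((norm_matrix_transpose _).trans_le h.norm_G_le)
  · refine norm_mul_le_of_le (norm_matrix_transpose _).le
      ((norm_add_le _ _).trans (add_le_add ?_ ?_))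
    · exact (norm_mul_le_of_le le_rfl le_rfl).trans (mul_comm _ _).le
    · exact (norm_mul_le_of_le le_rfl le_rfl).trans (mul_comm _ _).le

end PCAEquations

end Matrices

/-! ### Normal equations and smallest singular value of the estimator -/

section Spectral

variable {r : ℕ}

/-- The `T × N` matrix with `d` on its diagonal. -/
def rectDiagonal (d : ℕ → ℝ) (N T : ℕ) : Matrix (Fin T) (Fin N) ℝ :=
  Matrix.of fun (t : Fin T) (i : Fin N) => if (t : ℕ) = i then d t else 0

lemma mul_rectDiagonal_apply {N T : ℕ} {m : Type*} (A : Matrix m (Fin T) ℝ) (d : ℕ → ℝ) (i : m)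
    (j : Fin N) (hj : (j : ℕ) < T) : (A * rectDiagonal d N T) i j = A i ⟨j, hj⟩ * d j := by
  rw [Matrix.mul_apply, Finset.sum_eq_single ⟨j, hj⟩]
  · simp [rectDiagonal]
  · intro t _ ht
    have : (t : ℕ) ≠ j := fun h => ht (Fin.ext h)
    simp [rectDiagonal, this]
  · simp

lemma rectDiagonal_transpose (d : ℕ → ℝ) (N T : ℕ) :
    (rectDiagonal d N T)ᵀ = rectDiagonal d T N := by
  ext i j
  by_cases h : (j : ℕ) = i
  · simp [rectDiagonal, h]
  · have h' : (i : ℕ) ≠ j := fun hc => h hc.symm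
    simp [rectDiagonal, h, h']

/-- A rectangular diagonal matrix with decreasing entries shrinks, by at least the factor `d k`,
the vectors whose first `k` coordinates vanish. -/
lemma rectDiagonal_mulVec_dotProduct_le {d : ℕ → ℝ} (hd : Antitone d) (hd0 : ∀ k, 0 ≤ d k)
    {N T : ℕ} {k : ℕ} {y : Fin N → ℝ} (hy : ∀ j : Fin N, (j : ℕ) < k → y j = 0) :
    (rectDiagonal d N T *ᵥ y) ⬝ᵥ (rectDiagonal d N T *ᵥ y) ≤ d k ^ 2 * (y ⬝ᵥ y) := by
  have h1 : (rectDiagonal d N T *ᵥ y) ⬝ᵥ (rectDiagonal d N T *ᵥ y) =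
      ((rectDiagonal d N T *ᵥ y) ᵥ* rectDiagonal d N T) ⬝ᵥ y := by
    rw [Matrix.dotProduct_mulVec]
  rw [h1]
  simp only [dotProduct]
  rw [Finset.mul_sum]
  refine Finset.sum_le_sum fun j _ => ?_
  by_cases hjk : (j : ℕ) < k
  · rw [hy j hjk]; simp
  · have hdj : d j ^ 2 ≤ d k ^ 2 := pow_le_pow_left₀ (hd0 _) (hd (not_lt.1 hjk)) 2
    by_cases hjT : (j : ℕ) < T
    · have h2 : ((rectDiagonal d N T *ᵥ y) ᵥ* rectDiagonal d N T) j = d j ^ 2 * y j := by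
        have h3 : (rectDiagonal d N T *ᵥ y) ⟨j, hjT⟩ = d j * y j := by
          rw [Matrix.mulVec, dotProduct, Finset.sum_eq_single j]
          · simp [rectDiagonal]
          · intro i _ hi
            have : (j : ℕ) ≠ i := fun h => hi (Fin.ext h.symm)
            simp [rectDiagonal, this]
          · simp
        rw [Matrix.vecMul, dotProduct, Finset.sum_eq_single ⟨j, hjT⟩]
        · rw [h3]; simp [rectDiagonal]; ring
        · intro t _ ht
          have : (t : ℕ) ≠ j := fun h => ht (Fin.ext h)
          simp [rectDiagonal, this]
        · simp
      rw [h2]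
      nlinarith [mul_le_mul_of_nonneg_right hdj (mul_self_nonneg (y j))]
    · have h2 : ((rectDiagonal d N T *ᵥ y) ᵥ* rectDiagonal d N T) j = 0 := by
        rw [Matrix.vecMul, dotProduct]
        refine Finset.sum_eq_zero fun t _ => ?_
        have : (t : ℕ) ≠ j := fun h => hjT (h ▸ t.2)
        simp [rectDiagonal, this]
      rw [h2, zero_mul]
      exact mul_nonneg (sq_nonneg _) (mul_self_nonneg _)

lemma dotProduct_mulVec_self_of_orthogonal {m n : Type*} [Fintype m] [Fintype n] [DecidableEq n]
    {W : Matrix m n ℝ} (hW : Wᵀ * W = 1) (x : n → ℝ) : (W *ᵥ x) ⬝ᵥ (W *ᵥ x) = x ⬝ᵥ x := by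
  rw [Matrix.dotProduct_mulVec, ← Matrix.mulVec_transpose, Matrix.mulVec_mulVec, hW,
    Matrix.one_mulVec]

lemma orthonormal_submatrix {m n l : Type*} [Fintype m] [DecidableEq n] [DecidableEq l]
    {W : Matrix m n ℝ} (hW : Wᵀ * W = 1) {f : l → n} (hf : Function.Injective f) :
    (W.submatrix id f)ᵀ * W.submatrix id f = 1 := by
  have h : (W.submatrix id f)ᵀ * W.submatrix id f = (Wᵀ * W).submatrix f f := rfl
  rw [h, hW, Matrix.submatrix_one f hf]

/-- The estimator rescaled to `U = F̃ / √T` and `Q = Λ̃ / √ν` satisfies the normal equations of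
`X / √(T ν)`, with diagonal `Qᵀ Q`. Its diagonal entries, the squared leading singular values, are
bounded below by any lower bound of `X / √(T ν)` on the range of an injective `L` with `r` columns
(Courant-Fischer). -/
lemma IsPCEstimator.normal_equations {N T : ℕ} {X : Matrix (Fin T) (Fin N) ℝ}
    {Ft : Matrix (Fin T) (Fin r) ℝ} {Lt : Matrix (Fin N) (Fin r) ℝ} (h : IsPCEstimator X Ft Lt)
    (hN : 0 < N) (hT : 0 < T) {ν : ℝ} (hν : 0 < ν) {U : Matrix (Fin T) (Fin r) ℝ}
    {Q : Matrix (Fin N) (Fin r) ℝ} {Y : Matrix (Fin T) (Fin N) ℝ}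
    (hU : U = (1 / √(T : ℝ)) • Ft) (hQ : Q = (1 / √ν) • Lt) (hY : Y = (1 / √(T * ν)) • X) :
    ∃ δ : Fin r → ℝ, Uᵀ * U = 1 ∧ Q = Yᵀ * U ∧ Y * Q = U * (Qᵀ * Q) ∧
      Qᵀ * Q = Matrix.diagonal δ ∧
      ∀ (L : Matrix (Fin N) (Fin r) ℝ) (s : ℝ), (∀ a, L *ᵥ a = 0 → a = 0) →
        (∀ a, s * ((L *ᵥ a) ⬝ᵥ (L *ᵥ a)) ≤ (Y *ᵥ (L *ᵥ a)) ⬝ᵥ (Y *ᵥ (L *ᵥ a))) →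
        ∀ k, s ≤ δ k := by
  obtain ⟨hrT, hrN, U₀, V₀, d, hU₀, hV₀, hd, hd0, hX, hFt, hLt⟩ := h
  have hT' : (0 : ℝ) < T := Nat.cast_pos.2 hT
  have hN' : (0 : ℝ) < N := Nat.cast_pos.2 hN
  set c : ℝ := √N / √ν with hc
  have hcpos : 0 < c := by positivity
  have hUU : U₀ᵀ * U₀ = 1 := by
    rw [← Matrix.conjTranspose_eq_transpose_of_trivial]
    exact (Matrix.mem_orthogonalGroup_iff' (Fin T) ℝ).1 hU₀
  have hVV : V₀ᵀ * V₀ = 1 := by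
    rw [← Matrix.conjTranspose_eq_transpose_of_trivial]
    exact (Matrix.mem_orthogonalGroup_iff' (Fin N) ℝ).1 hV₀
  have hVV' : V₀ * V₀ᵀ = 1 := mul_eq_one_comm.1 hVV
  have hYe : Y = c • (U₀ * rectDiagonal d N T * V₀ᵀ) := by
    have h1 : U₀ * rectDiagonal d N T * V₀ᵀ = (1 / √((N : ℝ) * T)) • X := hX.symm
    rw [h1, hY, smul_smul]
    congr 1
    rw [hc, Real.sqrt_mul hT'.le, Real.sqrt_mul hN'.le]
    field_simp
  have hUe : U = U₀.submatrix id (Fin.castLE hrT) := by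
    ext t k
    rw [hU, hFt]
    simp only [Matrix.smul_apply, Matrix.of_apply, smul_eq_mul, Matrix.submatrix_apply, id]
    field_simp
  have hQe : Q = c • (V₀.submatrix id (Fin.castLE hrN) * Matrix.diagonal fun k : Fin r => d k) := by
    ext i k
    rw [hQ, hLt]
    simp only [Matrix.smul_apply, Matrix.of_apply, smul_eq_mul, Matrix.mul_diagonal,
      Matrix.submatrix_apply, id, hc]
    field_simp
  have hVsub : (V₀.submatrix id (Fin.castLE hrN))ᵀ * V₀.submatrix id (Fin.castLE hrN) =
      (1 : Matrix (Fin r) (Fin r) ℝ) := by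
    exact orthonormal_submatrix hVV (Fin.castLE_injective hrN)
  have hYV : Y * V₀ = c • (U₀ * rectDiagonal d N T) := by
    rw [hYe, Matrix.smul_mul, Matrix.mul_assoc _ V₀ᵀ, hVV, Matrix.mul_one]
  have hYU : Yᵀ * U₀ = c • (V₀ * rectDiagonal d T N) := by
    rw [hYe, Matrix.transpose_smul, Matrix.smul_mul, Matrix.transpose_mul, Matrix.transpose_mul,
      Matrix.transpose_transpose, rectDiagonal_transpose, Matrix.mul_assoc, Matrix.mul_assoc, hUU,
      Matrix.mul_one]
  have hQQ : Qᵀ * Q = Matrix.diagonal fun k : Fin r => c ^ 2 * d k ^ 2 := by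
    rw [hQe, Matrix.transpose_smul, Matrix.smul_mul, Matrix.mul_smul, smul_smul,
      Matrix.transpose_mul, Matrix.diagonal_transpose, Matrix.mul_assoc,
      ← Matrix.mul_assoc (V₀.submatrix id _)ᵀ, hVsub, Matrix.one_mul, Matrix.diagonal_mul_diagonal]
    ext i j
    by_cases hij : i = j
    · subst hij; simp; ring
    · simp [hij]
  refine ⟨fun k => c ^ 2 * d k ^ 2, ?_, ?_, ?_, hQQ, ?_⟩
  · rw [hUe]
    exact orthonormal_submatrix hUU (Fin.castLE_injective hrT)
  · ext i k
    have h1 : (Yᵀ * U) i k = (Yᵀ * U₀) i (Fin.castLE hrT k) := by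
      rw [hUe]; rfl
    rw [h1, hYU, hQe, Matrix.smul_apply, Matrix.smul_apply,
      mul_rectDiagonal_apply _ _ _ _ (by simpa using k.2.trans_le hrN), Matrix.mul_diagonal]
    rfl
  · rw [hQQ]
    ext t k
    have h1 : (Y * V₀.submatrix id (Fin.castLE hrN)) t k = (Y * V₀) t (Fin.castLE hrN k) := rfl
    rw [hQe, Matrix.mul_smul, ← Matrix.mul_assoc, Matrix.smul_apply, Matrix.mul_diagonal, h1, hYV,
      Matrix.smul_apply, mul_rectDiagonal_apply _ _ _ _ (by simpa using k.2.trans_le hrT),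
      Matrix.mul_diagonal, hUe]
    simp only [smul_eq_mul, Matrix.submatrix_apply, id, Fin.val_castLE]
    have h2 : U₀ t ⟨k, by simpa using k.2.trans_le hrT⟩ = U₀ t (Fin.castLE hrT k) := rfl
    rw [h2]
    ring
  · intro L s hL hs k
    -- a vector in the range of `L` orthogonal to the first `r - 1` right singular vectors
    obtain ⟨a, ha, ha0⟩ : ∃ a : Fin r → ℝ, a ≠ 0 ∧
        ∀ j : Fin N, (j : ℕ) < r - 1 → (V₀ᵀ *ᵥ (L *ᵥ a)) j = 0 := by
      have hr : r - 1 ≤ N := (Nat.sub_le _ _).trans hrN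
      let φ : (Fin r → ℝ) →ₗ[ℝ] (Fin (r - 1) → ℝ) :=
        ((V₀ᵀ * L).submatrix (Fin.castLE hr) id).mulVecLin
      have hφ : LinearMap.ker φ ≠ ⊥ := by
        refine LinearMap.ker_ne_bot_of_finrank_lt ?_
        simp only [Module.finrank_fintype_fun_eq_card, Fintype.card_fin]
        have := k.pos
        omega
      obtain ⟨a, ha, ha0⟩ := (Submodule.ne_bot_iff _).1 hφ
      refine ⟨a, ha0, fun j hj => ?_⟩
      have h1 := congrFun (LinearMap.mem_ker.1 ha) ⟨j, hj⟩
      rw [Matrix.mulVec_mulVec]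
      exact h1
    set w := L *ᵥ a with hw
    have hw0 : 0 < w ⬝ᵥ w := by
      have h1 : w ≠ 0 := fun hc => ha (hL a hc)
      have h2 : 0 ≤ w ⬝ᵥ w := Finset.sum_nonneg fun i _ => mul_self_nonneg _
      exact lt_of_le_of_ne h2 fun hc => h1 (dotProduct_self_eq_zero.1 hc.symm)
    have hYw : (Y *ᵥ w) ⬝ᵥ (Y *ᵥ w) ≤ c ^ 2 * (d (r - 1) ^ 2 * (w ⬝ᵥ w)) := by
      have h1 : Y *ᵥ w = c • (U₀ *ᵥ (rectDiagonal d N T *ᵥ (V₀ᵀ *ᵥ w))) := by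
        rw [hYe, Matrix.smul_mulVec, ← Matrix.mulVec_mulVec, ← Matrix.mulVec_mulVec]
      have hV₀' : (V₀ᵀ)ᵀ * V₀ᵀ = 1 := by rw [Matrix.transpose_transpose, hVV']
      rw [h1, smul_dotProduct, dotProduct_smul, dotProduct_mulVec_self_of_orthogonal hUU, smul_smul,
        smul_eq_mul, ← sq, ← dotProduct_mulVec_self_of_orthogonal hV₀' w]
      exact mul_le_mul_of_nonneg_left (rectDiagonal_mulVec_dotProduct_le hd hd0 ha0) (sq_nonneg _)
    have h1 : s ≤ c ^ 2 * d (r - 1) ^ 2 := by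
      refine le_of_mul_le_mul_right ((hs a).trans (hYw.trans (le_of_eq ?_))) hw0
      ring
    refine h1.trans (mul_le_mul_of_nonneg_left (pow_le_pow_left₀ (hd0 _) (hd ?_) 2) (sq_nonneg _))
    have := k.2
    omega

end Spectral

/-! ### Central limit theorem with random weights -/

section StableCLT

open Complex (I)
open scoped RealInnerProductSpace

variable {r : ℕ}

/-- The inner product `⟨k₁, z₁⟩ + ⟨k₂, z₂⟩` of two pairs of vectors. -/
noncomputable def pairing (k z : EuclideanSpace ℝ (Fin r) × EuclideanSpace ℝ (Fin r)) : ℝ :=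
  ⟪k.1, z.1⟫ + ⟪k.2, z.2⟫

lemma pairing_sub (k k' z : EuclideanSpace ℝ (Fin r) × EuclideanSpace ℝ (Fin r)) :
    pairing k z - pairing k' z = pairing (k - k') z := by
  simp only [pairing, Prod.fst_sub, Prod.snd_sub, inner_sub_left]; ring

lemma pairing_smul (c : ℝ) (k z : EuclideanSpace ℝ (Fin r) × EuclideanSpace ℝ (Fin r)) :
    pairing (c • k) z = c * pairing k z := by
  simp only [pairing, Prod.smul_fst, Prod.smul_snd, real_inner_smul_left]; ring

lemma abs_pairing_le (k z : EuclideanSpace ℝ (Fin r) × EuclideanSpace ℝ (Fin r)) :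
    |pairing k z| ≤ 2 * ‖k‖ * ‖z‖ := by
  have h1 := abs_real_inner_le_norm k.1 z.1
  have h2 := abs_real_inner_le_norm k.2 z.2
  have h3 := mul_le_mul (norm_fst_le k) (norm_fst_le z) (norm_nonneg _) (norm_nonneg _)
  have h4 := mul_le_mul (norm_snd_le k) (norm_snd_le z) (norm_nonneg _) (norm_nonneg _)
  exact (abs_add_le _ _).trans (by linarith)

lemma continuous_pairing : Continuous fun p : (EuclideanSpace ℝ (Fin r) ×
    EuclideanSpace ℝ (Fin r)) × (EuclideanSpace ℝ (Fin r) × EuclideanSpace ℝ (Fin r)) =>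
    pairing p.1 p.2 := by
  unfold pairing; fun_prop

lemma aemeasurable_pairing {Ω : Type*} [MeasurableSpace Ω] {μ : Measure Ω}
    {k z : Ω → EuclideanSpace ℝ (Fin r) × EuclideanSpace ℝ (Fin r)} (hk : AEMeasurable k μ)
    (hz : AEMeasurable z μ) : AEMeasurable (fun ω => pairing (k ω) (z ω)) μ := by
  have h := (continuous_pairing (r := r)).measurable.comp_aemeasurable (hk.prodMk hz)
  exact h

lemma norm_cexp_mul_I_sub_le (x y : ℝ) :
    ‖Complex.exp (x * I) - Complex.exp (y * I)‖ ≤ |x - y| := by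
  have h : Complex.exp (x * I) - Complex.exp (y * I) =
      Complex.exp (y * I) * (Complex.exp (I * ((x - y : ℝ) : ℂ)) - 1) := by
    rw [mul_sub, mul_one, ← Complex.exp_add]
    congr 2
    push_cast; ring
  rw [h, norm_mul, Complex.norm_exp_ofReal_mul_I, one_mul]
  exact Real.norm_exp_I_mul_ofReal_sub_one_le

/-- The characteristic function of `pairing k z` depends continuously, in `L¹`, on the random
weights `k`, uniformly over tight `z`. -/
lemma norm_integral_cexp_pairing_sub_le {Ω : Type*} [MeasurableSpace Ω] {μ : Measure Ω}
    [IsProbabilityMeasure μ] {k k' z : Ω → EuclideanSpace ℝ (Fin r) × EuclideanSpace ℝ (Fin r)}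
    (hk : AEMeasurable k μ) (hk' : AEMeasurable k' μ) (hz : AEMeasurable z μ)
    (hi : Integrable (fun ω => k ω - k' ω) μ) {R : ℝ} (hR : 0 ≤ R) :
    ‖∫ ω, Complex.exp (pairing (k ω) (z ω) * I) ∂μ -
        ∫ ω, Complex.exp (pairing (k' ω) (z ω) * I) ∂μ‖ ≤
      2 * R * ∫ ω, ‖k ω - k' ω‖ ∂μ + 2 * μ.real {ω | R < ‖z ω‖} := by
  have hm : ∀ {g : Ω → EuclideanSpace ℝ (Fin r) × EuclideanSpace ℝ (Fin r)}, AEMeasurable g μ →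
      Integrable (fun ω => Complex.exp (pairing (g ω) (z ω) * I)) μ := by
    intro g hg
    refine Integrable.of_bound (C := 1) ?_ (ae_of_all _ fun ω => ?_)
    · have h1 : Measurable fun p : (EuclideanSpace ℝ (Fin r) × EuclideanSpace ℝ (Fin r)) ×
          (EuclideanSpace ℝ (Fin r) × EuclideanSpace ℝ (Fin r)) =>
          Complex.exp (pairing p.1 p.2 * I) := by
        have := (continuous_pairing (r := r)).measurable
        fun_prop
      exact (h1.comp_aemeasurable (hg.prodMk hz)).aestronglyMeasurable
    · exact (Complex.norm_exp_ofReal_mul_I _).le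
  have hs : NullMeasurableSet {ω | R < ‖z ω‖} μ := nullMeasurableSet_lt (by fun_prop) (by fun_prop)
  have hind : Integrable ({ω | R < ‖z ω‖}.indicator fun _ => (2 : ℝ)) μ :=
    (integrable_const _).indicator₀ hs
  rw [← integral_sub (hm hk) (hm hk')]
  calc ‖∫ ω, Complex.exp (pairing (k ω) (z ω) * I) - Complex.exp (pairing (k' ω) (z ω) * I) ∂μ‖
      ≤ ∫ ω, ‖Complex.exp (pairing (k ω) (z ω) * I) - Complex.exp (pairing (k' ω) (z ω) * I)‖ ∂μ :=
        norm_integral_le_integral_norm _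
    _ ≤ ∫ ω, (2 * R * ‖k ω - k' ω‖ + {ω | R < ‖z ω‖}.indicator (fun _ => (2 : ℝ)) ω) ∂μ := by
        refine integral_mono ((hm hk).sub (hm hk')).norm ((hi.norm.const_mul _).add hind)
          fun ω => ?_
        by_cases hω : R < ‖z ω‖
        · have h1 : {ω | R < ‖z ω‖}.indicator (fun _ => (2 : ℝ)) ω = 2 :=
            Set.indicator_of_mem (s := {ω | R < ‖z ω‖}) hω _
          simp only [h1]
          refine (norm_sub_le _ _).trans ?_
          rw [Complex.norm_exp_ofReal_mul_I, Complex.norm_exp_ofReal_mul_I]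
          have : 0 ≤ 2 * R * ‖k ω - k' ω‖ := by positivity
          linarith
        · have h1 : {ω | R < ‖z ω‖}.indicator (fun _ => (2 : ℝ)) ω = 0 :=
            Set.indicator_of_notMem (s := {ω | R < ‖z ω‖}) hω _
          simp only [h1, add_zero]
          refine (norm_cexp_mul_I_sub_le _ _).trans ?_
          rw [pairing_sub]
          refine (abs_pairing_le _ _).trans ?_
          have := mul_le_mul_of_nonneg_left (not_lt.1 hω) (norm_nonneg (k ω - k' ω))
          linarith
    _ = 2 * R * ∫ ω, ‖k ω - k' ω‖ ∂μ + 2 * μ.real {ω | R < ‖z ω‖} := by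
        rw [integral_add (hi.norm.const_mul _) hind, integral_const_mul, integral_indicator₀ hs,
          setIntegral_const, smul_eq_mul, mul_comm (2 : ℝ) (μ.real _)]

lemma BddInProb.exists_measureReal_le {Ω : Type*} [MeasurableSpace Ω] {μ : Measure Ω}
    {X : ℕ × Ω → ℝ} (hX : BddInProb μ X) {ε : ℝ} (hε : 0 < ε) :
    ∃ R : ℝ, 0 ≤ R ∧ ∀ R' ≥ R, ∀ᶠ n in atTop, μ.real {ω | R' < |X (n, ω)|} ≤ ε := by
  obtain ⟨K, hK⟩ := hX ε hε
  refine ⟨max K 0, le_max_right _ _, fun R' hR' => ?_⟩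
  filter_upwards [hK] with n hn
  refine ENNReal.toReal_le_of_le_ofReal hε.le (le_trans (measure_mono fun ω hω => ?_) hn)
  exact lt_of_le_of_lt ((le_max_left _ _).trans hR') hω

/-- Convergence in distribution of `ζ_n`, jointly with the fixed variable `V`, passes to
`pairing (κ_n V) (ζ_n)` when the weights `κ_n` converge almost everywhere, even to a
discontinuous limit: that limit is approximated in `L¹` by continuous functions of `V`. -/
lemma tendsto_integral_cexp_pairing {Ω : Type*} [MeasurableSpace Ω] {μ : Measure Ω}
    [IsProbabilityMeasure μ]
    {ν : Measure (EuclideanSpace ℝ (Fin r) × EuclideanSpace ℝ (Fin r))} [IsProbabilityMeasure ν]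
    {V : Ω → EuclideanSpace ℝ (Fin r) × EuclideanSpace ℝ (Fin r)} (hV : Measurable V)
    {ζ : ℕ → Ω → EuclideanSpace ℝ (Fin r) × EuclideanSpace ℝ (Fin r)}
    (hclt : TendstoInDistribution (fun n ω => (V ω, ζ n ω)) atTop
      (fun p : Ω × (EuclideanSpace ℝ (Fin r) × EuclideanSpace ℝ (Fin r)) => (V p.1, p.2))
      (fun _ => μ) (μ.prod ν))
    (hζ : BddInProb μ fun p => ‖ζ p.1 p.2‖)
    {κ : ℕ → EuclideanSpace ℝ (Fin r) × EuclideanSpace ℝ (Fin r) →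
      EuclideanSpace ℝ (Fin r) × EuclideanSpace ℝ (Fin r)} (hκ : ∀ n, Measurable (κ n))
    {κ' : EuclideanSpace ℝ (Fin r) × EuclideanSpace ℝ (Fin r) →
      EuclideanSpace ℝ (Fin r) × EuclideanSpace ℝ (Fin r)} (hκ' : Measurable κ')
    {C : ℝ} (hC : ∀ n v, ‖κ n v‖ ≤ C)
    (hlim : ∀ᵐ v ∂(μ.map V), Tendsto (fun n => κ n v) atTop (𝓝 (κ' v))) :
    Tendsto (fun n => ∫ ω, Complex.exp (pairing (κ n (V ω)) (ζ n ω) * I) ∂μ) atTop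
      (𝓝 (∫ p, Complex.exp (pairing (κ' (V p.1)) p.2 * I) ∂(μ.prod ν))) := by
  have hP : IsProbabilityMeasure (μ.map V) := Measure.isProbabilityMeasure_map hV.aemeasurable
  have hζm : ∀ n, AEMeasurable (ζ n) μ := fun n => (hclt.forall_aemeasurable n).snd
  have hC' : ∀ᵐ v ∂(μ.map V), ‖κ' v‖ ≤ C := by
    filter_upwards [hlim] with v hv
    exact le_of_tendsto hv.norm (.of_forall fun n => hC n v)
  have hκi : ∀ n, Integrable (κ n) (μ.map V) := fun n =>
    Integrable.of_bound (hκ n).aestronglyMeasurable C (ae_of_all _ (hC n))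
  have hκ'i : Integrable κ' (μ.map V) := Integrable.of_bound hκ'.aestronglyMeasurable C hC'
  have hL1 : Tendsto (fun n => ∫ v, ‖κ n v - κ' v‖ ∂(μ.map V)) atTop (𝓝 0) := by
    have h0 : (0 : ℝ) = ∫ _, (0 : ℝ) ∂(μ.map V) := by simp
    rw [h0]
    refine tendsto_integral_of_dominated_convergence (fun _ => C + C)
      (fun n => ((hκi n).sub hκ'i).norm.aestronglyMeasurable) (integrable_const _) (fun n => ?_) ?_
    · filter_upwards [hC'] with v hv
      rw [norm_norm]
      exact (norm_sub_le _ _).trans (add_le_add (hC n v) hv)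
    · filter_upwards [hlim] with v hv
      exact tendsto_iff_norm_sub_tendsto_zero.1 hv
  rw [Metric.tendsto_nhds]
  intro ε hε
  obtain ⟨R₁, hR₁, hR₁'⟩ := hζ.exists_measureReal_le (ε := ε / 16) (by positivity)
  have hν : BddInProb (μ.prod ν) fun p : ℕ × (Ω × (EuclideanSpace ℝ (Fin r) ×
      EuclideanSpace ℝ (Fin r))) => ‖p.2.2‖ :=
    .of_measurable (Y := fun p : Ω × (EuclideanSpace ℝ (Fin r) ×
      EuclideanSpace ℝ (Fin r)) => ‖p.2‖) (by fun_prop)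
  obtain ⟨R₂, hR₂, hR₂'⟩ := hν.exists_measureReal_le (ε := ε / 16) (by positivity)
  set R := max R₁ R₂ with hRdef
  have hR : 0 ≤ R := hR₁.trans (le_max_left _ _)
  have htν : (μ.prod ν).real {p | R < ‖p.2‖} ≤ ε / 16 := by
    obtain ⟨n, hn⟩ := (hR₂' R (le_max_right _ _)).exists
    simpa using hn
  set η := ε / (16 * (R + 1)) with hη
  have hηpos : 0 < η := by positivity
  have hRη : 2 * R * η ≤ ε / 8 := by
    have : (R + 1) * η = ε / 16 := by rw [hη]; field_simp
    nlinarith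
  obtain ⟨g, hg, hgi⟩ := hκ'i.exists_boundedContinuous_integral_sub_le hηpos
  have hgm : Measurable g := g.continuous.measurable
  -- characteristic functions with the continuous weights `g` converge
  have hcont : Tendsto (fun n => ∫ ω, Complex.exp (pairing (g (V ω)) (ζ n ω) * I) ∂μ) atTop
      (𝓝 (∫ p, Complex.exp (pairing (g (V p.1)) p.2 * I) ∂(μ.prod ν))) := by
    have h1 := hclt.continuous_comp (g := fun p => pairing (g p.1) p.2)
      (continuous_pairing.comp ((g.continuous.comp continuous_fst).prodMk continuous_snd))
    have h2 := ProbabilityMeasure.tendsto_iff_tendsto_charFun.1 h1.tendsto 1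
    simp only [ProbabilityMeasure.coe_mk, charFun_apply_real] at h2
    rw [integral_map h1.aemeasurable_limit (by fun_prop)] at h2
    simp_rw [fun n => integral_map (h1.forall_aemeasurable n) (f := fun x : ℝ =>
      Complex.exp (((1 : ℝ) : ℂ) * x * I)) (by fun_prop)] at h2
    simpa using h2
  have e1 : ∀ n, ∫ ω, ‖κ n (V ω) - κ' (V ω)‖ ∂μ = ∫ v, ‖κ n v - κ' v‖ ∂(μ.map V) := fun n =>
    (integral_map (f := fun v => ‖κ n v - κ' v‖) hV.aemeasurable
      ((hκ n).sub hκ').norm.aestronglyMeasurable).symm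
  have e2 : ∫ ω, ‖κ' (V ω) - g (V ω)‖ ∂μ = ∫ v, ‖κ' v - g v‖ ∂(μ.map V) :=
    (integral_map (f := fun v => ‖κ' v - g v‖) hV.aemeasurable
      (hκ'.sub hgm).norm.aestronglyMeasurable).symm
  have i2 : Integrable (fun ω => κ' (V ω) - g (V ω)) μ :=
    (hκ'i.sub hgi).comp_measurable hV
  have e3 : ∫ p, ‖g (V p.1) - κ' (V p.1)‖ ∂(μ.prod ν) = ∫ v, ‖κ' v - g v‖ ∂(μ.map V) := by
    rw [← e2, integral_fun_fst (f := fun ω => ‖g (V ω) - κ' (V ω)‖)]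
    simp [norm_sub_rev]
  have i3 : Integrable (fun p : Ω × (EuclideanSpace ℝ (Fin r) × EuclideanSpace ℝ (Fin r)) =>
      g (V p.1) - κ' (V p.1)) (μ.prod ν) :=
    ((hgi.sub hκ'i).comp_measurable hV).comp_fst ν
  have b3 := norm_integral_cexp_pairing_sub_le (μ := μ.prod ν)
    (k := fun p => g (V p.1)) (k' := fun p => κ' (V p.1)) (z := fun p => p.2)
    (by fun_prop) (by fun_prop) (by fun_prop) i3 hR
  rw [e3] at b3
  filter_upwards [hR₁' R (le_max_left _ _), hL1.eventually_le_const hηpos,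
    (Metric.tendsto_nhds.1 hcont) (ε / 8) (by positivity)] with n h1 h2 h3
  have h1' : μ.real {ω | R < ‖ζ n ω‖} ≤ ε / 16 := by simpa using h1
  have b1 := norm_integral_cexp_pairing_sub_le (μ := μ)
    (k := fun ω => κ n (V ω)) (k' := fun ω => κ' (V ω)) (z := ζ n)
    ((hκ n).comp hV).aemeasurable (by fun_prop) (hζm n)
    (((hκi n).sub hκ'i).comp_measurable hV) hR
  have b2 := norm_integral_cexp_pairing_sub_le (μ := μ)
    (k := fun ω => κ' (V ω)) (k' := fun ω => g (V ω)) (z := ζ n)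
    (by fun_prop) (by fun_prop) (hζm n) i2 hR
  rw [e1] at b1
  rw [e2] at b2
  have m1 := mul_le_mul_of_nonneg_left h2 (by positivity : 0 ≤ 2 * R)
  have m2 := mul_le_mul_of_nonneg_left hg (by positivity : 0 ≤ 2 * R)
  rw [dist_eq_norm] at h3 ⊢
  set x₀ := ∫ ω, Complex.exp (pairing (κ n (V ω)) (ζ n ω) * I) ∂μ
  set x₁ := ∫ ω, Complex.exp (pairing (κ' (V ω)) (ζ n ω) * I) ∂μ
  set x₂ := ∫ ω, Complex.exp (pairing (g (V ω)) (ζ n ω) * I) ∂μ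
  set x₃ := ∫ p, Complex.exp (pairing (g (V p.1)) p.2 * I) ∂(μ.prod ν)
  set x₄ := ∫ p, Complex.exp (pairing (κ' (V p.1)) p.2 * I) ∂(μ.prod ν)
  have ht : x₀ - x₄ = (x₀ - x₁) + (x₁ - x₂) + (x₂ - x₃) + (x₃ - x₄) := by ring
  rw [ht]
  refine lt_of_le_of_lt (norm_add₄_le) ?_
  linarith

end StableCLT

section Studentized

open Complex (I)
open scoped RealInnerProductSpace

variable {r : ℕ}

/-- The quadratic form `x' S x`. -/
noncomputable def quad (S : Matrix (Fin r) (Fin r) ℝ) (x : EuclideanSpace ℝ (Fin r)) : ℝ :=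
  x.ofLp ⬝ᵥ (S *ᵥ x.ofLp)

lemma quad_smul (S : Matrix (Fin r) (Fin r) ℝ) (c : ℝ) (x : EuclideanSpace ℝ (Fin r)) :
    quad S (c • x) = c ^ 2 * quad S x := by
  simp only [quad, WithLp.ofLp_smul, Matrix.mulVec_smul, dotProduct_smul, smul_dotProduct,
    smul_eq_mul]
  ring

@[simp] lemma quad_zero (S : Matrix (Fin r) (Fin r) ℝ) : quad S 0 = 0 := by
  simp [quad]

lemma continuous_quad (S : Matrix (Fin r) (Fin r) ℝ) : Continuous (quad S) := by
  unfold quad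
  exact (PiLp.continuous_ofLp 2 _).dotProduct
    (continuous_const.matrix_mulVec (PiLp.continuous_ofLp 2 _))

lemma quad_pos {S : Matrix (Fin r) (Fin r) ℝ} (hS : S.PosDef) {x : EuclideanSpace ℝ (Fin r)}
    (hx : x ≠ 0) : 0 < quad S x := by
  have h : x.ofLp ≠ 0 := fun h => hx (by ext i; exact congrFun h i)
  simpa [quad] using hS.dotProduct_mulVec_pos h

lemma quad_nonneg {S : Matrix (Fin r) (Fin r) ℝ} (hS : S.PosDef) (x : EuclideanSpace ℝ (Fin r)) :
    0 ≤ quad S x := by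
  rcases eq_or_ne x 0 with rfl | hx
  · simp
  · exact (quad_pos hS hx).le

/-- A positive definite form is bounded below by a multiple of the squared norm. -/
lemma exists_le_quad {S : Matrix (Fin r) (Fin r) ℝ} (hS : S.PosDef) :
    ∃ m > 0, ∀ x, m * ‖x‖ ^ 2 ≤ quad S x := by
  rcases (Metric.sphere (0 : EuclideanSpace ℝ (Fin r)) 1).eq_empty_or_nonempty with he | hne
  · refine ⟨1, one_pos, fun x => ?_⟩
    rcases eq_or_ne x 0 with rfl | hx
    · simp
    · have h1 : (‖x‖⁻¹ • x) ∈ Metric.sphere (0 : EuclideanSpace ℝ (Fin r)) 1 := by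
        simp [norm_smul, norm_ne_zero_iff.2 hx]
      rw [he] at h1
      exact h1.elim
  · obtain ⟨y, hy, hmin⟩ := (isCompact_sphere (0 : EuclideanSpace ℝ (Fin r)) 1).exists_isMinOn hne
      (continuous_quad S).continuousOn
    have hy0 : y ≠ 0 := by
      rintro rfl
      simp at hy
    refine ⟨quad S y, quad_pos hS hy0, fun x => ?_⟩
    rcases eq_or_ne x 0 with rfl | hx
    · simp
    · have h1 : (‖x‖⁻¹ • x) ∈ Metric.sphere (0 : EuclideanSpace ℝ (Fin r)) 1 := by
        simp [norm_smul, norm_ne_zero_iff.2 hx]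
      have h2 : quad S y ≤ quad S (‖x‖⁻¹ • x) := hmin h1
      rw [quad_smul, inv_pow, ← div_eq_inv_mul,
        le_div_iff₀ (pow_pos (norm_pos_iff.2 hx) 2)] at h2
      exact h2

/-- The standard deviation of `a ⟨v₁, x⟩ + b ⟨v₂, y⟩` for independent `x ~ N(0, Γ)` and
`y ~ N(0, Φ)`. -/
noncomputable def stdDev (Γ Φ : Matrix (Fin r) (Fin r) ℝ) (a b : ℝ)
    (v : EuclideanSpace ℝ (Fin r) × EuclideanSpace ℝ (Fin r)) : ℝ :=
  √(a ^ 2 * quad Γ v.1 + b ^ 2 * quad Φ v.2)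

/-- The weights `(a v₁, b v₂)`, studentized. -/
noncomputable def weight (Γ Φ : Matrix (Fin r) (Fin r) ℝ) (a b : ℝ)
    (v : EuclideanSpace ℝ (Fin r) × EuclideanSpace ℝ (Fin r)) :
    EuclideanSpace ℝ (Fin r) × EuclideanSpace ℝ (Fin r) :=
  (stdDev Γ Φ a b v)⁻¹ • (a • v.1, b • v.2)

variable {Γ Φ : Matrix (Fin r) (Fin r) ℝ}

lemma stdDev_pos (hΓ : Γ.PosDef) (hΦ : Φ.PosDef) {a b : ℝ} (ha : 0 < a) (hb : 0 < b)
    {v : EuclideanSpace ℝ (Fin r) × EuclideanSpace ℝ (Fin r)} (hv : v.1 ≠ 0 ∨ v.2 ≠ 0) :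
    0 < stdDev Γ Φ a b v := by
  refine Real.sqrt_pos.2 ?_
  have h1 := quad_nonneg hΓ v.1
  have h2 := quad_nonneg hΦ v.2
  rcases hv with h | h
  · have := quad_pos hΓ h; positivity
  · have := quad_pos hΦ h; positivity

lemma measurable_weight (a b : ℝ) : Measurable (weight Γ Φ a b) := by
  have h1 := (continuous_quad Γ).measurable
  have h2 := (continuous_quad Φ).measurable
  unfold weight stdDev
  fun_prop

/-- Studentized weights give unit variance. -/
lemma quad_weight (hΓ : Γ.PosDef) (hΦ : Φ.PosDef) {a b : ℝ} (ha : 0 < a) (hb : 0 < b)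
    {v : EuclideanSpace ℝ (Fin r) × EuclideanSpace ℝ (Fin r)} (hv : v.1 ≠ 0 ∨ v.2 ≠ 0) :
    quad Γ (weight Γ Φ a b v).1 + quad Φ (weight Γ Φ a b v).2 = 1 := by
  have hs := stdDev_pos hΓ hΦ ha hb hv
  have h2 : stdDev Γ Φ a b v ^ 2 = a ^ 2 * quad Γ v.1 + b ^ 2 * quad Φ v.2 := by
    refine Real.sq_sqrt ?_
    have h1 := quad_nonneg hΓ v.1
    have h2 := quad_nonneg hΦ v.2
    positivity
  simp only [weight, Prod.smul_mk, quad_smul]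
  field_simp
  linarith

lemma exists_norm_weight_le (hΓ : Γ.PosDef) (hΦ : Φ.PosDef) :
    ∃ C, ∀ a b v, ‖weight Γ Φ a b v‖ ≤ C := by
  obtain ⟨m₁, hm₁, h₁⟩ := exists_le_quad hΓ
  obtain ⟨m₂, hm₂, h₂⟩ := exists_le_quad hΦ
  refine ⟨max (√(1 / m₁)) (√(1 / m₂)), fun a b v => ?_⟩
  have hq : quad Γ (weight Γ Φ a b v).1 + quad Φ (weight Γ Φ a b v).2 ≤ 1 := by
    have q1 := quad_nonneg hΓ v.1
    have q2 := quad_nonneg hΦ v.2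
    have h2 : stdDev Γ Φ a b v ^ 2 = a ^ 2 * quad Γ v.1 + b ^ 2 * quad Φ v.2 :=
      Real.sq_sqrt (by positivity)
    have h3 : quad Γ (weight Γ Φ a b v).1 + quad Φ (weight Γ Φ a b v).2 =
        (stdDev Γ Φ a b v ^ 2)⁻¹ * stdDev Γ Φ a b v ^ 2 := by
      simp only [weight, Prod.smul_mk, quad_smul]
      rw [h2, ← h2]
      ring_nf
      rw [h2]
      ring
    rw [h3]
    exact inv_mul_le_one
  have p1 := quad_nonneg hΓ (weight Γ Φ a b v).1
  have p2 := quad_nonneg hΦ (weight Γ Φ a b v).2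
  have b1 := h₁ (weight Γ Φ a b v).1
  have b2 := h₂ (weight Γ Φ a b v).2
  refine max_le_max ?_ ?_
  · refine Real.le_sqrt_of_sq_le ?_
    rw [le_div_iff₀ hm₁]
    linarith
  · refine Real.le_sqrt_of_sq_le ?_
    rw [le_div_iff₀ hm₂]
    linarith

lemma weight_mul (a b : ℝ) {c : ℝ} (hc : 0 < c)
    (v : EuclideanSpace ℝ (Fin r) × EuclideanSpace ℝ (Fin r)) :
    weight Γ Φ (c * a) (c * b) v = weight Γ Φ a b v := by
  have h : stdDev Γ Φ (c * a) (c * b) v = c * stdDev Γ Φ a b v := by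
    unfold stdDev
    rw [← Real.sqrt_sq hc.le, ← Real.sqrt_mul (sq_nonneg _), Real.sqrt_sq hc.le]
    congr 1; ring
  rw [weight, h, weight, mul_smul, mul_smul, ← Prod.smul_mk, smul_smul, mul_inv, mul_comm c⁻¹,
    inv_mul_cancel_right₀ hc.ne']

/-- Along a subsequence studentized weights converge at every nonzero `v`, although the ratio
`a / b` may tend to zero or infinity: the weights depend on it only if both components of `v`
are nonzero. -/
lemma exists_subseq_tendsto_weight (hΓ : Γ.PosDef) (hΦ : Φ.PosDef) {a b : ℕ → ℝ}
    (ha : ∀ n, 0 < a n) (hb : ∀ n, 0 < b n) :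
    ∃ φ : ℕ → ℕ, StrictMono φ ∧ ∀ v : EuclideanSpace ℝ (Fin r) × EuclideanSpace ℝ (Fin r),
      v.1 ≠ 0 ∨ v.2 ≠ 0 →
      ∃ l, Tendsto (fun n => weight Γ Φ (a (φ n)) (b (φ n)) v) atTop (𝓝 l) := by
  set θ : ℕ → ℝ := fun n => a n / (a n + b n) with hθ
  have hab : ∀ n, 0 < a n + b n := fun n => add_pos (ha n) (hb n)
  have hθ0 : ∀ n, 0 < θ n := fun n => div_pos (ha n) (hab n)
  have hθ1 : ∀ n, 0 < 1 - θ n := fun n => by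
    have : 1 - θ n = b n / (a n + b n) := by
      have := (hab n).ne'
      simp only [hθ]; field_simp; ring
    rw [this]
    exact div_pos (hb n) (hab n)
  have hw : ∀ n v, weight Γ Φ (a n) (b n) v = weight Γ Φ (θ n) (1 - θ n) v := fun n v => by
    rw [← weight_mul (θ n) (1 - θ n) (hab n)]
    have := (hab n).ne'
    congr 1
    · simp only [hθ]; field_simp
    · simp only [hθ]; field_simp; ring
  obtain ⟨t, -, φ, hφ, hlim⟩ := isCompact_Icc.tendsto_subseq (s := Set.Icc (0 : ℝ) 1)
    fun n => ⟨(hθ0 n).le, by linarith [hθ1 n]⟩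
  refine ⟨φ, hφ, fun v hv => ?_⟩
  simp_rw [hw]
  have hlim' : Tendsto (fun n => θ (φ n)) atTop (𝓝 t) := hlim
  by_cases h1 : v.1 = 0
  · refine ⟨weight Γ Φ 1 1 v, tendsto_const_nhds.congr fun n => ?_⟩
    rw [← weight_mul 1 1 (hθ1 (φ n))]
    simp only [weight, stdDev, h1, quad_zero, smul_zero, mul_zero, mul_one]
  by_cases h2 : v.2 = 0
  · refine ⟨weight Γ Φ 1 1 v, tendsto_const_nhds.congr fun n => ?_⟩
    rw [← weight_mul 1 1 (hθ0 (φ n))]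
    simp only [weight, stdDev, h2, quad_zero, smul_zero, mul_zero, mul_one]
  have q1 := quad_pos hΓ h1
  have q2 := quad_pos hΦ h2
  have hpos : 0 < stdDev Γ Φ t (1 - t) v := by
    refine Real.sqrt_pos.2 ?_
    rcases eq_or_ne t 0 with rfl | ht
    · simpa using q2
    · have : 0 < t ^ 2 := by positivity
      have := mul_pos this q1
      positivity
  refine ⟨weight Γ Φ t (1 - t) v, ?_⟩
  have h3 : Tendsto (fun n => stdDev Γ Φ (θ (φ n)) (1 - θ (φ n)) v) atTop
      (𝓝 (stdDev Γ Φ t (1 - t) v)) :=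
    (((hlim'.pow 2).mul_const _).add (((hlim'.const_sub 1).pow 2).mul_const _)).sqrt
  exact (h3.inv₀ hpos.ne').smul
    ((hlim'.smul_const v.1).prodMk_nhds ((hlim'.const_sub 1).smul_const v.2))

/-- With weights of unit variance, independent of the Gaussian vectors, the pairing is standard
normal. -/
lemma integral_cexp_pairing_gaussian {Ω : Type*} [MeasurableSpace Ω] {μ : Measure Ω}
    [IsProbabilityMeasure μ] (hΓ : Γ.PosDef) (hΦ : Φ.PosDef)
    {k : Ω → EuclideanSpace ℝ (Fin r) × EuclideanSpace ℝ (Fin r)} (hk : Measurable k) (s : ℝ)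
    (hv : ∀ᵐ ω ∂μ, quad Γ (k ω).1 + quad Φ (k ω).2 = s ^ 2) :
    ∫ p, Complex.exp (pairing (k p.1) p.2 * I)
      ∂(μ.prod ((multivariateGaussian 0 Γ).prod (multivariateGaussian 0 Φ))) =
      Complex.exp (-(s ^ 2) / 2) := by
  have hm : Measurable fun p : Ω × (EuclideanSpace ℝ (Fin r) × EuclideanSpace ℝ (Fin r)) =>
      Complex.exp (pairing (k p.1) p.2 * I) := by
    have h1 : Measurable fun p : Ω × (EuclideanSpace ℝ (Fin r) × EuclideanSpace ℝ (Fin r)) =>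
        pairing (k p.1) p.2 :=
      continuous_pairing.measurable.comp ((hk.comp measurable_fst).prodMk measurable_snd)
    fun_prop
  rw [integral_prod _ (Integrable.of_bound (C := 1) hm.aestronglyMeasurable
    (ae_of_all _ fun p => (Complex.norm_exp_ofReal_mul_I _).le))]
  have hin : ∀ᵐ ω ∂μ, ∫ z, Complex.exp (pairing (k ω) z * I)
      ∂((multivariateGaussian 0 Γ).prod (multivariateGaussian 0 Φ)) =
        Complex.exp (-(s ^ 2) / 2) := by
    filter_upwards [hv] with ω hω
    have h1 : ∀ z : EuclideanSpace ℝ (Fin r) × EuclideanSpace ℝ (Fin r),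
        Complex.exp (pairing (k ω) z * I) =
        Complex.exp (⟪z.1, (k ω).1⟫ * I) * Complex.exp (⟪z.2, (k ω).2⟫ * I) := fun z => by
      rw [← Complex.exp_add, pairing, real_inner_comm, real_inner_comm z.2]
      push_cast
      ring_nf
    simp_rw [h1]
    rw [integral_prod_mul (fun x => Complex.exp (⟪x, (k ω).1⟫ * I))
      (fun y => Complex.exp (⟪y, (k ω).2⟫ * I)), ← charFun_apply, ← charFun_apply,
      charFun_multivariateGaussian hΓ.posSemidef, charFun_multivariateGaussian hΦ.posSemidef,
      ← Complex.exp_add]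
    congr 1
    have h2 : ((s : ℂ)) ^ 2 = (quad Γ (k ω).1 : ℂ) + (quad Φ (k ω).2 : ℂ) := by
      rw [← Complex.ofReal_pow, ← hω]; push_cast; rfl
    rw [h2]
    simp only [inner_zero_right, quad]
    push_cast
    ring
  rw [integral_congr_ae hin]
  simp

/-- Along a subsequence, the characteristic function of the studentized weighted sum converges to
the standard normal one. -/
lemma exists_subseq_tendsto_charFun {Ω : Type*} [MeasurableSpace Ω] {μ : Measure Ω}
    [IsProbabilityMeasure μ] (hΓ : Γ.PosDef) (hΦ : Φ.PosDef)
    {V : Ω → EuclideanSpace ℝ (Fin r) × EuclideanSpace ℝ (Fin r)} (hV : Measurable V)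
    {ζ : ℕ → Ω → EuclideanSpace ℝ (Fin r) × EuclideanSpace ℝ (Fin r)}
    (hclt : TendstoInDistribution (fun n ω => (V ω, ζ n ω)) atTop
      (fun p : Ω × (EuclideanSpace ℝ (Fin r) × EuclideanSpace ℝ (Fin r)) => (V p.1, p.2))
      (fun _ => μ) (μ.prod ((multivariateGaussian 0 Γ).prod (multivariateGaussian 0 Φ))))
    (hζ : BddInProb μ fun p => ‖ζ p.1 p.2‖)
    (hV0 : ∀ᵐ ω ∂μ, (V ω).1 ≠ 0 ∨ (V ω).2 ≠ 0) {a b : ℕ → ℝ}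
    (ha : ∀ n, 0 < a n) (hb : ∀ n, 0 < b n) (s : ℝ) :
    ∃ φ : ℕ → ℕ, Tendsto (fun n => ∫ ω,
      Complex.exp (s * pairing (weight Γ Φ (a (φ n)) (b (φ n)) (V ω)) (ζ (φ n) ω) * I) ∂μ) atTop
      (𝓝 (Complex.exp (-(s ^ 2) / 2))) := by
  obtain ⟨φ, hφ, hconv⟩ := exists_subseq_tendsto_weight hΓ hΦ ha hb
  refine ⟨φ, ?_⟩
  have hV0' : ∀ᵐ v ∂(μ.map V), v.1 ≠ 0 ∨ v.2 ≠ 0 := by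
    refine (ae_map_iff hV.aemeasurable ?_).2 hV0
    exact ((measurableSet_singleton (0 : EuclideanSpace ℝ (Fin r))).compl.preimage
      measurable_fst).union ((measurableSet_singleton
        (0 : EuclideanSpace ℝ (Fin r))).compl.preimage measurable_snd)
  obtain ⟨κ', hκ'm, hκ'⟩ := measurable_limit_of_tendsto_metrizable_ae (μ := μ.map V)
    (f := fun k => weight Γ Φ (a (φ k)) (b (φ k))) (L := atTop)
    (fun k => (measurable_weight _ _).aemeasurable)
    (hV0'.mono fun v hv => hconv v hv)
  have hunit : ∀ᵐ ω ∂μ, quad Γ (κ' (V ω)).1 + quad Φ (κ' (V ω)).2 = 1 := by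
    refine ae_of_ae_map (p := fun v => quad Γ (κ' v).1 + quad Φ (κ' v).2 = 1) hV.aemeasurable ?_
    filter_upwards [hκ', hV0'] with v hv hv0
    have hc : Continuous fun w : EuclideanSpace ℝ (Fin r) × EuclideanSpace ℝ (Fin r) =>
        quad Γ w.1 + quad Φ w.2 :=
      ((continuous_quad Γ).comp continuous_fst).add ((continuous_quad Φ).comp continuous_snd)
    refine tendsto_nhds_unique ((hc.tendsto _).comp hv) ?_
    refine tendsto_const_nhds.congr fun k => ?_
    exact (quad_weight hΓ hΦ (ha _) (hb _) hv0).symm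
  obtain ⟨C, hC⟩ := exists_norm_weight_le hΓ hΦ
  have hclt' : TendstoInDistribution (fun k ω => (V ω, ζ (φ k) ω)) atTop
      (fun p : Ω × (EuclideanSpace ℝ (Fin r) × EuclideanSpace ℝ (Fin r)) => (V p.1, p.2))
      (fun _ => μ) (μ.prod ((multivariateGaussian 0 Γ).prod (multivariateGaussian 0 Φ))) :=
    ⟨fun k => hclt.forall_aemeasurable (φ k), hclt.aemeasurable_limit,
      hclt.tendsto.comp hφ.tendsto_atTop⟩
  have hζ' : BddInProb μ fun p => ‖ζ (φ p.1) p.2‖ := fun ε hε => by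
    obtain ⟨K, hK⟩ := hζ ε hε
    exact ⟨K, hφ.tendsto_atTop.eventually hK⟩
  have key := tendsto_integral_cexp_pairing hV hclt' hζ'
    (κ := fun k v => s • weight Γ Φ (a (φ k)) (b (φ k)) v) (κ' := fun v => s • κ' v)
    (fun k => (measurable_weight _ _).const_smul s) (hκ'm.const_smul s) (C := |s| * C)
    (fun k v => by
      rw [norm_smul, Real.norm_eq_abs]
      exact mul_le_mul_of_nonneg_left (hC _ _ _) (abs_nonneg s))
    (hκ'.mono fun v hv => hv.const_smul s)
  have hG := integral_cexp_pairing_gaussian (μ := μ) hΓ hΦ (k := fun ω => s • κ' (V ω))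
    ((hκ'm.comp hV).const_smul s) s (by
      filter_upwards [hunit] with ω hω
      simp only [Prod.smul_fst, Prod.smul_snd, quad_smul]
      rw [← mul_add, hω, mul_one])
  rw [hG] at key
  refine key.congr fun k => ?_
  refine integral_congr_ae (ae_of_all _ fun ω => ?_)
  simp only [pairing_smul, Complex.ofReal_mul]

/-- The studentized weighted sum is asymptotically standard normal, whatever the relative size of
the two scales `a` and `b`. -/
theorem tendstoInDistribution_pairing_weight {Ω : Type*} [MeasurableSpace Ω] {μ : Measure Ω}
    [IsProbabilityMeasure μ] (hΓ : Γ.PosDef) (hΦ : Φ.PosDef)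
    {V : Ω → EuclideanSpace ℝ (Fin r) × EuclideanSpace ℝ (Fin r)} (hV : Measurable V)
    {ζ : ℕ → Ω → EuclideanSpace ℝ (Fin r) × EuclideanSpace ℝ (Fin r)}
    (hclt : TendstoInDistribution (fun n ω => (V ω, ζ n ω)) atTop
      (fun p : Ω × (EuclideanSpace ℝ (Fin r) × EuclideanSpace ℝ (Fin r)) => (V p.1, p.2))
      (fun _ => μ) (μ.prod ((multivariateGaussian 0 Γ).prod (multivariateGaussian 0 Φ))))
    (hζ : BddInProb μ fun p => ‖ζ p.1 p.2‖)
    (hV0 : ∀ᵐ ω ∂μ, (V ω).1 ≠ 0 ∨ (V ω).2 ≠ 0) {a b : ℕ → ℝ}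
    (ha : ∀ᶠ n in atTop, 0 < a n) (hb : ∀ᶠ n in atTop, 0 < b n) :
    TendstoInDistribution (fun n ω => pairing (weight Γ Φ (a n) (b n) (V ω)) (ζ n ω)) atTop id
      (fun _ => μ) (gaussianReal 0 1) := by
  have hζm : ∀ n, AEMeasurable (ζ n) μ := fun n => (hclt.forall_aemeasurable n).snd
  have hZm : ∀ n, AEMeasurable (fun ω => pairing (weight Γ Φ (a n) (b n) (V ω)) (ζ n ω)) μ :=
    fun n => aemeasurable_pairing
      ((measurable_weight (a n) (b n)).comp hV).aemeasurable (hζm n)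
  refine ⟨hZm, aemeasurable_id, ?_⟩
  refine ProbabilityMeasure.tendsto_iff_tendsto_charFun.2 fun s => ?_
  have hlimval : charFun ((gaussianReal 0 1).map id) s = Complex.exp (-(s ^ 2) / 2) := by
    rw [Measure.map_id, charFun_gaussianReal]
    congr 1
    simp
    ring
  have hval : ∀ n, charFun (μ.map fun ω => pairing (weight Γ Φ (a n) (b n) (V ω)) (ζ n ω)) s =
      ∫ ω, Complex.exp (s * pairing (weight Γ Φ (a n) (b n) (V ω)) (ζ n ω) * I) ∂μ := fun n => by
    rw [charFun_apply_real]
    exact integral_map (hZm n) (by fun_prop)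
  simp only [ProbabilityMeasure.coe_mk, hval]
  rw [hlimval]
  refine Filter.tendsto_of_subseq_tendsto fun ns hns => ?_
  -- discard the finitely many indices at which a scale may vanish
  obtain ⟨k₀, hk₀⟩ := eventually_atTop.1 ((hns.eventually ha).and (hns.eventually hb))
  have hns' : Tendsto (fun k => ns (k + k₀)) atTop atTop := hns.comp (tendsto_add_atTop_nat k₀)
  have hclt' : TendstoInDistribution (fun k ω => (V ω, ζ (ns (k + k₀)) ω)) atTop
      (fun p : Ω × (EuclideanSpace ℝ (Fin r) × EuclideanSpace ℝ (Fin r)) => (V p.1, p.2))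
      (fun _ => μ) (μ.prod ((multivariateGaussian 0 Γ).prod (multivariateGaussian 0 Φ))) :=
    ⟨fun k => hclt.forall_aemeasurable _, hclt.aemeasurable_limit, hclt.tendsto.comp hns'⟩
  have hζ' : BddInProb μ fun p => ‖ζ (ns (p.1 + k₀)) p.2‖ := fun ε hε => by
    obtain ⟨K, hK⟩ := hζ ε hε
    exact ⟨K, hns'.eventually hK⟩
  obtain ⟨φ, hφ⟩ := exists_subseq_tendsto_charFun hΓ hΦ hV hclt' hζ' hV0
    (a := fun k => a (ns (k + k₀))) (b := fun k => b (ns (k + k₀)))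
    (fun k => (hk₀ _ (Nat.le_add_left _ _)).1) (fun k => (hk₀ _ (Nat.le_add_left _ _)).2) s
  exact ⟨fun k => φ k + k₀, hφ⟩

end Studentized

/-! ### Stochastic orders of the remainders -/

section Remainders

variable {Ω : Type*} [MeasurableSpace Ω] {μ : Measure Ω} {r : ℕ}

lemma BddInProb.mono_le {X Y : ℕ × Ω → ℝ} (hY : BddInProb μ Y)
    (h : ∀ᶠ p in whp μ, ‖X p‖ ≤ Y p) : BddInProb μ X :=
  hY.mono (h.mono fun _ hp => hp.trans (le_abs_self _))

lemma BddInProb.tendsto_mul' {X Y : ℕ × Ω → ℝ} (hY : BddInProb μ Y)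
    (hX : Tendsto X (whp μ) (𝓝 0)) : Tendsto (fun p => Y p * X p) (whp μ) (𝓝 0) := by
  simpa only [mul_comm] using hY.tendsto_mul hX

lemma tendsto_zero_add {α : Type*} {l : Filter α} {X Y : α → ℝ} (hX : Tendsto X l (𝓝 0))
    (hY : Tendsto Y l (𝓝 0)) : Tendsto (fun p => X p + Y p) l (𝓝 0) := by
  simpa using hX.add hY

/-- Consistency of an approximate inverse `A` of matrices `S_n → S`. -/
lemma tendsto_norm_sub_inv {S' A : ℕ × Ω → Matrix (Fin r) (Fin r) ℝ} {S : Matrix (Fin r) (Fin r) ℝ}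
    (hS : IsUnit S.det) (hS' : Tendsto S' (whp μ) (𝓝 S)) (hA : BddInProb μ fun p => ‖A p‖)
    (h : Tendsto (fun p => ‖S' p * A p - 1‖) (whp μ) (𝓝 0)) :
    Tendsto (fun p => ‖A p - S⁻¹‖) (whp μ) (𝓝 0) := by
  have h1 : Tendsto (fun p => ‖S⁻¹‖ * (‖S' p * A p - 1‖ + ‖S' p - S‖ * ‖A p‖)) (whp μ) (𝓝 0) := by
    simpa using (tendsto_zero_add h
      (hA.tendsto_mul (tendsto_iff_norm_sub_tendsto_zero.1 hS'))).const_mul ‖S⁻¹‖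
  refine squeeze_zero (fun _ => norm_nonneg _) (fun p => ?_) h1
  have h2 : A p - S⁻¹ = S⁻¹ * ((S' p * A p - 1) - (S' p - S) * A p) := by
    have h3 : S⁻¹ * (S * A p) = A p := Matrix.nonsing_inv_mul_cancel_left S (A p) hS
    rw [Matrix.sub_mul, sub_sub_sub_comm, sub_self, zero_sub, neg_sub, Matrix.mul_sub, h3,
      Matrix.mul_one]
  rw [h2]
  exact norm_mul_le_of_le le_rfl ((norm_sub_le _ _).trans
    (add_le_add le_rfl (norm_mul_le_of_le le_rfl le_rfl)))

variable {N T : ℕ → ℕ} {SΛ SF : Matrix (Fin r) (Fin r) ℝ}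
  {F U : ∀ p : ℕ × Ω, Matrix (Fin (T p.1)) (Fin r) ℝ}
  {L Q : ∀ p : ℕ × Ω, Matrix (Fin (N p.1)) (Fin r) ℝ}
  {E : ∀ p : ℕ × Ω, Matrix (Fin (T p.1)) (Fin (N p.1)) ℝ}
  {K G B : ℕ × Ω → Matrix (Fin r) (Fin r) ℝ}
  {g : ∀ p : ℕ × Ω, Matrix (Fin (N p.1)) (Fin 1) ℝ}
  {k : ∀ p : ℕ × Ω, Matrix (Fin (T p.1)) (Fin 1) ℝ}
  {u v : ℕ → ℝ}

lemma bddInProb_norm_of_gram {m : ℕ → ℕ} {A : ∀ p : ℕ × Ω, Matrix (Fin (m p.1)) (Fin r) ℝ}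
    {S : Matrix (Fin r) (Fin r) ℝ} (h : Tendsto (fun p => (A p)ᵀ * A p) (whp μ) (𝓝 S)) :
    BddInProb μ fun p => ‖A p‖ := by
  refine .of_tendsto (c := √‖S‖) (h.norm.sqrt.congr fun p => ?_)
  rw [norm_transpose_mul_self, Real.sqrt_sq (norm_nonneg _)]

/-- The normalized panel and its errors: the stochastic orders of the normalized factors,
loadings and errors. Here `u = √(N^α)`, `v = √T`, and the columns `g`, `k` are the errors of one
period and of one unit. -/
structure PanelOrders (μ : Measure Ω) (SΛ SF : Matrix (Fin r) (Fin r) ℝ) (u v : ℕ → ℝ)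
    (F U : ∀ p : ℕ × Ω, Matrix (Fin (T p.1)) (Fin r) ℝ)
    (L Q : ∀ p : ℕ × Ω, Matrix (Fin (N p.1)) (Fin r) ℝ)
    (E : ∀ p : ℕ × Ω, Matrix (Fin (T p.1)) (Fin (N p.1)) ℝ)
    (K G B : ℕ × Ω → Matrix (Fin r) (Fin r) ℝ)
    (g : ∀ p : ℕ × Ω, Matrix (Fin (N p.1)) (Fin 1) ℝ)
    (k : ∀ p : ℕ × Ω, Matrix (Fin (T p.1)) (Fin 1) ℝ) : Prop where
  eqs : ∀ᶠ p in whp μ, PCAEquations (F p) (L p) (E p) (U p) (Q p) (K p) (G p) (B p)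
  u_nonneg : ∀ n, 0 ≤ u n
  v_nonneg : ∀ n, 0 ≤ v n
  v_tendsto : Tendsto v atTop atTop
  unitF : IsUnit SF.det
  unitL : IsUnit SΛ.det
  gramF : Tendsto (fun p => (F p)ᵀ * F p) (whp μ) (𝓝 SF)
  gramL : Tendsto (fun p => (L p)ᵀ * L p) (whp μ) (𝓝 SΛ)
  bddK : BddInProb μ fun p => ‖K p‖
  normE : Tendsto (fun p => v p.1 * ‖E p‖ ^ 2) (whp μ) (𝓝 0)
  LEF : Tendsto (fun p => v p.1 * ‖(L p)ᵀ * (E p)ᵀ * F p‖) (whp μ) (𝓝 0)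
  FEg : Tendsto (fun p => u p.1 * ‖(F p)ᵀ * E p * g p‖) (whp μ) (𝓝 0)
  Eg : Tendsto (fun p => u p.1 * (‖E p * g p‖ * ‖E p‖)) (whp μ) (𝓝 0)
  LEk : Tendsto (fun p => v p.1 * ‖(L p)ᵀ * (E p)ᵀ * k p‖) (whp μ) (𝓝 0)
  Ek : Tendsto (fun p => v p.1 * (‖E p‖ * ‖(E p)ᵀ * k p‖)) (whp μ) (𝓝 0)
  Lg : BddInProb μ fun p => u p.1 * ‖(g p)ᵀ * L p‖
  Fk : BddInProb μ fun p => v p.1 * ‖(F p)ᵀ * k p‖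

namespace PanelOrders

lemma bddF (h : PanelOrders μ SΛ SF u v F U L Q E K G B g k) : BddInProb μ fun p => ‖F p‖ :=
  bddInProb_norm_of_gram h.gramF

lemma bddL (h : PanelOrders μ SΛ SF u v F U L Q E K G B g k) : BddInProb μ fun p => ‖L p‖ :=
  bddInProb_norm_of_gram h.gramL

lemma eventually_one_le_v (h : PanelOrders μ SΛ SF u v F U L Q E K G B g k) :
    ∀ᶠ p : ℕ × Ω in whp μ, 1 ≤ v p.1 :=
  tendsto_fst_whp.eventually (h.v_tendsto.eventually_ge_atTop 1)

lemma tendsto_E (h : PanelOrders μ SΛ SF u v F U L Q E K G B g k) :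
    Tendsto (fun p => ‖E p‖) (whp μ) (𝓝 0) := by
  have h1 : Tendsto (fun p => ‖E p‖ ^ 2) (whp μ) (𝓝 0) := by
    refine squeeze_zero' (.of_forall fun _ => sq_nonneg _) ?_ h.normE
    filter_upwards [h.eventually_one_le_v] with p hp
    nlinarith [sq_nonneg ‖E p‖]
  simpa using h1.sqrt

lemma bddQ (h : PanelOrders μ SΛ SF u v F U L Q E K G B g k) : BddInProb μ fun p => ‖Q p‖ :=
  ((h.bddL.mul h.bddF).add (.of_tendsto h.tendsto_E)).mono_le
    (h.eqs.mono fun _ hp => by rw [norm_norm]; exact hp.norm_Q_le)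

lemma bddB (h : PanelOrders μ SΛ SF u v F U L Q E K G B g k) : BddInProb μ fun p => ‖B p‖ :=
  ((h.bddL.mul h.bddQ).mul h.bddK).mono_le
    (h.eqs.mono fun _ hp => by rw [norm_norm]; exact hp.norm_B_le)

lemma bddG (h : PanelOrders μ SΛ SF u v F U L Q E K G B g k) : BddInProb μ fun p => ‖G p‖ :=
  h.bddF.mono_le (h.eqs.mono fun _ hp => by rw [norm_norm]; exact hp.norm_G_le)

/-- The rotations of factors and loadings are inverse to each other up to `o_p(1/v)`. -/
lemma tendsto_rotation (h : PanelOrders μ SΛ SF u v F U L Q E K G B g k) :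
    Tendsto (fun p => v p.1 * ‖B p * (G p)ᵀ - 1‖) (whp μ) (𝓝 0) := by
  have h1 : Tendsto (fun p => ‖K p‖ * (‖F p‖ * ((v p.1 * ‖(L p)ᵀ * (E p)ᵀ * F p‖) * ‖B p‖ +
      (v p.1 * ‖E p‖ ^ 2) * (‖L p‖ * ‖Q p‖ * ‖K p‖)) + v p.1 * ‖E p‖ ^ 2)) (whp μ) (𝓝 0) :=
    h.bddK.tendsto_mul' (tendsto_zero_add (h.bddF.tendsto_mul' (tendsto_zero_add
      (h.bddB.tendsto_mul h.LEF) (((h.bddL.mul h.bddQ).mul h.bddK).tendsto_mul h.normE))) h.normE)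
  have h2 : Tendsto (fun p => v p.1 * ‖(B p)ᵀ * G p - 1‖) (whp μ) (𝓝 0) := by
    refine squeeze_zero' (.of_forall fun p => mul_nonneg (h.v_nonneg _) (norm_nonneg _)) ?_ h1
    filter_upwards [h.eqs] with p hp
    refine (mul_le_mul_of_nonneg_left hp.norm_BG_sub_one_le (h.v_nonneg _)).trans (le_of_eq ?_)
    ring
  have h3 : ∀ᶠ p in whp μ, ‖(B p)ᵀ * G p - 1‖ ≤ 1 / 2 := by
    filter_upwards [h2.eventually_le_const (one_half_pos), h.eventually_one_le_v] with p hp hv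
    nlinarith [norm_nonneg ((B p)ᵀ * G p - 1)]
  have h4 : Tendsto (fun p => 2 * (‖G p‖ * (v p.1 * ‖(B p)ᵀ * G p - 1‖) * ‖B p‖)) (whp μ)
      (𝓝 0) := by
    simpa using (h.bddB.tendsto_mul (h.bddG.tendsto_mul' h2)).const_mul 2
  refine squeeze_zero' (.of_forall fun p => mul_nonneg (h.v_nonneg _) (norm_nonneg _)) ?_ h4
  filter_upwards [h3] with p hp
  have h5 := norm_mul_swap_sub_one_le hp
  have h6 : ‖B p * (G p)ᵀ - 1‖ = ‖G p * (B p)ᵀ - 1‖ := by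
    rw [← norm_matrix_transpose (G p * (B p)ᵀ - 1), Matrix.transpose_sub, Matrix.transpose_mul,
      Matrix.transpose_transpose, Matrix.transpose_one]
  rw [norm_matrix_transpose] at h5
  rw [h6]
  refine (mul_le_mul_of_nonneg_left h5 (h.v_nonneg _)).trans (le_of_eq ?_)
  ring

lemma tendsto_rotation' (h : PanelOrders μ SΛ SF u v F U L Q E K G B g k) :
    Tendsto (fun p => ‖B p * (G p)ᵀ - 1‖) (whp μ) (𝓝 0) := by
  refine squeeze_zero' (.of_forall fun p => norm_nonneg _) ?_ h.tendsto_rotation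
  filter_upwards [h.eventually_one_le_v] with p hp
  exact le_mul_of_one_le_left (norm_nonneg _) hp

lemma tendsto_GKG (h : PanelOrders μ SΛ SF u v F U L Q E K G B g k) :
    Tendsto (fun p => ‖G p * K p * (G p)ᵀ - SΛ⁻¹‖) (whp μ) (𝓝 0) := by
  refine tendsto_norm_sub_inv h.unitL h.gramL
    (((h.bddG.mul h.bddK).mul h.bddG).mono_le (.of_forall fun p => ?_)) ?_
  · rw [norm_norm]
    exact (norm_mul₃_le _ _ _).trans (by rw [norm_matrix_transpose])
  · have h1 : Tendsto (fun p => ‖B p * (G p)ᵀ - 1‖ + ‖L p‖ * ‖E p‖ * ‖K p‖ * ‖F p‖) (whp μ)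
        (𝓝 0) :=
      tendsto_zero_add h.tendsto_rotation'
        (h.bddF.tendsto_mul (h.bddK.tendsto_mul (h.bddL.tendsto_mul' h.tendsto_E)))
    exact squeeze_zero' (.of_forall fun p => norm_nonneg _)
      (h.eqs.mono fun p hp => hp.norm_LL_mul_GKG_sub_one_le) h1

lemma tendsto_BB (h : PanelOrders μ SΛ SF u v F U L Q E K G B g k) :
    Tendsto (fun p => ‖B p * (B p)ᵀ - SF⁻¹‖) (whp μ) (𝓝 0) := by
  refine tendsto_norm_sub_inv h.unitF h.gramF
    ((h.bddB.mul h.bddB).mono_le (.of_forall fun p => ?_)) ?_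
  · rw [norm_norm]
    exact norm_mul_le_of_le le_rfl (norm_matrix_transpose _).le
  · have h1 : Tendsto (fun p => ‖B p * (G p)ᵀ - 1‖ + ‖F p‖ * ‖E p‖ * ‖Q p‖ * ‖K p‖ * ‖B p‖)
        (whp μ) (𝓝 0) :=
      tendsto_zero_add h.tendsto_rotation' (h.bddB.tendsto_mul
        (h.bddK.tendsto_mul (h.bddQ.tendsto_mul (h.bddF.tendsto_mul' h.tendsto_E))))
    refine squeeze_zero' (.of_forall fun p => norm_nonneg _)
      (h.eqs.mono fun p hp => hp.norm_FF_mul_BB_sub_one_le.trans (le_of_eq ?_)) h1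
    rw [← norm_matrix_transpose (B p * (G p)ᵀ - 1), Matrix.transpose_sub, Matrix.transpose_mul,
      Matrix.transpose_transpose, Matrix.transpose_one]

lemma tendsto_factor_remainder (h : PanelOrders μ SΛ SF u v F U L Q E K G B g k) :
    Tendsto (fun p => u p.1 * ‖(g p)ᵀ * Q p - (g p)ᵀ * L p * G p‖) (whp μ) (𝓝 0) := by
  have h1 : Tendsto (fun p => (u p.1 * ‖(F p)ᵀ * E p * g p‖) * ‖B p‖ +
      (u p.1 * (‖E p * g p‖ * ‖E p‖)) * (‖Q p‖ * ‖K p‖)) (whp μ) (𝓝 0) :=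
    tendsto_zero_add (h.bddB.tendsto_mul h.FEg) ((h.bddQ.mul h.bddK).tendsto_mul h.Eg)
  refine squeeze_zero' (.of_forall fun p => mul_nonneg (h.u_nonneg _) (norm_nonneg _)) ?_ h1
  filter_upwards [h.eqs] with p hp
  refine (mul_le_mul_of_nonneg_left (hp.norm_factor_remainder_le (g p)) (h.u_nonneg _)).trans
    (le_of_eq ?_)
  ring

lemma tendsto_loading_remainder (h : PanelOrders μ SΛ SF u v F U L Q E K G B g k) :
    Tendsto (fun p => v p.1 * ‖(U p)ᵀ * k p - (B p)ᵀ * ((F p)ᵀ * k p)‖) (whp μ) (𝓝 0) := by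
  have h1 : Tendsto (fun p => ‖K p‖ * (‖F p‖ * (v p.1 * ‖(L p)ᵀ * (E p)ᵀ * k p‖) +
      v p.1 * (‖E p‖ * ‖(E p)ᵀ * k p‖))) (whp μ) (𝓝 0) :=
    h.bddK.tendsto_mul' (tendsto_zero_add (h.bddF.tendsto_mul' h.LEk) h.Ek)
  refine squeeze_zero' (.of_forall fun p => mul_nonneg (h.v_nonneg _) (norm_nonneg _)) ?_ h1
  filter_upwards [h.eqs] with p hp
  refine (mul_le_mul_of_nonneg_left (hp.norm_loading_remainder_le (k p)) (h.v_nonneg _)).trans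
    (le_of_eq ?_)
  ring

/-- The coefficient of the loading in the remainder is negligible. -/
lemma tendsto_loading_coeff (h : PanelOrders μ SΛ SF u v F U L Q E K G B g k) :
    Tendsto (fun p => u p.1 * (‖(g p)ᵀ * L p‖ * ‖G p * K p * (G p)ᵀ - SΛ⁻¹‖ +
      ‖(g p)ᵀ * Q p - (g p)ᵀ * L p * G p‖ * ‖K p‖ * ‖F p‖)) (whp μ) (𝓝 0) := by
  refine (tendsto_zero_add (h.Lg.tendsto_mul' h.tendsto_GKG)
    ((h.bddK.mul h.bddF).tendsto_mul h.tendsto_factor_remainder)).congr fun p => ?_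
  ring

/-- The coefficient of the factor in the remainder is negligible. -/
lemma tendsto_factor_coeff (h : PanelOrders μ SΛ SF u v F U L Q E K G B g k) :
    Tendsto (fun p => v p.1 * (‖(F p)ᵀ * k p‖ * ‖B p * (B p)ᵀ - SF⁻¹‖ +
      ‖(U p)ᵀ * k p - (B p)ᵀ * ((F p)ᵀ * k p)‖ * ‖B p‖)) (whp μ) (𝓝 0) := by
  refine (tendsto_zero_add (h.Fk.tendsto_mul' h.tendsto_BB)
    (h.bddB.tendsto_mul h.tendsto_loading_remainder)).congr fun p => ?_
  ring

/-- The product of the two estimation errors. -/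
lemma bddInProb_product (h : PanelOrders μ SΛ SF u v F U L Q E K G B g k) :
    BddInProb μ fun p => u p.1 * v p.1 * (‖(g p)ᵀ * Q p‖ * ‖K p‖ * ‖(U p)ᵀ * k p‖) := by
  have h1 := (((h.Lg.mul h.bddG).add (.of_tendsto h.tendsto_factor_remainder)).mul h.bddK).mul
    ((h.bddB.mul h.Fk).add (.of_tendsto h.tendsto_loading_remainder))
  refine h1.mono_le (.of_forall fun p => ?_)
  have hu := h.u_nonneg p.1
  have hv := h.v_nonneg p.1
  rw [Real.norm_of_nonneg (by positivity)]
  have e1 : ‖(g p)ᵀ * Q p‖ ≤ ‖(g p)ᵀ * L p‖ * ‖G p‖ + ‖(g p)ᵀ * Q p - (g p)ᵀ * L p * G p‖ := by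
    have : (g p)ᵀ * Q p = (g p)ᵀ * L p * G p + ((g p)ᵀ * Q p - (g p)ᵀ * L p * G p) := by abel
    conv_lhs => rw [this]
    exact (norm_add_le _ _).trans (add_le_add (norm_mul_le_of_le le_rfl le_rfl) le_rfl)
  have e2 : ‖(U p)ᵀ * k p‖ ≤ ‖B p‖ * ‖(F p)ᵀ * k p‖ +
      ‖(U p)ᵀ * k p - (B p)ᵀ * ((F p)ᵀ * k p)‖ := by
    have : (U p)ᵀ * k p = (B p)ᵀ * ((F p)ᵀ * k p) +
      ((U p)ᵀ * k p - (B p)ᵀ * ((F p)ᵀ * k p)) := by abel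
    conv_lhs => rw [this]
    exact (norm_add_le _ _).trans
      (add_le_add (norm_mul_le_of_le (norm_matrix_transpose _).le le_rfl) le_rfl)
  calc u p.1 * v p.1 * (‖(g p)ᵀ * Q p‖ * ‖K p‖ * ‖(U p)ᵀ * k p‖)
      ≤ u p.1 * v p.1 * ((‖(g p)ᵀ * L p‖ * ‖G p‖ + ‖(g p)ᵀ * Q p - (g p)ᵀ * L p * G p‖) * ‖K p‖ *
        (‖B p‖ * ‖(F p)ᵀ * k p‖ + ‖(U p)ᵀ * k p - (B p)ᵀ * ((F p)ᵀ * k p)‖)) := by gcongr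
    _ = _ := by ring

end PanelOrders

end Remainders

/-! ### Nondegeneracy of the leading singular values -/

section LowerBound

variable {r : ℕ}

lemma dotProduct_self_eq_norm_sq {ι : Type*} [Fintype ι] (x : ι → ℝ) :
    x ⬝ᵥ x = ‖(WithLp.toLp 2 x : EuclideanSpace ℝ ι)‖ ^ 2 := by
  rw [EuclideanSpace.real_norm_sq_eq]
  simp [dotProduct, sq]

lemma dotProduct_le_norm_mul {ι : Type*} [Fintype ι] (x y : ι → ℝ) :
    |x ⬝ᵥ y| ≤ ‖(WithLp.toLp 2 x : EuclideanSpace ℝ ι)‖ *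
      ‖(WithLp.toLp 2 y : EuclideanSpace ℝ ι)‖ := by
  have h := abs_real_inner_le_norm (WithLp.toLp 2 y : EuclideanSpace ℝ ι) (WithLp.toLp 2 x)
  rw [mul_comm] at h
  simpa [EuclideanSpace.inner_eq_star_dotProduct] using h

lemma dotProduct_gram {m n : Type*} [Fintype m] [Fintype n] (A : Matrix m n ℝ) (x : n → ℝ) :
    (A *ᵥ x) ⬝ᵥ (A *ᵥ x) = x ⬝ᵥ ((Aᵀ * A) *ᵥ x) := by
  rw [← Matrix.mulVec_mulVec, Matrix.dotProduct_mulVec x, Matrix.vecMul_transpose]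

lemma le_quad_of_norm_sub_le {S A : Matrix (Fin r) (Fin r) ℝ} {c : ℝ}
    (hS : ∀ x, c * ‖x‖ ^ 2 ≤ quad S x) (hA : ‖A - S‖ ≤ c / 2) (x : Fin r → ℝ) :
    c / 2 * (x ⬝ᵥ x) ≤ x ⬝ᵥ (A *ᵥ x) := by
  have h1 := hS (WithLp.toLp 2 x)
  have h2 : |x ⬝ᵥ ((A - S) *ᵥ x)| ≤ c / 2 * ‖(WithLp.toLp 2 x : EuclideanSpace ℝ (Fin r))‖ ^ 2 := by
    refine (dotProduct_le_norm_mul _ _).trans ?_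
    have h3 := Matrix.l2_opNorm_mulVec (A - S) (WithLp.toLp 2 x)
    have h4 := h3.trans (mul_le_mul_of_nonneg_right hA (norm_nonneg _))
    refine (mul_le_mul_of_nonneg_left h4 (norm_nonneg _)).trans (le_of_eq ?_)
    ring
  have h3 : x ⬝ᵥ (A *ᵥ x) = quad S (WithLp.toLp 2 x) + x ⬝ᵥ ((A - S) *ᵥ x) := by
    rw [Matrix.sub_mulVec, dotProduct_sub, quad]; ring
  rw [h3, dotProduct_self_eq_norm_sq]
  linarith [(abs_le.1 h2).1]

/-- If the Gram matrices of `F` and `L` are bounded below by `a` and `b` and `E` is small, then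
`F Lᵀ + E` is bounded below on the range of `L`. -/
lemma le_norm_mulVec_range {m n : Type*} [Fintype m] [Fintype n] [DecidableEq m] [DecidableEq n]
    {F : Matrix m (Fin r) ℝ}
    {L : Matrix n (Fin r) ℝ} {E : Matrix m n ℝ} {a b : ℝ} (ha : 0 < a) (hb : 0 < b)
    (hF : ∀ x, a * (x ⬝ᵥ x) ≤ x ⬝ᵥ ((Fᵀ * F) *ᵥ x)) (hL : ∀ x, b * (x ⬝ᵥ x) ≤ x ⬝ᵥ ((Lᵀ * L) *ᵥ x))
    (hE : ‖E‖ ≤ √(a * b) / 2) (x : Fin r → ℝ) :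
    a * b / 4 * ((L *ᵥ x) ⬝ᵥ (L *ᵥ x)) ≤
      ((F * Lᵀ + E) *ᵥ (L *ᵥ x)) ⬝ᵥ ((F * Lᵀ + E) *ᵥ (L *ᵥ x)) := by
  set w := L *ᵥ x with hw
  set y := Lᵀ *ᵥ w with hy
  set nw := ‖(WithLp.toLp 2 w : EuclideanSpace ℝ n)‖ with hnw
  set ny := ‖(WithLp.toLp 2 y : EuclideanSpace ℝ (Fin r))‖ with hny
  set nx := ‖(WithLp.toLp 2 x : EuclideanSpace ℝ (Fin r))‖ with hnx
  have h1 : nw ^ 2 ≤ nx * ny := by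
    have : w ⬝ᵥ w = x ⬝ᵥ y := by
      rw [hy, hw, dotProduct_gram, Matrix.mulVec_mulVec]
    rw [← dotProduct_self_eq_norm_sq, this]
    exact (le_abs_self _).trans (dotProduct_le_norm_mul _ _)
  have h2 : b * nx ^ 2 ≤ nw ^ 2 := by
    rw [← dotProduct_self_eq_norm_sq, ← dotProduct_self_eq_norm_sq, dotProduct_gram]
    exact hL x
  have h3 : b * nw ^ 2 ≤ ny ^ 2 := by
    rcases eq_or_lt_of_le (norm_nonneg (WithLp.toLp 2 w : EuclideanSpace ℝ n)) with h0 | h0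
    · rw [hnw, ← h0]; simpa using sq_nonneg ny
    · have h4 : nw ^ 2 * nw ^ 2 ≤ (nx * ny) * (nx * ny) :=
        mul_le_mul h1 h1 (sq_nonneg _) ((sq_nonneg _).trans h1)
      have h5 : (b * nw ^ 2) * nw ^ 2 ≤ ny ^ 2 * nw ^ 2 := by
        have := mul_le_mul_of_nonneg_right h2 (sq_nonneg ny)
        nlinarith
      exact le_of_mul_le_mul_right h5 (by positivity)
  have h4 : a * b * nw ^ 2 ≤ ‖(WithLp.toLp 2 (F *ᵥ y) : EuclideanSpace ℝ m)‖ ^ 2 := by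
    rw [← dotProduct_self_eq_norm_sq (F *ᵥ y), dotProduct_gram]
    refine le_trans ?_ (hF y)
    rw [dotProduct_self_eq_norm_sq]
    nlinarith
  have h5 : √(a * b) * nw ≤ ‖(WithLp.toLp 2 (F *ᵥ y) : EuclideanSpace ℝ m)‖ := by
    refine le_of_sq_le_sq ?_ (norm_nonneg _)
    rwa [mul_pow, Real.sq_sqrt (by positivity)]
  have h6 : ‖(WithLp.toLp 2 (E *ᵥ w) : EuclideanSpace ℝ m)‖ ≤ √(a * b) / 2 * nw :=
    (Matrix.l2_opNorm_mulVec E (WithLp.toLp 2 w)).trans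
      (mul_le_mul_of_nonneg_right hE (norm_nonneg _))
  have h7 : √(a * b) / 2 * nw ≤
      ‖(WithLp.toLp 2 ((F * Lᵀ + E) *ᵥ w) : EuclideanSpace ℝ m)‖ := by
    have h8 : (WithLp.toLp 2 ((F * Lᵀ + E) *ᵥ w) : EuclideanSpace ℝ m) =
        WithLp.toLp 2 (F *ᵥ y) - -WithLp.toLp 2 (E *ᵥ w) := by
      rw [Matrix.add_mulVec, ← Matrix.mulVec_mulVec, sub_neg_eq_add]; rfl
    rw [h8]
    have h9 := norm_sub_norm_le (WithLp.toLp 2 (F *ᵥ y) : EuclideanSpace ℝ m)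
      (-WithLp.toLp 2 (E *ᵥ w))
    rw [norm_neg] at h9
    linarith
  rw [dotProduct_self_eq_norm_sq, dotProduct_self_eq_norm_sq]
  have h8 := pow_le_pow_left₀ (by positivity) h7 2
  rw [mul_pow, div_pow, Real.sq_sqrt (by positivity)] at h8
  linarith

/-- The normalized factors `F / √T`. -/
noncomputable def normFactors {Ω : Type*} (F : ℕ → Ω → EuclideanSpace ℝ (Fin r)) (T : ℕ) (ω : Ω) :
    Matrix (Fin T) (Fin r) ℝ :=
  Matrix.of fun t j => (√(T : ℝ))⁻¹ * F t ω j

/-- The normalized loadings `Λ / u`. -/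
noncomputable def normLoadings {Ω : Type*} (Λ : ℕ → Ω → EuclideanSpace ℝ (Fin r)) (N : ℕ) (u : ℝ)
    (ω : Ω) : Matrix (Fin N) (Fin r) ℝ :=
  Matrix.of fun i j => u⁻¹ * Λ i ω j

/-- The normalized errors `e / (u √T)`. -/
noncomputable def normErrors {Ω : Type*} (e : ℕ → ℕ → Ω → ℝ) (N T : ℕ) (u : ℝ) (ω : Ω) :
    Matrix (Fin T) (Fin N) ℝ :=
  Matrix.of fun t i => (u * √(T : ℝ))⁻¹ * e i t ω

lemma data_eq {Ω : Type*} (Λ F : ℕ → Ω → EuclideanSpace ℝ (Fin r)) (e : ℕ → ℕ → Ω → ℝ) (N T : ℕ)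
    (u : ℝ) (ω : Ω) :
    normFactors F T ω * (normLoadings Λ N u ω)ᵀ + normErrors e N T u ω =
      (u * √(T : ℝ))⁻¹ • dataMatrix Λ F e N T ω := by
  ext t i
  simp only [normFactors, normLoadings, normErrors, dataMatrix, common, Matrix.add_apply,
    Matrix.mul_apply, Matrix.transpose_apply, Matrix.of_apply, Matrix.smul_apply, smul_eq_mul,
    dotProduct, mul_add, Finset.mul_sum, mul_inv]
  congr 1
  exact Finset.sum_congr rfl fun j _ => by ring

/-- Once the Gram matrices are close to positive definite limits and the errors are small, the
rescaled estimator solves the normal equations, with bounded `K`. -/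
lemma IsPCEstimator.pcaEquations {Ω : Type*} {Λ F : ℕ → Ω → EuclideanSpace ℝ (Fin r)}
    {e : ℕ → ℕ → Ω → ℝ} {N T : ℕ} {ω : Ω} {Ft : Matrix (Fin T) (Fin r) ℝ}
    {Lt : Matrix (Fin N) (Fin r) ℝ} (h : IsPCEstimator (dataMatrix Λ F e N T ω) Ft Lt)
    (hN : 0 < N) (hT : 0 < T) {u : ℝ} (hu : 0 < u) {SF SΛ : Matrix (Fin r) (Fin r) ℝ} {a b : ℝ}
    (ha : 0 < a) (hb : 0 < b) (hSF : ∀ x, a * ‖x‖ ^ 2 ≤ quad SF x)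
    (hSΛ : ∀ x, b * ‖x‖ ^ 2 ≤ quad SΛ x)
    (hF : ‖(normFactors F T ω)ᵀ * normFactors F T ω - SF‖ ≤ a / 2)
    (hL : ‖(normLoadings Λ N u ω)ᵀ * normLoadings Λ N u ω - SΛ‖ ≤ b / 2)
    (hE : ‖normErrors e N T u ω‖ ≤ √(a / 2 * (b / 2)) / 2)
    {U : Matrix (Fin T) (Fin r) ℝ} {Q : Matrix (Fin N) (Fin r) ℝ} {K G B : Matrix (Fin r) (Fin r) ℝ}
    (hU : U = (√(T : ℝ))⁻¹ • Ft) (hQ : Q = u⁻¹ • Lt) (hK : K = (Qᵀ * Q)⁻¹)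
    (hG : G = (normFactors F T ω)ᵀ * U) (hB : B = (normLoadings Λ N u ω)ᵀ * Q * K) :
    PCAEquations (normFactors F T ω) (normLoadings Λ N u ω) (normErrors e N T u ω) U Q K G B ∧
      ‖K‖ ≤ (a / 2 * (b / 2) / 4)⁻¹ := by
  have hT' : (0 : ℝ) < T := Nat.cast_pos.2 hT
  have hsu : √(u ^ 2) = u := Real.sqrt_sq hu.le
  obtain ⟨δ, h1, h2, h3, h4, h5⟩ := h.normal_equations hN hT (ν := u ^ 2) (by positivity)
    (U := U) (Q := Q) (Y := (u * √(T : ℝ))⁻¹ • dataMatrix Λ F e N T ω)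
    (by rw [hU, one_div]) (by rw [hQ, hsu, one_div])
    (by rw [Real.sqrt_mul hT'.le, hsu, one_div, mul_comm])
  rw [← data_eq] at h2 h3 h5
  have hLq := le_quad_of_norm_sub_le hSΛ hL
  have hinj : ∀ x, normLoadings Λ N u ω *ᵥ x = 0 → x = 0 := by
    intro x hx
    have h6 := hLq x
    rw [← dotProduct_gram, hx, dotProduct_zero] at h6
    have h7 : 0 ≤ x ⬝ᵥ x := Finset.sum_nonneg fun i _ => mul_self_nonneg _
    have h8 : x ⬝ᵥ x = 0 := by
      have := half_pos hb
      nlinarith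
    exact dotProduct_self_eq_zero.1 h8
  have hδ := h5 _ (a / 2 * (b / 2) / 4) hinj
    (le_norm_mulVec_range (half_pos ha) (half_pos hb) (le_quad_of_norm_sub_le hSF hF) hLq hE)
  have hs : 0 < a / 2 * (b / 2) / 4 := by positivity
  have hδ0 : ∀ k, 0 < δ k := fun k => hs.trans_le (hδ k)
  have hdet : IsUnit (Qᵀ * Q).det := by
    rw [h4, Matrix.det_diagonal]
    exact (Finset.prod_ne_zero_iff.2 fun k _ => (hδ0 k).ne').isUnit
  have hKd : K = Matrix.diagonal fun k => (δ k)⁻¹ := by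
    rw [hK, h4]
    refine Matrix.inv_eq_right_inv ?_
    rw [Matrix.diagonal_mul_diagonal, ← Matrix.diagonal_one]
    congr 1
    ext k
    exact mul_inv_cancel₀ (hδ0 k).ne'
  refine ⟨⟨h1, h2, ?_, ?_, hG, hB⟩, ?_⟩
  · rw [h3, hK, Matrix.mul_assoc, Matrix.mul_nonsing_inv _ hdet, Matrix.mul_one]
  · rw [hKd, Matrix.diagonal_transpose]
  · rw [hKd, Matrix.l2_opNorm_diagonal]
    refine (pi_norm_le_iff_of_nonneg (by positivity)).2 fun k => ?_
    rw [Real.norm_of_nonneg (inv_nonneg.2 (hδ0 k).le)]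
    exact inv_anti₀ hs (hδ k)

end LowerBound

/-! ### Orders of the normalized panel under the assumptions -/

section Rates

variable {N T : ℕ → ℕ} {α : ℝ}

lemma eventually_natCast_pos {m : ℕ → ℕ} (hm : Tendsto m atTop atTop) :
    ∀ᶠ n in atTop, (0 : ℝ) < m n :=
  (hm.eventually_ge_atTop 1).mono fun _ h => Nat.cast_pos.2 h

lemma tendsto_sqrt_natCast {m : ℕ → ℕ} (hm : Tendsto m atTop atTop) :
    Tendsto (fun n => √(m n : ℝ)) atTop atTop :=
  Real.tendsto_sqrt_atTop.comp (tendsto_natCast_atTop_atTop.comp hm)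

/-- The square root `√(N^α)` of the strength of the loadings. -/
noncomputable def strength (N : ℕ → ℕ) (α : ℝ) (n : ℕ) : ℝ := √((N n : ℝ) ^ α)

lemma strength_sq (n : ℕ) : strength N α n ^ 2 = (N n : ℝ) ^ α :=
  Real.sq_sqrt (Real.rpow_nonneg (Nat.cast_nonneg _) _)

lemma strength_nonneg (n : ℕ) : 0 ≤ strength N α n := Real.sqrt_nonneg _

lemma strength_pos {n : ℕ} (h : (0 : ℝ) < N n) : 0 < strength N α n :=
  Real.sqrt_pos.2 (Real.rpow_pos_of_pos h _)

lemma tendsto_strength (hN : Tendsto N atTop atTop) (hα : 0 < α) :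
    Tendsto (strength N α) atTop atTop :=
  Real.tendsto_sqrt_atTop.comp
    ((tendsto_rpow_atTop hα).comp (tendsto_natCast_atTop_atTop.comp hN))

lemma tendsto_inv_strength (hN : Tendsto N atTop atTop) (hα : 0 < α) :
    Tendsto (fun n => (strength N α n)⁻¹) atTop (𝓝 0) :=
  tendsto_inv_atTop_zero.comp (tendsto_strength hN hα)

lemma tendsto_sqrt_div_rpow (hN : Tendsto N atTop atTop) (hα : 1 / 2 < α) :
    Tendsto (fun n => √(N n : ℝ) / (N n : ℝ) ^ α) atTop (𝓝 0) := by
  have h := (tendsto_rpow_neg_atTop (y := α - 1 / 2) (by linarith)).comp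
    (tendsto_natCast_atTop_atTop (R := ℝ).comp hN)
  refine h.congr' ?_
  filter_upwards [eventually_natCast_pos hN] with n hn
  rw [Function.comp_apply, Function.comp_apply, neg_sub, Real.rpow_sub hn, ← Real.sqrt_eq_rpow]

lemma sqrt_max_mul_inv_delta_le {N T : ℕ} (hN : (0 : ℝ) < N) (hT : (0 : ℝ) < T) :
    √(max (N : ℝ) T) * (delta N T)⁻¹ ≤ 2 + √(N : ℝ) / √(T : ℝ) + √(T : ℝ) / √(N : ℝ) := by
  have h1 : 0 < √(N : ℝ) := Real.sqrt_pos.2 hN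
  have h2 : 0 < √(T : ℝ) := Real.sqrt_pos.2 hT
  rcases le_total (N : ℝ) T with h | h
  · rw [max_eq_right h, delta, min_eq_left (Real.sqrt_le_sqrt h), ← div_eq_mul_inv]
    have : 0 ≤ √(N : ℝ) / √(T : ℝ) := by positivity
    linarith
  · rw [max_eq_left h, delta, min_eq_right (Real.sqrt_le_sqrt h), ← div_eq_mul_inv]
    have : 0 ≤ √(T : ℝ) / √(N : ℝ) := by positivity
    linarith

lemma inv_delta_sq_le {N T : ℕ} : (delta N T ^ 2)⁻¹ ≤ (N : ℝ)⁻¹ + (T : ℝ)⁻¹ := by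
  have hN : (0 : ℝ) ≤ (N : ℝ)⁻¹ := by positivity
  have hT : (0 : ℝ) ≤ (T : ℝ)⁻¹ := by positivity
  rcases le_total (N : ℝ) T with h | h
  · rw [delta, min_eq_left (Real.sqrt_le_sqrt h), Real.sq_sqrt (Nat.cast_nonneg _)]
    linarith
  · rw [delta, min_eq_right (Real.sqrt_le_sqrt h), Real.sq_sqrt (Nat.cast_nonneg _)]
    linarith

lemma delta_pos {N T : ℕ} (hN : (0 : ℝ) < N) (hT : (0 : ℝ) < T) : 0 < delta N T :=
  lt_min (Real.sqrt_pos.2 hN) (Real.sqrt_pos.2 hT)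

lemma tendsto_rate₂ (hC : AssumptionC N T α) :
    Tendsto (fun n => (N n : ℝ) / ((N n : ℝ) ^ α * √(T n : ℝ))) atTop (𝓝 0) :=
  hC.rate₂.congr fun n => by rw [div_mul_div_comm, one_mul, mul_comm]

lemma tendsto_rate₃ (hN : Tendsto N atTop atTop) (hC : AssumptionC N T α) :
    Tendsto (fun n => (N n : ℝ) * √(N n : ℝ) / ((N n : ℝ) ^ α * T n)) atTop (𝓝 0) := by
  refine hC.rate₃.congr' ?_
  filter_upwards [eventually_natCast_pos hN] with n hn
  have h1 : (N n : ℝ) ^ (3 / 2 : ℝ) = N n * √(N n : ℝ) := by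
    rw [Real.sqrt_eq_rpow, show (3 / 2 : ℝ) = 1 + 1 / 2 by norm_num, Real.rpow_add hn,
      Real.rpow_one]
  rw [h1, div_mul_div_comm, one_mul, mul_comm (T n : ℝ)]

end Rates

section Orders

variable {Ω : Type*} [MeasurableSpace Ω] {μ : Measure Ω} {r : ℕ} {c : ℕ → ℝ}
  {lam F : ℕ → Ω → EuclideanSpace ℝ (Fin r)} {e : ℕ → ℕ → Ω → ℝ} {N T : ℕ → ℕ} {α M : ℝ}
  {SΛ SF : Matrix (Fin r) (Fin r) ℝ}

/-- The column `e_t / u` of normalized errors of one period. -/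
noncomputable def periodErrors (e : ℕ → ℕ → Ω → ℝ) (t N : ℕ) (u : ℝ) (ω : Ω) :
    Matrix (Fin N) (Fin 1) ℝ :=
  Matrix.of fun i _ => u⁻¹ * e i t ω

/-- The column `e_i / √T` of normalized errors of one unit. -/
noncomputable def unitErrors (e : ℕ → ℕ → Ω → ℝ) (i T : ℕ) (ω : Ω) : Matrix (Fin T) (Fin 1) ℝ :=
  Matrix.of fun t _ => (√(T : ℝ))⁻¹ * e i t ω

lemma norm_column_le {m : ℕ} {A : Matrix (Fin m) (Fin 1) ℝ} {a : ℝ} (ha : 0 ≤ a) {f : ℕ → ℝ}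
    (h : ∀ s, A s 0 = a * f s) : ‖A‖ ≤ a * √(∑ s ∈ Finset.range m, f s ^ 2) := by
  refine (norm_le_frobenius A).trans (le_of_eq ?_)
  rw [← Real.sqrt_sq ha, ← Real.sqrt_mul (sq_nonneg _), Finset.sum_range,
    Finset.mul_sum]
  congr 1
  refine Finset.sum_congr rfl fun s _ => ?_
  rw [Fin.sum_univ_one, h, mul_pow]

lemma norm_euclidean_column_le {A : Matrix (Fin r) (Fin 1) ℝ} {a : ℝ} (ha : 0 ≤ a)
    {x : EuclideanSpace ℝ (Fin r)} (h : ∀ j, A j 0 = a * x j) : ‖A‖ ≤ a * ‖x‖ := by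
  refine (norm_le_frobenius A).trans (le_of_eq ?_)
  rw [EuclideanSpace.norm_eq, ← Real.sqrt_sq ha, ← Real.sqrt_mul (sq_nonneg _), Finset.mul_sum]
  congr 1
  refine Finset.sum_congr rfl fun s _ => ?_
  rw [Fin.sum_univ_one, h, mul_pow, Real.norm_eq_abs, sq_abs]

lemma norm_le_mul_frobenius {A : Matrix (Fin r) (Fin r) ℝ} {a : ℝ} (ha : 0 ≤ a)
    {B : Fin r → Fin r → ℝ} (h : ∀ j k, A j k = a * B j k) : ‖A‖ ≤ a * √(∑ j, ∑ k, B j k ^ 2) := by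
  refine (norm_le_frobenius A).trans (le_of_eq ?_)
  rw [← Real.sqrt_sq ha, ← Real.sqrt_mul (sq_nonneg _), Finset.mul_sum]
  congr 1
  refine Finset.sum_congr rfl fun s _ => ?_
  rw [Finset.mul_sum]
  refine Finset.sum_congr rfl fun k _ => ?_
  rw [h, mul_pow]

lemma normErrors_mul_periodErrors_apply (t N T : ℕ) (u : ℝ) (ω : Ω) (s : Fin T) (q : Fin 1) :
    (normErrors e N T u ω * periodErrors e t N u ω) s q =
      (u * √(T : ℝ))⁻¹ * u⁻¹ * ∑ i ∈ Finset.range N, e i t ω * e i s ω := by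
  rw [Matrix.mul_apply, Finset.sum_range, Finset.mul_sum]
  refine Finset.sum_congr rfl fun i _ => ?_
  simp only [normErrors, periodErrors, Matrix.of_apply]
  ring

lemma normErrors_transpose_mul_unitErrors_apply (i N T : ℕ) (u : ℝ) (ω : Ω) (j : Fin N)
    (q : Fin 1) :
    ((normErrors e N T u ω)ᵀ * unitErrors e i T ω) j q =
      (u * √(T : ℝ))⁻¹ * (√(T : ℝ))⁻¹ * ∑ t ∈ Finset.range T, e i t ω * e j t ω := by
  rw [Matrix.mul_apply, Finset.sum_range, Finset.mul_sum]
  refine Finset.sum_congr rfl fun i _ => ?_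
  simp only [normErrors, unitErrors, Matrix.of_apply, Matrix.transpose_apply]
  ring

lemma norm_normErrors (N T : ℕ) {u : ℝ} (hu : 0 ≤ u) (ω : Ω) :
    ‖normErrors e N T u ω‖ = (u * √(T : ℝ))⁻¹ * ‖errMatrix e N T ω‖ := by
  have h : normErrors e N T u ω = (u * √(T : ℝ))⁻¹ • errMatrix e N T ω := by
    ext t i; simp [normErrors, errMatrix]
  rw [h, norm_smul, Real.norm_of_nonneg (by positivity)]

lemma euclidean_sum_apply {s : Finset ℕ} (a : ℕ → ℝ) (x : ℕ → EuclideanSpace ℝ (Fin r))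
    (j : Fin r) : (∑ i ∈ s, a i • x i) j = ∑ i ∈ s, a i * x i j := by
  simp [WithLp.ofLp_sum, Finset.sum_apply]

/-- A bound in probability, normalized by its rate. -/
lemma IsBigOP.bddInProb {X : ℕ → Ω → ℝ} {a : ℕ → ℝ} (hX : IsBigOP μ X a)
    (ha : ∀ᶠ n in atTop, 0 < a n) : BddInProb μ fun p => X p.1 p.2 * (a p.1)⁻¹ := by
  intro ε hε
  obtain ⟨K, hK⟩ := hX ε hε
  refine ⟨K, ?_⟩
  filter_upwards [hK, ha] with n hn han
  refine (measure_mono fun ω hω => ?_).trans hn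
  have hω' : K < |X n ω * (a n)⁻¹| := hω
  rw [abs_mul, abs_of_pos (inv_pos.2 han), ← div_eq_mul_inv, lt_div_iff₀ han] at hω'
  exact hω'

lemma tendsto_normErrors_sq (hT : Tendsto T atTop atTop)
    (hE : ErrorAssumption μ lam F e N T M) (hC : AssumptionC N T α) :
    Tendsto (fun p => √(T p.1 : ℝ) *
      ‖normErrors e (N p.1) (T p.1) (strength N α p.1) p.2‖ ^ 2) (whp μ) (𝓝 0) := by
  have h := hE.spectral.tendsto_mul (b := fun n => ((N n : ℝ) ^ α * √(T n : ℝ))⁻¹)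
    (fun n => by positivity) (by
      refine squeeze_zero (fun n => by positivity) (fun n => ?_)
        (tendsto_zero_add (tendsto_rate₂ hC) hC.rate₁)
      have h1 : max (N n : ℝ) (T n) ≤ N n + T n :=
        max_le (le_add_of_nonneg_right (Nat.cast_nonneg _))
          (le_add_of_nonneg_left (Nat.cast_nonneg _))
      refine (mul_le_mul_of_nonneg_right h1 (by positivity)).trans (le_of_eq ?_)
      rw [add_mul, ← div_eq_mul_inv, mul_inv, mul_comm ((_ : ℝ) ^ _)⁻¹, ← mul_assoc,
        ← div_eq_mul_inv (T n : ℝ), Real.div_sqrt, div_eq_mul_inv (√(T n : ℝ))])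
  refine h.congr' ?_
  filter_upwards [tendsto_fst_whp.eventually (eventually_natCast_pos hT)] with p hp
  have hs : 0 < √(T p.1 : ℝ) := Real.sqrt_pos.2 hp
  rw [norm_normErrors _ _ (strength_nonneg _), mul_pow, inv_pow, mul_pow, strength_sq, mul_inv,
    mul_inv]
  field_simp

lemma tendsto_loading_error_factor (hN : Tendsto N atTop atTop) (hT : Tendsto T atTop atTop)
    (hα : 0 < α) (hL : LinkAssumption μ c lam F e N T α M) :
    Tendsto (fun p => √(T p.1 : ℝ) *
      ‖(normLoadings (loading c lam (N p.1)) (N p.1) (strength N α p.1) p.2)ᵀ *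
        (normErrors e (N p.1) (T p.1) (strength N α p.1) p.2)ᵀ *
        normFactors F (T p.1) p.2‖) (whp μ) (𝓝 0) := by
  have h := hL.loading_factor.tendsto_mul (b := fun n => ((N n : ℝ) ^ α * √(T n : ℝ))⁻¹)
    (fun n => by positivity) (by
      refine (tendsto_inv_strength hN hα).congr' ?_
      filter_upwards [eventually_natCast_pos hN, eventually_natCast_pos hT] with n h1 h2
      have h3 := strength_pos (α := α) h1
      have h4 : 0 < √(T n : ℝ) := Real.sqrt_pos.2 h2
      rw [Real.sqrt_mul (Real.rpow_nonneg h1.le _), ← strength_sq (α := α),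
        Real.sqrt_sq h3.le]
      field_simp)
  refine squeeze_zero' (.of_forall fun p => by positivity) ?_ h
  filter_upwards [tendsto_fst_whp.eventually (eventually_natCast_pos hT)] with p hp
  have hs : 0 < √(T p.1 : ℝ) := Real.sqrt_pos.2 hp
  have h1 := norm_le_mul_frobenius
    (A := (normLoadings (loading c lam (N p.1)) (N p.1) (strength N α p.1) p.2)ᵀ *
        (normErrors e (N p.1) (T p.1) (strength N α p.1) p.2)ᵀ * normFactors F (T p.1) p.2)
    (a := ((strength N α p.1) ^ 2 * √(T p.1 : ℝ) ^ 2)⁻¹) (by positivity)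
    (B := fun j k => ∑ i ∈ Finset.range (N p.1), ∑ t ∈ Finset.range (T p.1),
        loading c lam (N p.1) i p.2 j * F t p.2 k * e i t p.2) (fun j k => by
      rw [Matrix.mul_assoc, Matrix.mul_apply, Finset.sum_range, Finset.mul_sum]
      refine Finset.sum_congr rfl fun i _ => ?_
      rw [Matrix.mul_apply, Finset.sum_range, Finset.mul_sum, Finset.mul_sum]
      refine Finset.sum_congr rfl fun t _ => ?_
      simp only [normLoadings, normErrors, normFactors, Matrix.transpose_apply, Matrix.of_apply]
      ring)
  refine (mul_le_mul_of_nonneg_left h1 hs.le).trans (le_of_eq ?_)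
  rw [strength_sq, mul_inv, mul_inv]
  field_simp

lemma tendsto_factor_error_period (hN : Tendsto N atTop atTop) (hT : Tendsto T atTop atTop)
    (hα : 0 < α) (hα1 : α ≤ 1) (hL : LinkAssumption μ c lam F e N T α M)
    (hC : AssumptionC N T α) (t : ℕ) :
    Tendsto (fun p => strength N α p.1 *
      ‖(normFactors F (T p.1) p.2)ᵀ * normErrors e (N p.1) (T p.1) (strength N α p.1) p.2 *
        periodErrors e t (N p.1) (strength N α p.1) p.2‖) (whp μ) (𝓝 0) := by
  have h := (hL.cross_factor t).tendsto_mul (b := fun n => (N n : ℝ) / strength N α n)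
    (fun n => div_nonneg (Nat.cast_nonneg _) (strength_nonneg _)) (by
      refine squeeze_zero' (.of_forall fun n => mul_nonneg (by positivity)
        (div_nonneg (Nat.cast_nonneg _) (strength_nonneg _))) ?_
        (tendsto_zero_add (tendsto_inv_strength hN hα) (tendsto_rate₃ hN hC))
      filter_upwards [eventually_natCast_pos hN, eventually_natCast_pos hT] with n h1 h2
      have h3 := strength_pos (α := α) h1
      refine (mul_le_mul_of_nonneg_right inv_delta_sq_le (by positivity)).trans ?_
      have h4 : strength N α n ≤ √(N n : ℝ) := by
        refine Real.sqrt_le_sqrt ?_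
        have h5 : (1 : ℝ) ≤ N n := by exact_mod_cast (Nat.cast_pos.1 h1 : 0 < N n)
        calc (N n : ℝ) ^ α ≤ (N n : ℝ) ^ (1 : ℝ) := Real.rpow_le_rpow_of_exponent_le h5 hα1
          _ = N n := Real.rpow_one _
      rw [← strength_sq (α := α), add_mul]
      refine add_le_add (le_of_eq (by field_simp)) ?_
      rw [inv_mul_eq_div, div_div, div_le_div_iff₀ (by positivity) (by positivity)]
      calc (N n : ℝ) * (strength N α n ^ 2 * T n) =
            strength N α n * (N n * (strength N α n * T n)) := by ring
        _ ≤ √(N n : ℝ) * (N n * (strength N α n * T n)) := by gcongr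
        _ = _ := by ring)
  refine squeeze_zero' (.of_forall fun p => mul_nonneg (strength_nonneg _) (norm_nonneg _)) ?_ h
  filter_upwards [tendsto_fst_whp.eventually (eventually_natCast_pos hT),
    tendsto_fst_whp.eventually (eventually_natCast_pos hN)] with p hp hp'
  have hs : 0 < √(T p.1 : ℝ) := Real.sqrt_pos.2 hp
  have hu := strength_pos (α := α) hp'
  have h1 := norm_euclidean_column_le
    (A := (normFactors F (T p.1) p.2)ᵀ * normErrors e (N p.1) (T p.1) (strength N α p.1) p.2 *
        periodErrors e t (N p.1) (strength N α p.1) p.2)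
    (a := (strength N α p.1 ^ 2 * √(T p.1 : ℝ) ^ 2)⁻¹) (by positivity)
    (x := ∑ s ∈ Finset.range (T p.1),
      (∑ i ∈ Finset.range (N p.1), e i t p.2 * e i s p.2) • F s p.2) (fun j => by
      rw [euclidean_sum_apply, Matrix.mul_assoc, Matrix.mul_apply, Finset.sum_range _,
        Finset.mul_sum]
      refine Finset.sum_congr rfl fun s _ => ?_
      rw [normErrors_mul_periodErrors_apply]
      simp only [normFactors, Matrix.transpose_apply, Matrix.of_apply]
      ring)
  refine (mul_le_mul_of_nonneg_left h1 hu.le).trans (le_of_eq ?_)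
  rw [Real.sq_sqrt hp.le]
  field_simp

lemma tendsto_loading_error_unit (hN : Tendsto N atTop atTop) (hT : Tendsto T atTop atTop)
    (hα : 0 < α) (hL : LinkAssumption μ c lam F e N T α M) (hC : AssumptionC N T α) (i : ℕ) :
    Tendsto (fun p => √(T p.1 : ℝ) *
      ‖(normLoadings (loading c lam (N p.1)) (N p.1) (strength N α p.1) p.2)ᵀ *
        (normErrors e (N p.1) (T p.1) (strength N α p.1) p.2)ᵀ *
        unitErrors e i (T p.1) p.2‖) (whp μ) (𝓝 0) := by
  have h := (hL.serial_loading i).tendsto_mul (b := fun n => √(T n : ℝ))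
    (fun n => Real.sqrt_nonneg _) (by
      refine (tendsto_zero_add hC.rate₁ (tendsto_inv_strength hN hα)).congr' ?_
      filter_upwards [eventually_natCast_pos hN, eventually_natCast_pos hT] with n h1 h2
      have h3 := strength_pos (α := α) h1
      have h4 : 0 < √(T n : ℝ) := Real.sqrt_pos.2 h2
      rw [Real.sqrt_mul h2.le]
      change _ = (_ + 1 / (√(T n : ℝ) * strength N α n)) * _
      field_simp)
  refine squeeze_zero' (.of_forall fun p => by positivity) ?_ h
  filter_upwards [tendsto_fst_whp.eventually (eventually_natCast_pos hT),
    tendsto_fst_whp.eventually (eventually_natCast_pos hN)] with p hp hp'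
  have hs : 0 < √(T p.1 : ℝ) := Real.sqrt_pos.2 hp
  have hu := strength_pos (α := α) hp'
  have h1 := norm_euclidean_column_le
    (A := (normLoadings (loading c lam (N p.1)) (N p.1) (strength N α p.1) p.2)ᵀ *
        (normErrors e (N p.1) (T p.1) (strength N α p.1) p.2)ᵀ * unitErrors e i (T p.1) p.2)
    (a := (strength N α p.1 ^ 2 * √(T p.1 : ℝ) ^ 2)⁻¹) (by positivity)
    (x := ∑ j ∈ Finset.range (N p.1),
      (∑ t ∈ Finset.range (T p.1), e i t p.2 * e j t p.2) • loading c lam (N p.1) j p.2)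
    (fun j => by
      rw [euclidean_sum_apply, Matrix.mul_assoc, Matrix.mul_apply, Finset.sum_range _,
        Finset.mul_sum]
      refine Finset.sum_congr rfl fun s _ => ?_
      rw [normErrors_transpose_mul_unitErrors_apply]
      simp only [normLoadings, Matrix.transpose_apply, Matrix.of_apply]
      ring)
  refine (mul_le_mul_of_nonneg_left h1 hs.le).trans (le_of_eq ?_)
  rw [Real.sq_sqrt hp.le, strength_sq, one_div, mul_inv]
  ring

/-- `‖e‖ = O_p(√(max(N, T)))`. -/
lemma bddInProb_errMatrix (hN : Tendsto N atTop atTop) (hE : ErrorAssumption μ lam F e N T M) :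
    BddInProb μ fun p => ‖errMatrix e (N p.1) (T p.1) p.2‖ *
      (√(max (N p.1 : ℝ) (T p.1)))⁻¹ := by
  have hpos : ∀ᶠ n in atTop, 0 < max (N n : ℝ) (T n) :=
    (eventually_natCast_pos hN).mono fun n hn => hn.trans_le (le_max_left _ _)
  refine ((BddInProb.const 1).add (hE.spectral.bddInProb hpos)).mono_le (.of_forall fun p => ?_)
  rw [Real.norm_of_nonneg (by positivity)]
  have h1 : ‖errMatrix e (N p.1) (T p.1) p.2‖ ^ 2 * (max (N p.1 : ℝ) (T p.1))⁻¹ =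
      (‖errMatrix e (N p.1) (T p.1) p.2‖ * (√(max (N p.1 : ℝ) (T p.1)))⁻¹) ^ 2 := by
    rw [mul_pow, inv_pow, Real.sq_sqrt (le_max_of_le_left (Nat.cast_nonneg _))]
  rw [h1]
  nlinarith [sq_nonneg (‖errMatrix e (N p.1) (T p.1) p.2‖ * (√(max (N p.1 : ℝ) (T p.1)))⁻¹ - 1)]

lemma tendsto_error_period (hN : Tendsto N atTop atTop) (hT : Tendsto T atTop atTop)
    (hE : ErrorAssumption μ lam F e N T M) (hC : AssumptionC N T α) (t : ℕ) :
    Tendsto (fun p => strength N α p.1 *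
      (‖normErrors e (N p.1) (T p.1) (strength N α p.1) p.2 *
        periodErrors e t (N p.1) (strength N α p.1) p.2‖ *
        ‖normErrors e (N p.1) (T p.1) (strength N α p.1) p.2‖)) (whp μ) (𝓝 0) := by
  have hδ : ∀ᶠ n in atTop, 0 < (delta (N n) (T n))⁻¹ := by
    filter_upwards [eventually_natCast_pos hN, eventually_natCast_pos hT] with n h1 h2
    exact inv_pos.2 (delta_pos h1 h2)
  have hb := ((hE.cross_norm t).bddInProb hδ).mul (bddInProb_errMatrix hN hE)
  have hdet : Tendsto (fun n => 2 * ((N n : ℝ) / ((N n : ℝ) ^ α * √(T n : ℝ))) +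
      (N n : ℝ) * √(N n : ℝ) / ((N n : ℝ) ^ α * T n) + √(N n : ℝ) / (N n : ℝ) ^ α) atTop (𝓝 0) :=
    tendsto_zero_add (tendsto_zero_add (by simpa using (tendsto_rate₂ hC).const_mul 2)
      (tendsto_rate₃ hN hC)) (tendsto_sqrt_div_rpow hN hC.alpha_gt)
  have h := hb.tendsto_mul (hdet.comp tendsto_fst_whp)
  refine squeeze_zero' (.of_forall fun p => mul_nonneg (strength_nonneg _) (by positivity)) ?_ h
  filter_upwards [tendsto_fst_whp.eventually (eventually_natCast_pos hT),
    tendsto_fst_whp.eventually (eventually_natCast_pos hN)] with p hp hp'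
  have hs : 0 < √(T p.1 : ℝ) := Real.sqrt_pos.2 hp
  have hsN : 0 < √(N p.1 : ℝ) := Real.sqrt_pos.2 hp'
  have hu := strength_pos (α := α) hp'
  have h1 := norm_column_le
    (A := normErrors e (N p.1) (T p.1) (strength N α p.1) p.2 *
        periodErrors e t (N p.1) (strength N α p.1) p.2)
    (a := (strength N α p.1 * √(T p.1 : ℝ))⁻¹ * (strength N α p.1)⁻¹) (by positivity)
    (f := fun s => ∑ i ∈ Finset.range (N p.1), e i t p.2 * e i s p.2)
    (fun s => normErrors_mul_periodErrors_apply _ _ _ _ _ _ _)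
  rw [norm_normErrors _ _ hu.le]
  set S := √(∑ s ∈ Finset.range (T p.1), (∑ i ∈ Finset.range (N p.1), e i t p.2 * e i s p.2) ^ 2)
  set R := ‖errMatrix e (N p.1) (T p.1) p.2‖
  set m := √(max (N p.1 : ℝ) (T p.1)) with hm
  have hmpos : 0 < m := Real.sqrt_pos.2 (hp.trans_le (le_max_right _ _))
  have hd := delta_pos hp' hp
  have hS : 0 ≤ S := Real.sqrt_nonneg _
  have hR : 0 ≤ R := norm_nonneg _
  calc strength N α p.1 * (‖normErrors e (N p.1) (T p.1) (strength N α p.1) p.2 *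
        periodErrors e t (N p.1) (strength N α p.1) p.2‖ *
        ((strength N α p.1 * √(T p.1 : ℝ))⁻¹ * R))
      ≤ strength N α p.1 * ((strength N α p.1 * √(T p.1 : ℝ))⁻¹ * (strength N α p.1)⁻¹ * S *
        ((strength N α p.1 * √(T p.1 : ℝ))⁻¹ * R)) := by gcongr
    _ = (N p.1 : ℝ) / ((N p.1 : ℝ) ^ α * √(T p.1 : ℝ)) * (m * (delta (N p.1) (T p.1))⁻¹) *
        (1 / ((N p.1 : ℝ) * √(T p.1 : ℝ)) * S * ((delta (N p.1) (T p.1))⁻¹)⁻¹ * (R * m⁻¹)) := by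
        rw [← strength_sq (α := α)]
        field_simp
    _ ≤ (N p.1 : ℝ) / ((N p.1 : ℝ) ^ α * √(T p.1 : ℝ)) *
        (2 + √(N p.1 : ℝ) / √(T p.1 : ℝ) + √(T p.1 : ℝ) / √(N p.1 : ℝ)) *
        (1 / ((N p.1 : ℝ) * √(T p.1 : ℝ)) * S * ((delta (N p.1) (T p.1))⁻¹)⁻¹ * (R * m⁻¹)) := by
        gcongr
        exact sqrt_max_mul_inv_delta_le hp' hp
    _ = _ := by
        simp only [Function.comp_apply]
        congr 1
        have e1 : (T p.1 : ℝ) = √(T p.1 : ℝ) * √(T p.1 : ℝ) := (Real.mul_self_sqrt hp.le).symm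
        have e2 : (N p.1 : ℝ) = √(N p.1 : ℝ) * √(N p.1 : ℝ) := (Real.mul_self_sqrt hp'.le).symm
        have hν : 0 < (N p.1 : ℝ) ^ α := Real.rpow_pos_of_pos hp' _
        generalize (N p.1 : ℝ) ^ α = ν at hν ⊢
        generalize √(T p.1 : ℝ) = τ at hs e1 ⊢
        generalize √(N p.1 : ℝ) = η at hsN e2 ⊢
        rw [e1, e2]
        field_simp

lemma tendsto_error_unit (hN : Tendsto N atTop atTop) (hT : Tendsto T atTop atTop)
    (hE : ErrorAssumption μ lam F e N T M) (hC : AssumptionC N T α) (i : ℕ) :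
    Tendsto (fun p => √(T p.1 : ℝ) *
      (‖normErrors e (N p.1) (T p.1) (strength N α p.1) p.2‖ *
        ‖(normErrors e (N p.1) (T p.1) (strength N α p.1) p.2)ᵀ *
          unitErrors e i (T p.1) p.2‖)) (whp μ) (𝓝 0) := by
  have hδ : ∀ᶠ n in atTop, 0 < (delta (N n) (T n))⁻¹ := by
    filter_upwards [eventually_natCast_pos hN, eventually_natCast_pos hT] with n h1 h2
    exact inv_pos.2 (delta_pos h1 h2)
  have hb := ((hE.serial_norm i).bddInProb hδ).mul (bddInProb_errMatrix hN hE)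
  have hdet : Tendsto (fun n => 2 * (√(N n : ℝ) / (N n : ℝ) ^ α) +
      (N n : ℝ) / ((N n : ℝ) ^ α * √(T n : ℝ)) + √(T n : ℝ) / (N n : ℝ) ^ α) atTop (𝓝 0) :=
    tendsto_zero_add (tendsto_zero_add
      (by simpa using (tendsto_sqrt_div_rpow hN hC.alpha_gt).const_mul 2)
      (tendsto_rate₂ hC)) hC.rate₁
  have h := hb.tendsto_mul (hdet.comp tendsto_fst_whp)
  refine squeeze_zero' (.of_forall fun p => by positivity) ?_ h
  filter_upwards [tendsto_fst_whp.eventually (eventually_natCast_pos hT),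
    tendsto_fst_whp.eventually (eventually_natCast_pos hN)] with p hp hp'
  have hs : 0 < √(T p.1 : ℝ) := Real.sqrt_pos.2 hp
  have hsN : 0 < √(N p.1 : ℝ) := Real.sqrt_pos.2 hp'
  have hu := strength_pos (α := α) hp'
  have h1 := norm_column_le
    (A := (normErrors e (N p.1) (T p.1) (strength N α p.1) p.2)ᵀ * unitErrors e i (T p.1) p.2)
    (a := (strength N α p.1 * √(T p.1 : ℝ))⁻¹ * (√(T p.1 : ℝ))⁻¹) (by positivity)
    (f := fun j => ∑ t ∈ Finset.range (T p.1), e i t p.2 * e j t p.2)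
    (fun s => normErrors_transpose_mul_unitErrors_apply _ _ _ _ _ _ _)
  rw [norm_normErrors _ _ hu.le]
  set S := √(∑ j ∈ Finset.range (N p.1), (∑ t ∈ Finset.range (T p.1), e i t p.2 * e j t p.2) ^ 2)
  set R := ‖errMatrix e (N p.1) (T p.1) p.2‖
  set m := √(max (N p.1 : ℝ) (T p.1)) with hm
  have hmpos : 0 < m := Real.sqrt_pos.2 (hp.trans_le (le_max_right _ _))
  have hd := delta_pos hp' hp
  have hS : 0 ≤ S := Real.sqrt_nonneg _
  have hR : 0 ≤ R := norm_nonneg _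
  calc √(T p.1 : ℝ) * ((strength N α p.1 * √(T p.1 : ℝ))⁻¹ * R *
        ‖(normErrors e (N p.1) (T p.1) (strength N α p.1) p.2)ᵀ * unitErrors e i (T p.1) p.2‖)
      ≤ √(T p.1 : ℝ) * ((strength N α p.1 * √(T p.1 : ℝ))⁻¹ * R *
        ((strength N α p.1 * √(T p.1 : ℝ))⁻¹ * (√(T p.1 : ℝ))⁻¹ * S)) := by gcongr
    _ = √(N p.1 : ℝ) / (N p.1 : ℝ) ^ α * (m * (delta (N p.1) (T p.1))⁻¹) *
        (1 / (√(T p.1 : ℝ) ^ 2 * √(N p.1 : ℝ)) * S * ((delta (N p.1) (T p.1))⁻¹)⁻¹ *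
          (R * m⁻¹)) := by
        rw [← strength_sq (α := α)]
        field_simp
    _ ≤ √(N p.1 : ℝ) / (N p.1 : ℝ) ^ α *
        (2 + √(N p.1 : ℝ) / √(T p.1 : ℝ) + √(T p.1 : ℝ) / √(N p.1 : ℝ)) *
        (1 / (√(T p.1 : ℝ) ^ 2 * √(N p.1 : ℝ)) * S * ((delta (N p.1) (T p.1))⁻¹)⁻¹ *
          (R * m⁻¹)) := by
        gcongr
        exact sqrt_max_mul_inv_delta_le hp' hp
    _ = _ := by
        simp only [Function.comp_apply]
        rw [Real.sq_sqrt hp.le]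
        congr 1
        have e2 : (N p.1 : ℝ) = √(N p.1 : ℝ) * √(N p.1 : ℝ) := (Real.mul_self_sqrt hp'.le).symm
        have hν : 0 < (N p.1 : ℝ) ^ α := Real.rpow_pos_of_pos hp' _
        generalize (N p.1 : ℝ) ^ α = ν at hν ⊢
        generalize √(T p.1 : ℝ) = τ at hs ⊢
        generalize √(N p.1 : ℝ) = η at hsN e2 ⊢
        rw [e2]
        field_simp

end Orders

section Panel

variable {Ω : Type*} [MeasurableSpace Ω] {μ : Measure Ω} {r : ℕ} {c : ℕ → ℝ}
  {lam F : ℕ → Ω → EuclideanSpace ℝ (Fin r)} {e : ℕ → ℕ → Ω → ℝ} {N T : ℕ → ℕ} {α M : ℝ}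
  {SΛ SF : Matrix (Fin r) (Fin r) ℝ}

lemma tendsto_gram_factors (hT : Tendsto T atTop atTop)
    (hF : FactorAssumption μ c lam F α M SΛ SF) :
    Tendsto (fun p : ℕ × Ω => (normFactors F (T p.1) p.2)ᵀ * normFactors F (T p.1) p.2) (whp μ)
      (𝓝 SF) := by
  refine tendsto_pi_nhds.2 fun j => tendsto_pi_nhds.2 fun k => ?_
  refine (tendsto_whp_of_tendstoInMeasure ((hF.factor_plim j k).comp hT)).congr fun p => ?_
  change 1 / (T p.1 : ℝ) * ∑ t ∈ Finset.range (T p.1), F t p.2 j * F t p.2 k = _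
  rw [Matrix.mul_apply, Finset.sum_range, Finset.mul_sum]
  refine Finset.sum_congr rfl fun t _ => ?_
  simp only [normFactors, Matrix.transpose_apply, Matrix.of_apply]
  have h : 1 / (T p.1 : ℝ) = (√(T p.1 : ℝ))⁻¹ * (√(T p.1 : ℝ))⁻¹ := by
    rw [← mul_inv, Real.mul_self_sqrt (Nat.cast_nonneg _), one_div]
  rw [h]
  ring

lemma tendsto_gram_loadings (hN : Tendsto N atTop atTop)
    (hF : FactorAssumption μ c lam F α M SΛ SF) :
    Tendsto (fun p : ℕ × Ω =>
      (normLoadings (loading c lam (N p.1)) (N p.1) (strength N α p.1) p.2)ᵀ *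
        normLoadings (loading c lam (N p.1)) (N p.1) (strength N α p.1) p.2) (whp μ) (𝓝 SΛ) := by
  refine tendsto_pi_nhds.2 fun j => tendsto_pi_nhds.2 fun k => ?_
  refine (tendsto_whp_of_tendstoInMeasure ((hF.loading_lim j k).comp hN)).congr fun p => ?_
  change 1 / (N p.1 : ℝ) ^ α * ∑ i ∈ Finset.range (N p.1),
    loading c lam (N p.1) i p.2 j * loading c lam (N p.1) i p.2 k = _
  rw [Matrix.mul_apply, Finset.sum_range, Finset.mul_sum]
  refine Finset.sum_congr rfl fun t _ => ?_
  simp only [normLoadings, Matrix.transpose_apply, Matrix.of_apply]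
  rw [← strength_sq]
  ring

lemma eventually_of_whp [IsProbabilityMeasure μ] {P : ℕ → Prop}
    (h : ∀ᶠ p : ℕ × Ω in whp μ, P p.1) : ∀ᶠ n in atTop, P n := by
  have h1 := (eventually_whp.1 h).eventually_lt_const (zero_lt_one (α := ℝ≥0∞))
  filter_upwards [h1] with n hn
  by_contra hc
  simp [hc] at hn

/-- As the loadings `c_N λ_i` with bounded `λ_i` have strength `N^α`, the scale `c_N` is at least of
order `√(N^α / N)`. -/
lemma eventually_le_scale [IsProbabilityMeasure μ] (hN : Tendsto N atTop atTop)
    (hF : FactorAssumption μ c lam F α M SΛ SF) (j : Fin r) :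
    ∀ᶠ n in atTop, SΛ j j / 2 ≤ c (N n) ^ 2 * M ^ 2 * ((N n : ℝ) / (N n : ℝ) ^ α) := by
  have hdpos : 0 < SΛ j j := hF.loading_posDef.diag_pos
  have hlim : Tendsto (fun p : ℕ × Ω => 1 / (N p.1 : ℝ) ^ α * ∑ i ∈ Finset.range (N p.1),
      loading c lam (N p.1) i p.2 j * loading c lam (N p.1) i p.2 j) (whp μ) (𝓝 (SΛ j j)) :=
    tendsto_whp_of_tendstoInMeasure (X := fun n ω => 1 / (N n : ℝ) ^ α *
      ∑ i ∈ Finset.range (N n), loading c lam (N n) i ω j * loading c lam (N n) i ω j)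
      ((hF.loading_lim j j).comp hN)
  have hb : ∀ᶠ p : ℕ × Ω in whp μ, ∀ i, ‖lam i p.2‖ ≤ M :=
    eventually_whp_of_ae (.of_forall fun _ => ae_all_iff.2 hF.loading_bound)
  refine eventually_of_whp (μ := μ)
    (P := fun n => SΛ j j / 2 ≤ c (N n) ^ 2 * M ^ 2 * ((N n : ℝ) / (N n : ℝ) ^ α)) ?_
  filter_upwards [hlim.eventually_const_le (half_lt_self hdpos), hb] with p hp hpb
  have h2 : ∑ i ∈ Finset.range (N p.1),
      loading c lam (N p.1) i p.2 j * loading c lam (N p.1) i p.2 j ≤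
      ∑ _i ∈ Finset.range (N p.1), c (N p.1) ^ 2 * M ^ 2 := by
    refine Finset.sum_le_sum fun i _ => ?_
    have h3 : |lam i p.2 j| ≤ M := (PiLp.norm_apply_le (lam i p.2) j).trans (hpb i)
    have h4 : lam i p.2 j ^ 2 ≤ M ^ 2 := sq_le_sq' (abs_le.1 h3).1 (abs_le.1 h3).2
    have h5 : loading c lam (N p.1) i p.2 j = c (N p.1) * lam i p.2 j := rfl
    rw [h5]
    nlinarith [mul_le_mul_of_nonneg_left h4 (sq_nonneg (c (N p.1)))]
  refine hp.trans ((mul_le_mul_of_nonneg_left h2 (by positivity)).trans (le_of_eq ?_))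
  rw [Finset.sum_const, Finset.card_range, nsmul_eq_mul]
  ring

/-- The scale of the loadings is large compared to `1/√T`. -/
lemma tendsto_inv_scale [IsProbabilityMeasure μ] (hN : Tendsto N atTop atTop)
    (hT : Tendsto T atTop atTop) (hF : FactorAssumption μ c lam F α M SΛ SF)
    (hrate : Tendsto (fun n => (N n : ℝ) / (N n : ℝ) ^ α * (1 / (T n : ℝ))) atTop (𝓝 0))
    (j : Fin r) : Tendsto (fun n => (c (N n) * √(T n : ℝ))⁻¹) atTop (𝓝 0) := by
  have hdpos : 0 < SΛ j j := hF.loading_posDef.diag_pos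
  have h2 := eventually_le_scale hN hF j
  generalize SΛ j j = d at hdpos h2
  have h3 : Tendsto (fun n => (c (N n) * √(T n : ℝ))⁻¹ ^ 2) atTop (𝓝 0) := by
    have h4 : Tendsto (fun n => 2 * M ^ 2 / d * ((N n : ℝ) / (N n : ℝ) ^ α * (1 / (T n : ℝ))))
        atTop (𝓝 0) := by simpa using hrate.const_mul (2 * M ^ 2 / d)
    refine squeeze_zero' (.of_forall fun n => sq_nonneg _) ?_ h4
    filter_upwards [h2, eventually_natCast_pos hT] with n hn hTn
    have hc := hF.scale_pos (N n)
    rw [inv_pow, mul_pow, Real.sq_sqrt hTn.le, inv_le_iff_one_le_mul₀ (by positivity)]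
    have h5 : 1 ≤ 2 / d * (c (N n) ^ 2 * M ^ 2 * ((N n : ℝ) / (N n : ℝ) ^ α)) := by
      rw [div_mul_eq_mul_div, le_div_iff₀ hdpos]
      linarith
    refine h5.trans (le_of_eq ?_)
    field_simp
  have h4 := h3.sqrt
  rw [Real.sqrt_zero] at h4
  refine h4.congr fun n => Real.sqrt_sq ?_
  exact inv_nonneg.2 (mul_nonneg (hF.scale_pos (N n)).le (Real.sqrt_nonneg _))

lemma rpow_neg_half_eq (n : ℕ) : (N n : ℝ) ^ (-α / 2) = (strength N α n)⁻¹ := by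
  rw [neg_div, Real.rpow_neg (Nat.cast_nonneg _), strength, Real.sqrt_eq_rpow,
    ← Real.rpow_mul (Nat.cast_nonneg _), mul_one_div]

lemma periodErrors_mul_loadings_apply (t n : ℕ) (ω : Ω) (q : Fin 1) (j : Fin r) :
    ((periodErrors e t (N n) (strength N α n) ω)ᵀ *
      normLoadings (loading c lam (N n)) (N n) (strength N α n) ω) q j =
      (strength N α n)⁻¹ * crossSum (loading c lam (N n)) e α t (N n) ω j := by
  have h : crossSum (loading c lam (N n)) e α t (N n) ω j = (strength N α n)⁻¹ *
      ∑ i ∈ Finset.range (N n), e i t ω * loading c lam (N n) i ω j := by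
    rw [← euclidean_sum_apply, ← rpow_neg_half_eq]
    rfl
  rw [h, Matrix.mul_apply, Finset.sum_range, Finset.mul_sum, Finset.mul_sum]
  refine Finset.sum_congr rfl fun i _ => ?_
  simp only [periodErrors, normLoadings, Matrix.transpose_apply, Matrix.of_apply]
  ring

lemma factors_mul_unitErrors_apply (i T : ℕ) (ω : Ω) (j : Fin r) (q : Fin 1) :
    ((normFactors F T ω)ᵀ * unitErrors e i T ω) j q =
      (√(T : ℝ))⁻¹ * timeSum F e i T ω j := by
  have h : timeSum F e i T ω j = (√(T : ℝ))⁻¹ * ∑ t ∈ Finset.range T, e i t ω * F t ω j := by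
    rw [← euclidean_sum_apply, ← one_div]
    rfl
  rw [h, Matrix.mul_apply, Finset.sum_range, Finset.mul_sum, Finset.mul_sum]
  refine Finset.sum_congr rfl fun i _ => ?_
  simp only [unitErrors, normFactors, Matrix.transpose_apply, Matrix.of_apply]
  ring

lemma bddInProb_period_loadings (hN : Tendsto N atTop atTop) (t : ℕ)
    (h : BddInProb μ fun p => ‖crossSum (loading c lam (N p.1)) e α t (N p.1) p.2‖) :
    BddInProb μ fun p => strength N α p.1 *
      ‖(periodErrors e t (N p.1) (strength N α p.1) p.2)ᵀ *
        normLoadings (loading c lam (N p.1)) (N p.1) (strength N α p.1) p.2‖ := by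
  refine h.mono_le ?_
  filter_upwards [tendsto_fst_whp.eventually (eventually_natCast_pos hN)] with p hp
  have hu := strength_pos (α := α) hp
  rw [Real.norm_of_nonneg (by positivity), ← norm_matrix_transpose]
  have h1 := norm_euclidean_column_le (A := ((periodErrors e t (N p.1) (strength N α p.1) p.2)ᵀ *
        normLoadings (loading c lam (N p.1)) (N p.1) (strength N α p.1) p.2)ᵀ)
    (inv_nonneg.2 hu.le) (x := crossSum (loading c lam (N p.1)) e α t (N p.1) p.2)
    (fun j => periodErrors_mul_loadings_apply _ _ _ _ _)
  refine (mul_le_mul_of_nonneg_left h1 hu.le).trans (le_of_eq ?_)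
  field_simp

lemma bddInProb_factors_unit (hT : Tendsto T atTop atTop) (i : ℕ)
    (h : BddInProb μ fun p => ‖timeSum F e i (T p.1) p.2‖) :
    BddInProb μ fun p => √(T p.1 : ℝ) *
      ‖(normFactors F (T p.1) p.2)ᵀ * unitErrors e i (T p.1) p.2‖ := by
  refine h.mono_le ?_
  filter_upwards [tendsto_fst_whp.eventually (eventually_natCast_pos hT)] with p hp
  have hs : 0 < √(T p.1 : ℝ) := Real.sqrt_pos.2 hp
  rw [Real.norm_of_nonneg (by positivity)]
  have h1 := norm_euclidean_column_le
    (A := (normFactors F (T p.1) p.2)ᵀ * unitErrors e i (T p.1) p.2)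
    (inv_nonneg.2 hs.le) (x := timeSum F e i (T p.1) p.2)
    (fun j => factors_mul_unitErrors_apply _ _ _ _ _)
  refine (mul_le_mul_of_nonneg_left h1 hs.le).trans (le_of_eq ?_)
  field_simp

/-- The rescaled estimator has all the stochastic orders that the expansion needs. -/
theorem panelOrders (hN : Tendsto N atTop atTop) (hT : Tendsto T atTop atTop)
    (hA : AssumptionA μ c lam F e N T α M SΛ SF) (hC : AssumptionC N T α)
    {Ft : ∀ n, Ω → Matrix (Fin (T n)) (Fin r) ℝ} {Lt : ∀ n, Ω → Matrix (Fin (N n)) (Fin r) ℝ}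
    (hPC : ∀ᶠ n in atTop, ∀ᵐ ω ∂μ,
      IsPCEstimator (dataMatrix (loading c lam (N n)) F e (N n) (T n) ω) (Ft n ω) (Lt n ω))
    (i t : ℕ)
    (hξ : BddInProb μ fun p => ‖crossSum (loading c lam (N p.1)) e α t (N p.1) p.2‖)
    (hη : BddInProb μ fun p => ‖timeSum F e i (T p.1) p.2‖)
    {U : ∀ p : ℕ × Ω, Matrix (Fin (T p.1)) (Fin r) ℝ}
    {Q : ∀ p : ℕ × Ω, Matrix (Fin (N p.1)) (Fin r) ℝ} {K G B : ℕ × Ω → Matrix (Fin r) (Fin r) ℝ}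
    (hU : ∀ p, U p = (√(T p.1 : ℝ))⁻¹ • Ft p.1 p.2)
    (hQ : ∀ p, Q p = (strength N α p.1)⁻¹ • Lt p.1 p.2) (hK : ∀ p, K p = ((Q p)ᵀ * Q p)⁻¹)
    (hG : ∀ p, G p = (normFactors F (T p.1) p.2)ᵀ * U p)
    (hB : ∀ p, B p = (normLoadings (loading c lam (N p.1)) (N p.1) (strength N α p.1) p.2)ᵀ *
      Q p * K p) :
    PanelOrders (N := N) (T := T) μ SΛ SF (strength N α) (fun n => √(T n : ℝ))
      (fun p => normFactors F (T p.1) p.2) U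
      (fun p => normLoadings (loading c lam (N p.1)) (N p.1) (strength N α p.1) p.2) Q
      (fun p => normErrors e (N p.1) (T p.1) (strength N α p.1) p.2) K G B
      (fun p => periodErrors e t (N p.1) (strength N α p.1) p.2)
      (fun p => unitErrors e i (T p.1) p.2) := by
  obtain ⟨a, ha, hSF⟩ := exists_le_quad hA.factors.factor_posDef
  obtain ⟨b, hb, hSΛ⟩ := exists_le_quad hA.factors.loading_posDef
  have gF := tendsto_gram_factors hT hA.factors
  have gL := tendsto_gram_loadings hN hA.factors
  have nE := tendsto_normErrors_sq hT hA.errors hC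
  have hv := tendsto_sqrt_natCast hT
  have nE' : ∀ᶠ p in whp μ, ‖normErrors e (N p.1) (T p.1) (strength N α p.1) p.2‖ ≤
      √(a / 2 * (b / 2)) / 2 := by
    filter_upwards [nE.eventually_le_const (by positivity : 0 < (√(a / 2 * (b / 2)) / 2) ^ 2),
      tendsto_fst_whp.eventually (hv.eventually_ge_atTop 1)] with p hp hp1
    refine le_of_sq_le_sq (le_trans ?_ hp) (by positivity)
    exact le_mul_of_one_le_left (sq_nonneg _) hp1
  have key : ∀ᶠ p in whp μ, PCAEquations (normFactors F (T p.1) p.2)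
      (normLoadings (loading c lam (N p.1)) (N p.1) (strength N α p.1) p.2)
      (normErrors e (N p.1) (T p.1) (strength N α p.1) p.2) (U p) (Q p) (K p) (G p) (B p) ∧
      ‖K p‖ ≤ (a / 2 * (b / 2) / 4)⁻¹ := by
    have hPC' : ∀ᶠ p : ℕ × Ω in whp μ, IsPCEstimator
        (dataMatrix (loading c lam (N p.1)) F e (N p.1) (T p.1) p.2) (Ft p.1 p.2) (Lt p.1 p.2) :=
      eventually_whp_of_ae hPC
    filter_upwards [hPC', nE',
      (tendsto_iff_norm_sub_tendsto_zero.1 gF).eventually_le_const (half_pos ha),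
      (tendsto_iff_norm_sub_tendsto_zero.1 gL).eventually_le_const (half_pos hb),
      tendsto_fst_whp.eventually (eventually_natCast_pos hN),
      tendsto_fst_whp.eventually (eventually_natCast_pos hT)] with p h1 h2 h3 h4 h5 h6
    exact h1.pcaEquations (Nat.cast_pos.1 h5) (Nat.cast_pos.1 h6) (strength_pos h5) ha hb hSF hSΛ
      h3 h4 h2 (hU p) (hQ p) (hK p) (hG p) (hB p)
  exact
    { eqs := key.mono fun _ h => h.1
      u_nonneg := fun _ => strength_nonneg _
      v_nonneg := fun _ => Real.sqrt_nonneg _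
      v_tendsto := hv
      unitF := (Matrix.isUnit_iff_isUnit_det _).1 hA.factors.factor_posDef.isUnit
      unitL := (Matrix.isUnit_iff_isUnit_det _).1 hA.factors.loading_posDef.isUnit
      gramF := gF
      gramL := gL
      bddK := .of_bound _ (key.mono fun _ h => by rw [abs_norm]; exact h.2)
      normE := nE
      LEF := tendsto_loading_error_factor hN hT hA.factors.alpha_pos hA.link
      FEg := tendsto_factor_error_period hN hT hA.factors.alpha_pos hA.factors.alpha_le_one
        hA.link hC t
      Eg := tendsto_error_period hN hT hA.errors hC t
      LEk := tendsto_loading_error_unit hN hT hA.factors.alpha_pos hA.link hC i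
      Ek := tendsto_error_unit hN hT hA.errors hC i
      Lg := bddInProb_period_loadings hN t hξ
      Fk := bddInProb_factors_unit hT i hη }

end Panel

/-! ### The studentized estimator of the common component -/

section Solve

variable {r : ℕ} {S Γ Φ SΛ SF : Matrix (Fin r) (Fin r) ℝ}

/-- The vector `S⁻¹ v`. -/
noncomputable def solve (S : Matrix (Fin r) (Fin r) ℝ) (v : EuclideanSpace ℝ (Fin r)) :
    EuclideanSpace ℝ (Fin r) :=
  WithLp.toLp 2 (S⁻¹ *ᵥ v.ofLp)

lemma solve_smul (a : ℝ) (v : EuclideanSpace ℝ (Fin r)) : solve S (a • v) = a • solve S v := by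
  simp only [solve, WithLp.ofLp_smul, Matrix.mulVec_smul, WithLp.toLp_smul]

lemma continuous_solve : Continuous (solve S) :=
  (PiLp.continuous_toLp 2 _).comp
    (continuous_const.matrix_mulVec (PiLp.continuous_ofLp 2 _))

lemma transpose_inv_of_posDef (hS : S.PosDef) : (S⁻¹)ᵀ = S⁻¹ := by
  have h : Sᵀ = S := by
    rw [← Matrix.conjTranspose_eq_transpose_of_trivial]
    exact hS.isHermitian
  rw [Matrix.transpose_nonsing_inv, h]

lemma isUnit_det_of_posDef (hS : S.PosDef) : IsUnit S.det :=
  (Matrix.isUnit_iff_isUnit_det _).1 hS.isUnit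

lemma sandwich_eq_quad (hS : S.PosDef) (v : EuclideanSpace ℝ (Fin r)) :
    sandwich S Γ v = quad Γ (solve S v) := by
  simp only [sandwich, quad, solve]
  rw [← Matrix.mulVec_mulVec, ← Matrix.mulVec_mulVec, Matrix.dotProduct_mulVec,
    ← Matrix.mulVec_transpose, transpose_inv_of_posDef hS]

lemma norm_le_norm_solve (hS : S.PosDef) (v : EuclideanSpace ℝ (Fin r)) :
    ‖v‖ ≤ ‖S‖ * ‖solve S v‖ := by
  have h := Matrix.l2_opNorm_mulVec S (solve S v)
  have h1 : S *ᵥ (solve S v).ofLp = v.ofLp := by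
    simp only [solve]
    rw [Matrix.mulVec_mulVec, Matrix.mul_nonsing_inv _ (isUnit_det_of_posDef hS),
      Matrix.one_mulVec]
  rw [h1] at h
  exact h

lemma solve_ne_zero (hS : S.PosDef) {v : EuclideanSpace ℝ (Fin r)} (hv : v ≠ 0) :
    solve S v ≠ 0 := fun h => by
  have h1 := norm_le_norm_solve hS v
  rw [h, norm_zero, mul_zero] at h1
  exact hv (norm_le_zero_iff.1 h1)

lemma exists_norm_le_sqrt_quad (hΓ : Γ.PosDef) (hS : S.PosDef) :
    ∃ C, 0 ≤ C ∧ ∀ v, ‖v‖ ≤ C * √(quad Γ (solve S v)) := by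
  obtain ⟨m, hm, h⟩ := exists_le_quad hΓ
  refine ⟨‖S‖ * (√m)⁻¹, by positivity, fun v => (norm_le_norm_solve hS v).trans ?_⟩
  have h1 : √m * ‖solve S v‖ ≤ √(quad Γ (solve S v)) := by
    rw [← Real.sqrt_sq (norm_nonneg (solve S v)), ← Real.sqrt_mul hm.le]
    exact Real.sqrt_le_sqrt (h _)
  rw [mul_assoc]
  refine mul_le_mul_of_nonneg_left ?_ (norm_nonneg _)
  rw [inv_mul_eq_div, le_div_iff₀ (Real.sqrt_pos.2 hm), mul_comm]
  exact h1

/-- The two scaled vectors are controlled by the standard deviation. -/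
lemma exists_norm_le_stdDev (hΓ : Γ.PosDef) (hΦ : Φ.PosDef) (hSΛ : SΛ.PosDef) (hSF : SF.PosDef) :
    ∃ C, 0 ≤ C ∧ ∀ a b x y, 0 ≤ a → 0 ≤ b →
      a * ‖x‖ ≤ C * stdDev Γ Φ a b (solve SΛ x, solve SF y) ∧
      b * ‖y‖ ≤ C * stdDev Γ Φ a b (solve SΛ x, solve SF y) := by
  obtain ⟨C₁, hC₁, h₁⟩ := exists_norm_le_sqrt_quad hΓ hSΛ
  obtain ⟨C₂, hC₂, h₂⟩ := exists_norm_le_sqrt_quad hΦ hSF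
  refine ⟨max C₁ C₂, le_max_of_le_left hC₁, fun a b x y ha hb => ⟨?_, ?_⟩⟩
  · have q := quad_nonneg hΦ (solve SF y)
    calc a * ‖x‖ ≤ a * (C₁ * √(quad Γ (solve SΛ x))) := mul_le_mul_of_nonneg_left (h₁ x) ha
      _ = C₁ * √(a ^ 2 * quad Γ (solve SΛ x)) := by
        rw [Real.sqrt_mul (sq_nonneg a), Real.sqrt_sq ha]; ring
      _ ≤ _ := mul_le_mul (le_max_left _ _)
        (Real.sqrt_le_sqrt (le_add_of_nonneg_right (by positivity))) (Real.sqrt_nonneg _)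
        (le_max_of_le_left hC₁)
  · have q := quad_nonneg hΓ (solve SΛ x)
    calc b * ‖y‖ ≤ b * (C₂ * √(quad Φ (solve SF y))) := mul_le_mul_of_nonneg_left (h₂ y) hb
      _ = C₂ * √(b ^ 2 * quad Φ (solve SF y)) := by
        rw [Real.sqrt_mul (sq_nonneg b), Real.sqrt_sq hb]; ring
      _ ≤ _ := mul_le_mul (le_max_right _ _)
        (Real.sqrt_le_sqrt (le_add_of_nonneg_left (by positivity))) (Real.sqrt_nonneg _)
        (le_max_of_le_left hC₁)

lemma mul_stdDev_one_le (hΓ : Γ.PosDef) (hΦ : Φ.PosDef) {a b d : ℝ} (hd : 0 ≤ d) (ha : d ≤ a)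
    (hb : d ≤ b) (v : EuclideanSpace ℝ (Fin r) × EuclideanSpace ℝ (Fin r)) :
    d * stdDev Γ Φ 1 1 v ≤ stdDev Γ Φ a b v := by
  have q1 := quad_nonneg hΓ v.1
  have q2 := quad_nonneg hΦ v.2
  rw [stdDev, stdDev, ← Real.sqrt_sq hd, ← Real.sqrt_mul (sq_nonneg _)]
  refine Real.sqrt_le_sqrt ?_
  rw [one_pow, one_mul, one_mul, mul_add]
  gcongr

lemma stdDev_le_mul_one (hΓ : Γ.PosDef) (hΦ : Φ.PosDef) {a b d : ℝ} (ha : 0 ≤ a) (hb : 0 ≤ b)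
    (had : a ≤ d) (hbd : b ≤ d) (v : EuclideanSpace ℝ (Fin r) × EuclideanSpace ℝ (Fin r)) :
    stdDev Γ Φ a b v ≤ d * stdDev Γ Φ 1 1 v := by
  have q1 := quad_nonneg hΓ v.1
  have q2 := quad_nonneg hΦ v.2
  have hd := ha.trans had
  rw [stdDev, stdDev, ← Real.sqrt_sq hd, ← Real.sqrt_mul (sq_nonneg _)]
  refine Real.sqrt_le_sqrt ?_
  rw [one_pow, one_mul, one_mul, mul_add]
  gcongr

lemma measurable_stdDev (a b : ℝ) : Measurable (stdDev Γ Φ a b) := by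
  have h1 := (continuous_quad Γ).measurable
  have h2 := (continuous_quad Φ).measurable
  unfold stdDev
  fun_prop

end Solve

section Common

variable {Ω : Type*} [MeasurableSpace Ω] {μ : Measure Ω} {r : ℕ} {c : ℕ → ℝ}
  {lam F : ℕ → Ω → EuclideanSpace ℝ (Fin r)} {e : ℕ → ℕ → Ω → ℝ} {N T : ℕ → ℕ} {α M : ℝ}
  {SΛ SF Γ Φ : Matrix (Fin r) (Fin r) ℝ}

/-- A vector as a column. -/
def column (x : EuclideanSpace ℝ (Fin r)) : Matrix (Fin r) (Fin 1) ℝ := Matrix.of fun j _ => x j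

lemma norm_column_euclidean_le (x : EuclideanSpace ℝ (Fin r)) : ‖column x‖ ≤ ‖x‖ := by
  have h := norm_euclidean_column_le (A := column x) zero_le_one (x := x)
    (fun j => (one_mul _).symm)
  rwa [one_mul] at h

/-- The estimated common component in terms of the normal equations. -/
lemma PCAEquations.estCommon_eq {Λ F : ℕ → Ω → EuclideanSpace ℝ (Fin r)} {N T : ℕ} {u : ℝ}
    (hu : 0 < u) {ω : Ω} {Ft : Matrix (Fin T) (Fin r) ℝ} {Lt : Matrix (Fin N) (Fin r) ℝ}
    {K G B : Matrix (Fin r) (Fin r) ℝ} {U : Matrix (Fin T) (Fin r) ℝ}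
    {Q : Matrix (Fin N) (Fin r) ℝ}
    (h : PCAEquations (normFactors F T ω) (normLoadings Λ N u ω) (normErrors e N T u ω) U Q K G B)
    (hU : U = (√(T : ℝ))⁻¹ • Ft) (hQ : Q = u⁻¹ • Lt) {i t : ℕ} (hi : i < N) (ht : t < T) :
    estCommon Ft Lt i t = (((column (F t ω))ᵀ * B + (periodErrors e t N u ω)ᵀ * Q * K) *
      (Gᵀ * column (Λ i ω) + Uᵀ * unitErrors e i T ω)) 0 0 := by
  have hT : 0 < √(T : ℝ) := Real.sqrt_pos.2 (Nat.cast_pos.2 (Nat.zero_lt_of_lt ht))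
  rw [estCommon, dif_pos ⟨ht, hi⟩, Matrix.mul_apply, Matrix.mul_apply]
  refine Finset.sum_congr rfl fun k _ => ?_
  congr 1
  · have h1 : Ft ⟨t, ht⟩ k = √(T : ℝ) * U ⟨t, ht⟩ k := by
      rw [hU, Matrix.smul_apply, smul_eq_mul, mul_inv_cancel_left₀ hT.ne']
    rw [h1, h.U_eq, Matrix.mul_assoc _ Q K, Matrix.mul_assoc _ Q K, Matrix.add_apply,
      Matrix.add_apply, Matrix.mul_apply, Matrix.mul_apply, Matrix.mul_apply, Matrix.mul_apply,
      mul_add, Finset.mul_sum, Finset.mul_sum]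
    congr 1
    · refine Finset.sum_congr rfl fun j _ => ?_
      simp only [normFactors, column, Matrix.of_apply, Matrix.transpose_apply]
      field_simp
    · refine Finset.sum_congr rfl fun j _ => ?_
      simp only [normErrors, periodErrors, Matrix.of_apply, Matrix.transpose_apply]
      field_simp
  · have h1 : Lt ⟨i, hi⟩ k = u * Q ⟨i, hi⟩ k := by
      rw [hQ, Matrix.smul_apply, smul_eq_mul, mul_inv_cancel_left₀ hu.ne']
    rw [Matrix.transpose_apply, h1, h.Q_eq, Matrix.add_apply, Matrix.add_apply, Matrix.mul_apply,
      Matrix.mul_apply, Matrix.mul_apply, Matrix.mul_apply, mul_add, Finset.mul_sum,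
      Finset.mul_sum]
    congr 1
    · refine Finset.sum_congr rfl fun j _ => ?_
      simp only [normLoadings, column, Matrix.of_apply, Matrix.transpose_apply]
      field_simp
    · refine Finset.sum_congr rfl fun j _ => ?_
      simp only [normErrors, unitErrors, Matrix.of_apply, Matrix.transpose_apply]
      field_simp

/-- The leading term of the expansion. -/
lemma leading_term_eq (hSF : SF.PosDef) (i t n : ℕ) (ω : Ω) :
    ((periodErrors e t (N n) (strength N α n) ω)ᵀ *
        normLoadings (loading c lam (N n)) (N n) (strength N α n) ω * SΛ⁻¹ *
        column (loading c lam (N n) i ω) +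
      (column (F t ω))ᵀ * SF⁻¹ * ((normFactors F (T n) ω)ᵀ * unitErrors e i (T n) ω)) 0 0 =
    pairing ((c (N n) / strength N α n) • solve SΛ (lam i ω), (√(T n : ℝ))⁻¹ • solve SF (F t ω))
      (crossSum (loading c lam (N n)) e α t (N n) ω, timeSum F e i (T n) ω) := by
  have h1 : ((periodErrors e t (N n) (strength N α n) ω)ᵀ *
        normLoadings (loading c lam (N n)) (N n) (strength N α n) ω * SΛ⁻¹ *
        column (loading c lam (N n) i ω)) 0 0 =
      inner ℝ ((c (N n) / strength N α n) • solve SΛ (lam i ω))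
        (crossSum (loading c lam (N n)) e α t (N n) ω) := by
    rw [Matrix.mul_assoc, Matrix.mul_apply, real_inner_smul_left, PiLp.inner_apply,
      Finset.mul_sum]
    refine Finset.sum_congr rfl fun j _ => ?_
    rw [periodErrors_mul_loadings_apply]
    have h2 : (SΛ⁻¹ * column (loading c lam (N n) i ω)) j 0 =
        c (N n) * solve SΛ (lam i ω) j := by
      have h3 : (SΛ⁻¹ * column (loading c lam (N n) i ω)) j 0 =
        solve SΛ (c (N n) • lam i ω) j := rfl
      rw [h3, solve_smul]
      rfl
    rw [h2]
    simp only [RCLike.inner_apply, conj_trivial]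
    ring
  have h2 : ((column (F t ω))ᵀ * SF⁻¹ *
        ((normFactors F (T n) ω)ᵀ * unitErrors e i (T n) ω)) 0 0 =
      inner ℝ ((√(T n : ℝ))⁻¹ • solve SF (F t ω)) (timeSum F e i (T n) ω) := by
    rw [Matrix.mul_apply, real_inner_smul_left, PiLp.inner_apply, Finset.mul_sum]
    refine Finset.sum_congr rfl fun j _ => ?_
    rw [factors_mul_unitErrors_apply]
    have h3 : ((column (F t ω))ᵀ * SF⁻¹) 0 j = solve SF (F t ω) j := by
      rw [← transpose_inv_of_posDef hSF, ← Matrix.transpose_mul]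
      rfl
    rw [h3]
    simp only [RCLike.inner_apply, conj_trivial]
    ring
  rw [Matrix.add_apply, h1, h2]
  rfl

lemma inv_mul_stdDev_le (hΓ : Γ.PosDef) (hΦ : Φ.PosDef) {γ u v : ℝ} (hγ : 0 < γ) (hu : 0 < u)
    (hv : 0 < v) {x : EuclideanSpace ℝ (Fin r) × EuclideanSpace ℝ (Fin r)}
    (hx : x.1 ≠ 0 ∨ x.2 ≠ 0) :
    (u * v * stdDev Γ Φ (γ / u) v⁻¹ x)⁻¹ ≤ ((γ * v)⁻¹ + u⁻¹) * (stdDev Γ Φ 1 1 x)⁻¹ := by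
  have hτ := stdDev_pos hΓ hΦ one_pos one_pos hx
  have h1 := mul_stdDev_one_le hΓ hΦ (d := min (γ / u) v⁻¹) (le_min (by positivity) (by positivity))
    (min_le_left _ _) (min_le_right _ _) x
  have h2 : min (γ * v) u = u * v * min (γ / u) v⁻¹ := by
    rw [mul_min_of_nonneg _ _ (by positivity)]
    congr 1 <;> field_simp
  have hm : 0 < min (γ * v) u := lt_min (by positivity) hu
  have h3 : min (γ * v) u * stdDev Γ Φ 1 1 x ≤ u * v * stdDev Γ Φ (γ / u) v⁻¹ x := by
    rw [h2, mul_assoc]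
    exact mul_le_mul_of_nonneg_left h1 (by positivity)
  refine (inv_anti₀ (by positivity) h3).trans ?_
  rw [mul_inv]
  refine mul_le_mul_of_nonneg_right ?_ (inv_nonneg.2 hτ.le)
  rcases min_cases (γ * v) u with h | h <;> rw [h.1]
  · exact le_add_of_nonneg_right (by positivity)
  · exact le_add_of_nonneg_left (by positivity)

end Common

section Studentization

variable {Ω : Type*} [MeasurableSpace Ω] {μ : Measure Ω} {r : ℕ} {c : ℕ → ℝ}
  {lam F : ℕ → Ω → EuclideanSpace ℝ (Fin r)} {e : ℕ → ℕ → Ω → ℝ} {N T : ℕ → ℕ} {α M : ℝ}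
  {SΛ SF Γ Φ : Matrix (Fin r) (Fin r) ℝ}

/-- The two directions `Σ_Λ⁻¹ λ_i` and `Σ_F⁻¹ F_t` of the leading term. -/
noncomputable def directions (SΛ SF : Matrix (Fin r) (Fin r) ℝ)
    (x : EuclideanSpace ℝ (Fin r) × EuclideanSpace ℝ (Fin r)) :
    EuclideanSpace ℝ (Fin r) × EuclideanSpace ℝ (Fin r) :=
  (solve SΛ x.1, solve SF x.2)

lemma continuous_directions : Continuous (directions SΛ SF) :=
  (continuous_solve.comp continuous_fst).prodMk (continuous_solve.comp continuous_snd)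

lemma directions_ne_zero (hSΛ : SΛ.PosDef) (hSF : SF.PosDef)
    {x : EuclideanSpace ℝ (Fin r) × EuclideanSpace ℝ (Fin r)} (hx : x.1 ≠ 0 ∨ x.2 ≠ 0) :
    (directions SΛ SF x).1 ≠ 0 ∨ (directions SΛ SF x).2 ≠ 0 :=
  hx.imp (solve_ne_zero hSΛ) (solve_ne_zero hSF)

/-- The asymptotic variance is the variance of the leading term. -/
lemma sqrt_variance_eq (hSΛ : SΛ.PosDef) (hSF : SF.PosDef) (n : ℕ)
    (x y : EuclideanSpace ℝ (Fin r)) :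
    √(1 / (N n : ℝ) ^ α * sandwich SΛ Γ (c (N n) • x) + 1 / (T n : ℝ) * sandwich SF Φ y) =
      stdDev Γ Φ (c (N n) / strength N α n) (√(T n : ℝ))⁻¹ (directions SΛ SF (x, y)) := by
  rw [sandwich_eq_quad hSΛ, sandwich_eq_quad hSF, solve_smul, quad_smul, stdDev, div_pow,
    strength_sq, inv_pow, Real.sq_sqrt (Nat.cast_nonneg _), directions]
  congr 1
  ring

/-- The remainder of the expansion, after division by a standard deviation `s` that is not small
compared to the scaled loading `x` and factor `y`. -/
lemma norm_div_sub_le {w z s f l x y u v γ C M κ R₁ R₂ R₃ R₄ : ℝ} (hs : 0 < s) (hu : 0 < u)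
    (hv : 0 < v) (hC : 0 ≤ C) (hl0 : 0 ≤ l) (hx : 0 ≤ x) (hR₁ : 0 ≤ R₁) (hR₂ : 0 ≤ R₂)
    (hR₃ : 0 ≤ R₃) (hR₄ : 0 ≤ R₄)
    (h : |w - z| ≤ f * l * R₁ + l * R₂ + f * R₃ + R₄) (hf : f ≤ y)
    (hl : l ≤ γ * x) (hγ : γ ≤ 1) (hM : x ≤ M) (hx' : γ / u * x ≤ C * s) (hy : v⁻¹ * y ≤ C * s)
    (hκ : (u * v * s)⁻¹ ≤ κ) :
    ‖w / s - s⁻¹ * z‖ ≤ C * M * (v * R₁) + C * (u * R₂) + C * (v * R₃) + u * v * R₄ * κ := by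
  have hyv : f ≤ v * (C * s) := by
    refine hf.trans ?_
    rwa [inv_mul_eq_div, div_le_iff₀ hv, mul_comm] at hy
  have hlu : l ≤ u * (C * s) := by
    refine hl.trans ?_
    rwa [div_mul_eq_mul_div, div_le_iff₀ hu, mul_comm _ u] at hx'
  have hlM : l ≤ M := hl.trans ((mul_le_of_le_one_left hx hγ).trans hM)
  have h1 : |w - z| ≤ v * (C * s) * M * R₁ + u * (C * s) * R₂ + v * (C * s) * R₃ + R₄ := by
    refine h.trans ?_
    gcongr
  have h2 : w / s - s⁻¹ * z = s⁻¹ * (w - z) := by ring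
  rw [h2, norm_mul, Real.norm_of_nonneg (inv_nonneg.2 hs.le), Real.norm_eq_abs]
  refine (mul_le_mul_of_nonneg_left h1 (inv_nonneg.2 hs.le)).trans ?_
  have h3 : s⁻¹ * (v * (C * s) * M * R₁ + u * (C * s) * R₂ + v * (C * s) * R₃ + R₄) =
      C * M * (v * R₁) + C * (u * R₂) + C * (v * R₃) + u * v * R₄ * (u * v * s)⁻¹ := by
    field_simp
  rw [h3]
  gcongr

/-- After studentization, the estimation error of the common component is its leading term up to
`o_p(1)`. -/
theorem tendsto_studentized_sub [IsProbabilityMeasure μ] (hN : Tendsto N atTop atTop)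
    (hT : Tendsto T atTop atTop) (hA : AssumptionA μ c lam F e N T α M SΛ SF)
    (hC : AssumptionC N T α) (hΓ : Γ.PosDef) (hΦ : Φ.PosDef)
    {Ft : ∀ n, Ω → Matrix (Fin (T n)) (Fin r) ℝ} {Lt : ∀ n, Ω → Matrix (Fin (N n)) (Fin r) ℝ}
    (hPC : ∀ᶠ n in atTop, ∀ᵐ ω ∂μ,
      IsPCEstimator (dataMatrix (loading c lam (N n)) F e (N n) (T n) ω) (Ft n ω) (Lt n ω))
    (i t : ℕ)
    (hξ : BddInProb μ fun p => ‖crossSum (loading c lam (N p.1)) e α t (N p.1) p.2‖)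
    (hη : BddInProb μ fun p => ‖timeSum F e i (T p.1) p.2‖)
    (hnd : ∀ᵐ ω ∂μ, lam i ω ≠ 0 ∨ F t ω ≠ 0) :
    Tendsto (fun p : ℕ × Ω =>
      (estCommon (Ft p.1 p.2) (Lt p.1 p.2) i t - common (loading c lam (N p.1)) F i t p.2) /
        stdDev Γ Φ (c (N p.1) / strength N α p.1) (√(T p.1 : ℝ))⁻¹
          (directions SΛ SF (lam i p.2, F t p.2)) -
      pairing (weight Γ Φ (c (N p.1) / strength N α p.1) (√(T p.1 : ℝ))⁻¹
          (directions SΛ SF (lam i p.2, F t p.2)))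
        (crossSum (loading c lam (N p.1)) e α t (N p.1) p.2, timeSum F e i (T p.1) p.2))
      (whp μ) (𝓝 0) := by
  have hSΛ := hA.factors.loading_posDef
  have hSF := hA.factors.factor_posDef
  -- as not both vectors vanish, there is at least one factor
  obtain ⟨j⟩ : Nonempty (Fin r) := by
    obtain ⟨ω, hω⟩ := hnd.exists
    by_contra hr
    rw [not_nonempty_iff] at hr
    rcases hω with h | h <;> exact h (Subsingleton.elim _ _)
  obtain ⟨C, hC0, hCb⟩ := exists_norm_le_stdDev hΓ hΦ hSΛ hSF
  let U : ∀ p : ℕ × Ω, Matrix (Fin (T p.1)) (Fin r) ℝ := fun p =>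
    (√(T p.1 : ℝ))⁻¹ • Ft p.1 p.2
  let Q : ∀ p : ℕ × Ω, Matrix (Fin (N p.1)) (Fin r) ℝ := fun p =>
    (strength N α p.1)⁻¹ • Lt p.1 p.2
  let K : ℕ × Ω → Matrix (Fin r) (Fin r) ℝ := fun p => ((Q p)ᵀ * Q p)⁻¹
  let G : ℕ × Ω → Matrix (Fin r) (Fin r) ℝ := fun p => (normFactors F (T p.1) p.2)ᵀ * U p
  let B : ℕ × Ω → Matrix (Fin r) (Fin r) ℝ := fun p =>
    (normLoadings (loading c lam (N p.1)) (N p.1) (strength N α p.1) p.2)ᵀ * Q p * K p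
  have h := panelOrders hN hT hA hC hPC i t hξ hη (U := U) (Q := Q) (K := K) (G := G) (B := B)
    (fun _ => rfl) (fun _ => rfl) (fun _ => rfl) (fun _ => rfl) (fun _ => rfl)
  have hτ : BddInProb μ fun p : ℕ × Ω =>
      (stdDev Γ Φ 1 1 (directions SΛ SF (lam i p.2, F t p.2)))⁻¹ := by
    refine BddInProb.of_measurable (Y := fun ω =>
      (stdDev Γ Φ 1 1 (directions SΛ SF (lam i ω, F t ω)))⁻¹) ?_
    exact ((measurable_stdDev 1 1).comp (continuous_directions.measurable.comp
      ((hA.factors.measurable_loading i).prodMk (hA.factors.measurable_factor t)))).inv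
  have hscale : Tendsto (fun p : ℕ × Ω => (c (N p.1) * √(T p.1 : ℝ))⁻¹ + (strength N α p.1)⁻¹)
      (whp μ) (𝓝 0) :=
    (tendsto_zero_add (tendsto_inv_scale hN hT hA.factors hA.rate j)
      (tendsto_inv_strength hN hA.factors.alpha_pos)).comp tendsto_fst_whp
  have hlim := tendsto_zero_add (tendsto_zero_add (tendsto_zero_add
    (by simpa using h.tendsto_rotation.const_mul (C * M))
    (by simpa using h.tendsto_loading_coeff.const_mul C))
    (by simpa using h.tendsto_factor_coeff.const_mul C))
    (h.bddInProb_product.tendsto_mul' (hτ.tendsto_mul hscale))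
  refine squeeze_zero_norm' ?_ hlim
  have hnd' : ∀ᶠ p : ℕ × Ω in whp μ, lam i p.2 ≠ 0 ∨ F t p.2 ≠ 0 :=
    eventually_whp_of_ae (.of_forall fun _ => hnd)
  have hM : ∀ᶠ p : ℕ × Ω in whp μ, ‖lam i p.2‖ ≤ M :=
    eventually_whp_of_ae (.of_forall fun _ => hA.factors.loading_bound i)
  filter_upwards [h.eqs, hnd', hM, tendsto_fst_whp.eventually (eventually_natCast_pos hN),
    tendsto_fst_whp.eventually (eventually_natCast_pos hT),
    tendsto_fst_whp.eventually (hN.eventually_gt_atTop i),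
    tendsto_fst_whp.eventually (hT.eventually_gt_atTop t)] with p heq hp hMp hNp hTp hi ht
  have hu := strength_pos (α := α) hNp
  have hv : 0 < √(T p.1 : ℝ) := Real.sqrt_pos.2 hTp
  have hc := hA.factors.scale_pos (N p.1)
  have hexp := heq.norm_common_remainder_le SΛ⁻¹ SF⁻¹ (column (F t p.2))
    (column (loading c lam (N p.1) i p.2)) (periodErrors e t (N p.1) (strength N α p.1) p.2)
    (unitErrors e i (T p.1) p.2)
  have hest := heq.estCommon_eq hu rfl rfl hi ht
  have hcom : ((column (F t p.2))ᵀ * column (loading c lam (N p.1) i p.2)) 0 0 =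
      common (loading c lam (N p.1)) F i t p.2 := by
    rw [common, dotProduct_comm]
    rfl
  have hent := (abs_entry_le_norm _ 0 0).trans hexp
  rw [Matrix.sub_apply, Matrix.sub_apply, ← hest, hcom, leading_term_eq hSF] at hent
  have hbd := hCb (c (N p.1) / strength N α p.1) (√(T p.1 : ℝ))⁻¹ (lam i p.2) (F t p.2)
    (by positivity) (by positivity)
  have hdir := directions_ne_zero hSΛ hSF (x := (lam i p.2, F t p.2)) hp
  have hs : 0 < stdDev Γ Φ (c (N p.1) / strength N α p.1) (√(T p.1 : ℝ))⁻¹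
      (directions SΛ SF (lam i p.2, F t p.2)) :=
    stdDev_pos hΓ hΦ (by positivity) (by positivity) hdir
  have hinv := inv_mul_stdDev_le hΓ hΦ hc hu hv hdir
  have hf := norm_column_euclidean_le (F t p.2)
  have hl : ‖column (loading c lam (N p.1) i p.2)‖ ≤ c (N p.1) * ‖lam i p.2‖ := by
    refine (norm_column_euclidean_le _).trans (le_of_eq ?_)
    rw [loading, norm_smul, Real.norm_of_nonneg hc.le]
  have hc1 := hA.factors.scale_le_one (N p.1)
  rw [weight, pairing_smul]
  change ‖_ / _ - _ * pairing ((c (N p.1) / strength N α p.1) • solve SΛ (lam i p.2),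
    (√(T p.1 : ℝ))⁻¹ • solve SF (F t p.2)) _‖ ≤ _
  change _ ≤ C * stdDev Γ Φ _ _ (directions SΛ SF (lam i p.2, F t p.2)) ∧
    _ ≤ C * stdDev Γ Φ _ _ (directions SΛ SF (lam i p.2, F t p.2)) at hbd
  exact norm_div_sub_le hs hu hv hC0 (norm_nonneg _) (norm_nonneg _) (norm_nonneg _)
    (by positivity) (by positivity) (by positivity) hent hf hl hc1 hMp hbd.1 hbd.2
    hinv

section Abstract

variable {V : Ω → EuclideanSpace ℝ (Fin r) × EuclideanSpace ℝ (Fin r)}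
  {ζ : ℕ → Ω → EuclideanSpace ℝ (Fin r) × EuclideanSpace ℝ (Fin r)} {w : ℕ → Ω → ℝ} {a b : ℕ → ℝ}

lemma tendstoInDistribution_div_stdDev [IsProbabilityMeasure μ] (hΓ : Γ.PosDef) (hΦ : Φ.PosDef)
    (hV : Measurable V)
    (hclt : TendstoInDistribution (fun n ω => (V ω, ζ n ω)) atTop
      (fun p : Ω × (EuclideanSpace ℝ (Fin r) × EuclideanSpace ℝ (Fin r)) => (V p.1, p.2))
      (fun _ => μ) (μ.prod ((multivariateGaussian 0 Γ).prod (multivariateGaussian 0 Φ))))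
    (hζ : BddInProb μ fun p => ‖ζ p.1 p.2‖) (hV0 : ∀ᵐ ω ∂μ, (V ω).1 ≠ 0 ∨ (V ω).2 ≠ 0)
    (ha : ∀ᶠ n in atTop, 0 < a n) (hb : ∀ᶠ n in atTop, 0 < b n)
    (hw : ∀ n, AEMeasurable (w n) μ)
    (hsub : Tendsto (fun p : ℕ × Ω => w p.1 p.2 / stdDev Γ Φ (a p.1) (b p.1) (V p.2) -
      pairing (weight Γ Φ (a p.1) (b p.1) (V p.2)) (ζ p.1 p.2)) (whp μ) (𝓝 0)) :
    TendstoInDistribution (fun n ω => w n ω / stdDev Γ Φ (a n) (b n) (V ω)) atTop id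
      (fun _ => μ) (gaussianReal 0 1) :=
  tendstoInDistribution_of_tendstoInMeasure_sub _ _
    (tendstoInDistribution_pairing_weight hΓ hΦ hV hclt hζ hV0 ha hb)
    (tendstoInMeasure_of_tendsto_whp hsub)
    fun n => (hw n).div ((measurable_stdDev _ _).comp hV).aemeasurable

/-- An error whose studentized version is bounded in probability is of the order of the larger
scale. -/
lemma isBigOP_of_studentized [IsProbabilityMeasure μ] (hΓ : Γ.PosDef) (hΦ : Φ.PosDef)
    (hV : Measurable V) (hζ : BddInProb μ fun p => ‖ζ p.1 p.2‖)
    (hV0 : ∀ᵐ ω ∂μ, (V ω).1 ≠ 0 ∨ (V ω).2 ≠ 0)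
    (ha : ∀ᶠ n in atTop, 0 < a n) (hb : ∀ᶠ n in atTop, 0 < b n) {d : ℕ → ℝ} (hd : ∀ n, 0 ≤ d n)
    (had : ∀ᶠ n in atTop, a n ≤ d n) (hbd : ∀ᶠ n in atTop, b n ≤ d n)
    (hsub : Tendsto (fun p : ℕ × Ω => w p.1 p.2 / stdDev Γ Φ (a p.1) (b p.1) (V p.2) -
      pairing (weight Γ Φ (a p.1) (b p.1) (V p.2)) (ζ p.1 p.2)) (whp μ) (𝓝 0)) :
    IsBigOP μ w d := by
  obtain ⟨C, hC⟩ := exists_norm_weight_le hΓ hΦ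
  have hτ : BddInProb μ fun p : ℕ × Ω => stdDev Γ Φ 1 1 (V p.2) :=
    .of_measurable (Y := fun ω => stdDev Γ Φ 1 1 (V ω)) ((measurable_stdDev 1 1).comp hV)
  have hV0' : ∀ᶠ p : ℕ × Ω in whp μ, (V p.2).1 ≠ 0 ∨ (V p.2).2 ≠ 0 :=
    eventually_whp_of_ae (.of_forall fun _ => hV0)
  refine isBigOP_of_bddInProb hd
    (((BddInProb.of_tendsto hsub.norm).add ((BddInProb.const (2 * C)).mul hζ)).mul hτ) ?_
  filter_upwards [hV0', tendsto_fst_whp.eventually ha, tendsto_fst_whp.eventually hb,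
    tendsto_fst_whp.eventually had, tendsto_fst_whp.eventually hbd] with p hp hap hbp hadp hbdp
  have hs := stdDev_pos hΓ hΦ hap hbp hp
  have hle := stdDev_le_mul_one hΓ hΦ hap.le hbp.le hadp hbdp (V p.2)
  have hpair := (abs_pairing_le (weight Γ Φ (a p.1) (b p.1) (V p.2)) (ζ p.1 p.2)).trans
    (mul_le_mul_of_nonneg_right (mul_le_mul_of_nonneg_left (hC _ _ _) zero_le_two)
      (norm_nonneg _))
  generalize pairing _ _ = z at hpair ⊢
  generalize stdDev Γ Φ (a p.1) (b p.1) (V p.2) = s at hs hle ⊢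
  generalize stdDev Γ Φ 1 1 (V p.2) = τ at hle ⊢
  have h1 : |w p.1 p.2| = |w p.1 p.2 / s| * s := by
    rw [abs_div, abs_of_pos hs, div_mul_cancel₀ _ hs.ne']
  have h2 : |w p.1 p.2 / s| ≤ ‖w p.1 p.2 / s - z‖ + 2 * C * ‖ζ p.1 p.2‖ := by
    have h3 := abs_add_le (w p.1 p.2 / s - z) z
    rw [sub_add_cancel] at h3
    exact h3.trans (add_le_add le_rfl hpair)
  rw [h1]
  calc |w p.1 p.2 / s| * s ≤ (‖w p.1 p.2 / s - z‖ + 2 * C * ‖ζ p.1 p.2‖) * (d p.1 * τ) :=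
        mul_le_mul h2 hle hs.le ((abs_nonneg _).trans h2)
    _ = (‖w p.1 p.2 / s - z‖ + 2 * C * ‖ζ p.1 p.2‖) * τ * d p.1 := by ring
    _ ≤ _ := mul_le_mul_of_nonneg_right (le_abs_self _) (hd _)

end Abstract

end Studentization

end WeakFactor

open WeakFactor in
theorem proposition5 {Ω : Type*} [MeasurableSpace Ω] (μ : Measure Ω) [IsProbabilityMeasure μ]
    {r : ℕ}
    -- loadings `c N • lam i ω`, factors `F t ω` and errors `e i t ω`
    (c : ℕ → ℝ) (lam F : ℕ → Ω → EuclideanSpace ℝ (Fin r)) (e : ℕ → ℕ → Ω → ℝ)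
    -- the panel sizes, both tending to infinity
    (N T : ℕ → ℕ) (hN : Tendsto N atTop atTop) (hT : Tendsto T atTop atTop)
    (α M : ℝ) (SΛ SF : Matrix (Fin r) (Fin r) ℝ) (Γ Φ : ℕ → Matrix (Fin r) (Fin r) ℝ)
    (hA : AssumptionA μ c lam F e N T α M SΛ SF)
    (hB : AssumptionB μ c lam F e N T α Γ Φ)
    (hC : AssumptionC N T α)
    -- a principal components estimator
    (Ft : ∀ n, Ω → Matrix (Fin (T n)) (Fin r) ℝ) (Lt : ∀ n, Ω → Matrix (Fin (N n)) (Fin r) ℝ)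
    (hPC : ∀ᶠ n in atTop, ∀ᵐ ω ∂μ,
      IsPCEstimator (dataMatrix (loading c lam (N n)) F e (N n) (T n) ω) (Ft n ω) (Lt n ω))
    (i t : ℕ)
    (hmeas : ∀ n, AEMeasurable (fun ω => estCommon (Ft n ω) (Lt n ω) i t) μ)
    -- the asymptotic variance does not vanish
    (hnd : ∀ᵐ ω ∂μ, lam i ω ≠ 0 ∨ F t ω ≠ 0) :
    TendstoInDistribution
      (fun n ω =>
        (estCommon (Ft n ω) (Lt n ω) i t - common (loading c lam (N n)) F i t ω) /
        √(1 / (N n : ℝ) ^ α * sandwich SΛ (Γ t) (loading c lam (N n) i ω) +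
          1 / (T n : ℝ) * sandwich SF (Φ i) (F t ω)))
      atTop id (fun _ => μ) (gaussianReal 0 1) ∧
    IsBigOP μ
      (fun n ω => estCommon (Ft n ω) (Lt n ω) i t - common (loading c lam (N n)) F i t ω)
      (fun n => 1 / min (√((N n : ℝ) ^ α)) (√(T n : ℝ))) := by
  have hSΛ := hA.factors.loading_posDef
  have hSF := hA.factors.factor_posDef
  have hΓ := hB.cross_posDef t
  have hΦ := hB.time_posDef i
  have hclt := hB.clt i t
  have hξ : BddInProb μ fun p => ‖crossSum (loading c lam (N p.1)) e α t (N p.1) p.2‖ :=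
    .of_lintegral_sq (X := fun n ω => crossSum (loading c lam (N n)) e α t (N n) ω)
      (fun n => (hclt.forall_aemeasurable n).snd.fst.aestronglyMeasurable)
      fun n => hA.link.cross_moment t (N n)
  have hη : BddInProb μ fun p => ‖timeSum F e i (T p.1) p.2‖ :=
    .of_lintegral_sq (X := fun n ω => timeSum F e i (T n) ω)
      (fun n => (hclt.forall_aemeasurable n).snd.snd.aestronglyMeasurable)
      fun n => hA.link.time_moment i (T n)
  have hζ : BddInProb μ fun p : ℕ × Ω =>
      ‖(crossSum (loading c lam (N p.1)) e α t (N p.1) p.2, timeSum F e i (T p.1) p.2)‖ :=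
    (hξ.add hη).mono_le (.of_forall fun p => by
      rw [norm_norm]
      exact max_le (le_add_of_nonneg_right (norm_nonneg _))
        (le_add_of_nonneg_left (norm_nonneg _)))
  have hVm : Measurable fun ω => directions SΛ SF (lam i ω, F t ω) :=
    continuous_directions.measurable.comp
      ((hA.factors.measurable_loading i).prodMk (hA.factors.measurable_factor t))
  have hdir : ∀ᵐ ω ∂μ, (directions SΛ SF (lam i ω, F t ω)).1 ≠ 0 ∨
      (directions SΛ SF (lam i ω, F t ω)).2 ≠ 0 :=
    hnd.mono fun ω hω => directions_ne_zero hSΛ hSF (x := (lam i ω, F t ω)) hω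
  have ha : ∀ᶠ n in atTop, 0 < c (N n) / strength N α n :=
    (eventually_natCast_pos hN).mono fun n hn =>
      div_pos (hA.factors.scale_pos _) (strength_pos hn)
  have hb : ∀ᶠ n in atTop, 0 < (√(T n : ℝ))⁻¹ :=
    (eventually_natCast_pos hT).mono fun n hn => inv_pos.2 (Real.sqrt_pos.2 hn)
  have hsub := tendsto_studentized_sub hN hT hA hC hΓ hΦ hPC i t hξ hη hnd
  have hsd : ∀ n ω, √(1 / (N n : ℝ) ^ α * sandwich SΛ (Γ t) (loading c lam (N n) i ω) +
      1 / (T n : ℝ) * sandwich SF (Φ i) (F t ω)) =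
      stdDev (Γ t) (Φ i) (c (N n) / strength N α n) (√(T n : ℝ))⁻¹
        (directions SΛ SF (lam i ω, F t ω)) := fun n ω => sqrt_variance_eq hSΛ hSF n _ _
  have hcm : ∀ n, Measurable fun ω => common (loading c lam (N n)) F i t ω := fun n => by
    have h1 := hA.factors.measurable_loading i
    have h2 := hA.factors.measurable_factor t
    simp only [common, loading, dotProduct]
    fun_prop
  simp only [hsd]
  constructor
  · refine tendstoInDistribution_div_stdDev
      (V := fun ω => directions SΛ SF (lam i ω, F t ω))
      (ζ := fun n ω => (crossSum (loading c lam (N n)) e α t (N n) ω, timeSum F e i (T n) ω))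
      (w := fun n ω => estCommon (Ft n ω) (Lt n ω) i t - common (loading c lam (N n)) F i t ω)
      (a := fun n => c (N n) / strength N α n) (b := fun n => (√(T n : ℝ))⁻¹)
      hΓ hΦ hVm ?_ hζ hdir ha hb (fun n => (hmeas n).sub (hcm n).aemeasurable) hsub
    exact hclt.continuous_comp (g := fun q => (directions SΛ SF q.1, q.2))
      ((continuous_directions.comp continuous_fst).prodMk continuous_snd)
  · refine isBigOP_of_studentized
      (V := fun ω => directions SΛ SF (lam i ω, F t ω))
      (ζ := fun n ω => (crossSum (loading c lam (N n)) e α t (N n) ω, timeSum F e i (T n) ω))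
      (w := fun n ω => estCommon (Ft n ω) (Lt n ω) i t - common (loading c lam (N n)) F i t ω)
      (a := fun n => c (N n) / strength N α n) (b := fun n => (√(T n : ℝ))⁻¹)
      hΓ hΦ hVm hζ hdir ha hb (fun n => by positivity) ?_ ?_ hsub
    · filter_upwards [eventually_natCast_pos hN, eventually_natCast_pos hT] with n hn hn'
      exact div_le_div₀ zero_le_one (hA.factors.scale_le_one _)
        (lt_min (strength_pos hn) (Real.sqrt_pos.2 hn')) (min_le_left _ _)
    · filter_upwards [eventually_natCast_pos hN, eventually_natCast_pos hT] with n hn hn'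
      rw [one_div]
      exact inv_anti₀ (lt_min (strength_pos (α := α) hn) (Real.sqrt_pos.2 hn')) (min_le_right _ _)
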